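/- Let $N\ge 2$. Let $g:\mathbb R\to\mathbb R$ be a bistable nonlinearity: $g$ is odd and of class $C^1$, and there are $0<\beta<\alpha$ such that $g>0$ on $(0,\alpha)$, $g<0$ on $(\alpha,+\infty)$, $g'>0$ on $[0,\beta)$, $g'<0$ on $(\beta,+\infty)$, $g$ is twice differentiable at $\pm\beta$, and $g''(\beta)<0$. For $U:\mathbb R^N\to\mathbb R$ and $1\le k<N$ let $\mathcal P_k^+U(x)$ be the sum of the $k$ largest eigenvalues (with multiplicity) of the Hessian matrix $D^2U(x)$. A radial solution of $\mathcal P_1^+U+g(U)=0$ is a pair $(R,u)$ with $0<R\le+\infty$ and $u:[0,R)\to\mathbb R$ such that: (1) $u$ is of class $C^1$ on $[0,R)$ and piecewise $C^2$, i.e. every interval $[0,T]$ with $0<T<R$ can be cut by finitely many points into closed intervals on each of which $u$ is $C^2$; (2) $u'(0)=0$; (3) $U(x):=u(|x|)$ satisfies $\mathcal P_1^+U(x)+g(U(x))=0$ at every point $x$ of the ball $B(0,R)$ at which $U$ is $C^2$; (4) if $R<+\infty$ then $|u(r)|+|u'(r)|\to+\infty$ as $r\nearrow R$ (maximality). It is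 oscillating if $R=+\infty$, $u\not\equiv0$, and the zeros of $u$ are unbounded. Then for every $\xi\in\mathbb R$ there is a unique radial solution $(R,u)$ with $u(0)=\xi$. Moreover, there is a unique $\xi^*\in(\beta,\alpha)$ with $$g(\beta)^2\int_\beta^{\xi^*}\frac{ds}{g(s)}=\int_\beta^\alpha g(s)\,ds,$$ and the solution starting from $\xi$ has the following properties. (i) If $\xi\in\{-\alpha,0,\alpha\}$, then $R=+\infty$ and $u$ is constant. (ii) If $\xi<-\alpha$, then $u'<0$ on $(0,R)$ and $u(r)\to-\infty$ as $r\nearrow R$. (iii) If $\xi>\alpha$, then $u'>0$ on $(0,R)$ and $u(r)\to+\infty$ as $r\nearrow R$. (iv) If $-\alpha<\xi<0$, then $R=+\infty$, $u'>0$ on $(0,+\infty)$ and $u(r)\to0$ as $r\to+\infty$. (v) (a) If $\xi^*<\xi<\alpha$, then $u'<0$ on $(0,R)$ and $u(r)\to-\infty$ as $r\nearrow R$. (b) If $\xi=\xi^*$, then $R=+\infty$, $u'<0$ on $(0,+\infty)$ and $u(r)\to-\alpha$ as $r\to+\infty$. (c) If $0<\xi<\xi^*$, then $R=+\infty$ and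 there is $b>0$ such that $u'<0$ on $(0,b)$, $u(b)<0$, $u'>0$ on $(b,+\infty)$, and $u(r)\to0$ as $r\to+\infty$. In particular, no radial solution is oscillating, and no nonconstant radial solution with $R=+\infty$ is periodic on $[0,+\infty)$. -/

import Mathlib

open Set Filter Topology

noncomputable section

namespace TruncLaplace

/-- Bistable nonlinearity: `g` is odd and `C¹`, positive on `(0, α)`, negative beyond `α`,
increasing on `[0, β)` and decreasing beyond `β`, with a nondegenerate maximum at `β`. -/
structure IsBistable (g : ℝ → ℝ) (α β : ℝ) : Prop where
  odd : ∀ s, g (-s) = -g s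
  contDiff : ContDiff ℝ 1 g
  beta_pos : 0 < β
  beta_lt_alpha : β < α
  pos : ∀ s ∈ Ioo 0 α, 0 < g s
  neg : ∀ s ∈ Ioi α, g s < 0
  deriv_pos : ∀ s ∈ Ico 0 β, 0 < deriv g s
  deriv_neg : ∀ s ∈ Ioi β, deriv g s < 0
  twice_diff_beta : DifferentiableAt ℝ (deriv g) β
  twice_diff_neg_beta : DifferentiableAt ℝ (deriv g) (-β)
  second_deriv_beta_neg : deriv (deriv g) β < 0

/-- The Hessian matrix `D²U(x)` in the standard basis of `ℝᴺ`. -/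
def hessian {N : ℕ} (U : EuclideanSpace ℝ (Fin N) → ℝ) (x : EuclideanSpace ℝ (Fin N)) :
    Matrix (Fin N) (Fin N) ℝ :=
  Matrix.of fun i j =>
    fderiv ℝ (fderiv ℝ U) x (EuclideanSpace.single i 1) (EuclideanSpace.single j 1)

/-- The real eigenvalues `λ₁ ≤ ⋯ ≤ λ_N` of a real matrix, in increasing order and counted with
multiplicity (a real symmetric `N × N` matrix has exactly `N` of them). -/
def sortedEigenvalues {N : ℕ} (M : Matrix (Fin N) (Fin N) ℝ) : List ℝ :=
  M.charpoly.roots.sort (· ≤ ·)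

/-- The truncated Laplacian `𝒫ₖ⁺U(x) = λ_{N-k+1} + ⋯ + λ_N`: the sum of the `k` largest
eigenvalues of the Hessian matrix. -/
def truncLaplacePlus {N : ℕ} (k : ℕ) (U : EuclideanSpace ℝ (Fin N) → ℝ)
    (x : EuclideanSpace ℝ (Fin N)) : ℝ :=
  ((sortedEigenvalues (hessian U x)).drop (N - k)).sum

/-- The half-open interval `[0, R)`, where `R` may be `+∞`. -/
def halfOpen (R : EReal) : Set ℝ := {r | 0 ≤ r ∧ (r : EReal) < R}

/-- The filter `r ↗ R` on the real line, where `R` may be `+∞`. -/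
def toLeft (R : EReal) : Filter ℝ := comap (fun r : ℝ => (r : EReal)) (𝓝[<] R)

theorem toLeft_top : toLeft ⊤ = atTop := by
  have h := (EReal.nhds_top_basis.comap (fun r : ℝ => (r : EReal)))
  have h2 : toLeft ⊤ = comap (fun r : ℝ => (r : EReal)) (𝓝 ⊤) := by
    rw [toLeft, nhdsWithin, comap_inf, inf_eq_left, comap_principal]
    have : (fun r : ℝ => (r : EReal)) ⁻¹' Iio ⊤ = univ := by
      ext r
      simp
    rw [this, principal_univ]
    exact le_top
  rw [h2]
  refine h.ext atTop_basis_Ioi ?_ ?_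
  · intro a _
    exact ⟨a, trivial, fun r hr => by simpa using hr⟩
  · intro a _
    exact ⟨a, trivial, fun r hr => by simpa using hr⟩

theorem toLeft_coe (R : ℝ) : toLeft (R : EReal) = 𝓝[<] R := by
  rw [toLeft, nhdsWithin, comap_inf, comap_principal, nhdsWithin,
    EReal.isOpenEmbedding_coe.isInducing.nhds_eq_comap R]
  congr 2
  ext r
  simp

/-- Piecewise `C²` on `[0, R)`: `u` is `C¹` on `[0, R)` and every compact interval `[0, T]` in
`[0, R)` is cut by finitely many points into closed intervals on each of which `u` is `C²`, up
to the end points. -/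
def PiecewiseC2 (R : EReal) (u : ℝ → ℝ) : Prop :=
  ContDiffOn ℝ 1 u (halfOpen R) ∧
  ∀ T : ℝ, 0 < T → (T : EReal) < R →
    ∃ (n : ℕ) (a : ℕ → ℝ), a 0 = 0 ∧ a n = T ∧
      ∀ i < n, a i < a (i + 1) ∧ ContDiffOn ℝ 2 u (Icc (a i) (a (i + 1)))

/-- A (maximal) radial solution `(R, u)` of `𝒫ₖ⁺U + g(U) = 0`, `U(x) = u(|x|)`. Only the values
of `u` on `[0, R)` matter. The equation is required at every point of the ball `B(0, R)` near
which `U` is `C²`, hence off the spheres on which `u''` jumps. -/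
structure IsRadialSolution (N k : ℕ) (g : ℝ → ℝ) (R : EReal) (u : ℝ → ℝ) : Prop where
  radius_pos : 0 < R
  piecewise : PiecewiseC2 R u
  deriv_zero : HasDerivWithinAt u 0 (Ici 0) 0
  equation : ∀ x : EuclideanSpace ℝ (Fin N), ((‖x‖ : ℝ) : EReal) < R →
    ContDiffAt ℝ 2 (fun y : EuclideanSpace ℝ (Fin N) => u ‖y‖) x →
    truncLaplacePlus k (fun y : EuclideanSpace ℝ (Fin N) => u ‖y‖) x + g (u ‖x‖) = 0
  maximal : R ≠ ⊤ → Tendsto (fun r => |u r| + |deriv u r|) (toLeft R) atTop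

/-- Oscillating: global, nontrivial, with an unbounded set of zeros. -/
def IsOscillating (R : EReal) (u : ℝ → ℝ) : Prop :=
  R = ⊤ ∧ (∃ r, 0 ≤ r ∧ u r ≠ 0) ∧ ∀ A : ℝ, ∃ r, A < r ∧ 0 ≤ r ∧ u r = 0

/-- Periodic: global, nonconstant, and invariant under some positive translation. -/
def IsNonconstantPeriodic (R : EReal) (u : ℝ → ℝ) : Prop :=
  R = ⊤ ∧ (∃ r, 0 ≤ r ∧ u r ≠ u 0) ∧ ∃ T : ℝ, 0 < T ∧ ∀ r, 0 ≤ r → u (r + T) = u r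

/-- `ξ` lies in `(β, α)` and `k g(β)² ∫_β^ξ ds / g(s) = ∫_β^α g(s) ds`. -/
def IsCriticalValue (k : ℕ) (g : ℝ → ℝ) (α β ξ : ℝ) : Prop :=
  ξ ∈ Ioo β α ∧ (k : ℝ) * g β ^ 2 * (∫ s in β..ξ, 1 / g s) = ∫ s in β..α, g s

end TruncLaplace

end

/-! Away from the origin the Hessian of `U` has the eigenvalue `u'/r` with multiplicity `N - 1` and
the eigenvalue `u''`, so for `N ≥ 2` the equation is `max (u'', u'/r) + g u = 0`. At each radius one
of two regimes holds: the free one, `u'' = -g u`, admissible when the excess `u' + r g u` is `≤ 0`;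
or the drift, `u' = -r g u`, for which `u'' + g u = r² g(u) g'(u)`, admissible where `g(u) g'(u) ≤
0`.

Uniqueness rests on a reflection formula. Put `P r = ∫₀ʳ g u`. Then `u' + P` is nonincreasing and
can move only while the excess vanishes, so `-(u' + P)` at `r` is the maximum over `s ≤ r` of `s g
(u s) - P s`. Hence `u'` depends on `u` in a Lipschitz way, and a weighted sup norm gives
`Reach.eqOn`. It then suffices to exhibit, for each `ξ`, one maximal solution of the claimed shape.

These are glued from free and drift pieces. A free piece conserves the energy `u'²/2 + G u`, `G`
being the potential, and its excess has derivative `r g'(u) u'`, whose sign tells how long the piece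
lasts. From `ξ ∈ (β, α)` the solution drifts down to `β`; separating variables, it arrives at `r₀`
with `r₀²/2 = ∫_β^ξ ds/g` and slope `-r₀ g(β)` (`exists_reach_beta`). The energy there is `g(β)²
∫_β^ξ ds/g + G β`, and `ξ*` is the value that makes it equal to `G α`. The free descent that follows
turns back inside `(-α, 0)`, tends to `-α`, or passes `-α` and goes to `-∞`, according to whether
this energy is less than, equal to or greater than `G α` (`exists_sol_subcritical`,
`exists_sol_critical`, `exists_sol_supercritical`). After turning back, `u` climbs freely, then
drifts to `0` without reaching it (`exists_sol_rest`), which excludes oscillation. For `0 < ξ ≤ β`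
the free descent starts at once and is subcritical. -/

namespace TruncLaplace

/-! ### Maximal solutions of autonomous `C¹` equations -/

section MaximalODE

variable {E : Type*} [NormedAddCommGroup E] [NormedSpace ℝ E]

theorem nhdsWithin_Icc_eq_left {a b c r : ℝ} (hb : r < b) (hbc : b ≤ c) :
    𝓝[Icc a c] r = 𝓝[Icc a b] r := by
  rw [← nhdsWithin_inter_of_mem' (s := Icc a c) (t := Iic b)
    (mem_nhdsWithin_of_mem_nhds (Iic_mem_nhds hb))]
  congr 1
  ext x
  simp only [mem_inter_iff, mem_Icc, mem_Iic]
  grind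

theorem nhdsWithin_Icc_eq_right {a b c r : ℝ} (hb : b < r) (hab : a ≤ b) :
    𝓝[Icc a c] r = 𝓝[Icc b c] r := by
  rw [← nhdsWithin_inter_of_mem' (s := Icc a c) (t := Ici b)
    (mem_nhdsWithin_of_mem_nhds (Ici_mem_nhds hb))]
  congr 1
  ext x
  simp only [mem_inter_iff, mem_Icc, mem_Ici]
  grind

/-- Derivatives within two adjacent intervals give derivatives within their union. -/
theorem hasDerivWithinAt_Icc_union {u v : ℝ → E} {a b c : ℝ} (hab : a ≤ b) (hbc : b ≤ c)
    (h₁ : ∀ r ∈ Icc a b, HasDerivWithinAt u (v r) (Icc a b) r)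
    (h₂ : ∀ r ∈ Icc b c, HasDerivWithinAt u (v r) (Icc b c) r) :
    ∀ r ∈ Icc a c, HasDerivWithinAt u (v r) (Icc a c) r := by
  intro r hr
  rcases lt_trichotomy r b with h | h | h
  · have := h₁ r ⟨hr.1, h.le⟩
    rw [HasDerivWithinAt, HasDerivAtFilter] at this ⊢
    rwa [nhdsWithin_Icc_eq_left h hbc]
  · rw [← Icc_union_Icc_eq_Icc hab hbc]
    exact (h₁ r ⟨hr.1, h.le⟩).union (h₂ r ⟨h.ge, hr.2⟩)
  · have := h₂ r ⟨h.le, hr.2⟩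
    rw [HasDerivWithinAt, HasDerivAtFilter] at this ⊢
    rwa [nhdsWithin_Icc_eq_right h hab]

theorem hasDerivWithinAt_Ici_of_Icc {u : ℝ → E} {d : E} {a b r : ℝ} (hr : r ∈ Ico a b)
    (h : HasDerivWithinAt u d (Icc a b) r) : HasDerivWithinAt u d (Ici r) r := by
  refine h.mono_of_mem_nhdsWithin ?_
  exact mem_of_superset (Icc_mem_nhdsGE hr.2) (Icc_subset_Icc_left hr.1)

/-- `y` solves `y' = f y` on `[a, b]`. -/
def SolvesOn (f : E → E) (y : ℝ → E) (a b : ℝ) : Prop :=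
  ∀ t ∈ Icc a b, HasDerivWithinAt y (f (y t)) (Icc a b) t

theorem SolvesOn.continuousOn {f : E → E} {y : ℝ → E} {a b : ℝ} (h : SolvesOn f y a b) :
    ContinuousOn y (Icc a b) := fun t ht => (h t ht).continuousWithinAt

theorem SolvesOn.mono {f : E → E} {y : ℝ → E} {a b b' : ℝ} (h : SolvesOn f y a b)
    (hb : b' ≤ b) : SolvesOn f y a b' := fun t ht =>
  (h t ⟨ht.1, ht.2.trans hb⟩).mono (Icc_subset_Icc_right hb)

theorem exists_lipschitzOnWith_closedBall [ProperSpace E] {f : E → E} (hf : ContDiff ℝ 1 f)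
    (M : ℝ) : ∃ K, LipschitzOnWith K f (Metric.closedBall 0 M) :=
  hf.locallyLipschitz.locallyLipschitzOn.exists_lipschitzOnWith_of_compact
    (isCompact_closedBall 0 M)

theorem SolvesOn.eqOn [ProperSpace E] {f : E → E} (hf : ContDiff ℝ 1 f) {y z : ℝ → E} {a b : ℝ}
    (hy : SolvesOn f y a b) (hz : SolvesOn f z a b) (h : y a = z a) : EqOn y z (Icc a b) := by
  obtain ⟨M₁, hM₁⟩ := (isCompact_Icc.image_of_continuousOn hy.continuousOn).isBounded.subset_closedBall 0
  obtain ⟨M₂, hM₂⟩ := (isCompact_Icc.image_of_continuousOn hz.continuousOn).isBounded.subset_closedBall 0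
  obtain ⟨K, hK⟩ := exists_lipschitzOnWith_closedBall hf (max M₁ M₂)
  refine ODE_solution_unique_of_mem_Icc_right (v := fun _ => f)
    (s := fun _ => Metric.closedBall 0 (max M₁ M₂)) (K := K) (fun _ _ => hK) hy.continuousOn
    (fun t ht => hasDerivWithinAt_Ici_of_Icc ht (hy t (Ico_subset_Icc_self ht))) ?_ hz.continuousOn
    (fun t ht => hasDerivWithinAt_Ici_of_Icc ht (hz t (Ico_subset_Icc_self ht))) ?_ h
  · exact fun t ht => Metric.closedBall_subset_closedBall (le_max_left _ _)
      (hM₁ (mem_image_of_mem _ (Ico_subset_Icc_self ht)))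
  · exact fun t ht => Metric.closedBall_subset_closedBall (le_max_right _ _)
      (hM₂ (mem_image_of_mem _ (Ico_subset_Icc_self ht)))

/-- On the ball of radius `M + 1` the field is bounded by `max C 0`, so a trajectory needs time more
than `1 / (max C 0 + 1)` to leave the unit ball around its starting point. The uniformity of `δ` is
what forces blow-up at a finite end point. -/
theorem exists_uniform_time [ProperSpace E] {f : E → E} (hf : ContDiff ℝ 1 f)
    (M : ℝ) : ∃ δ > 0, ∀ (a : ℝ) (x : E), ‖x‖ ≤ M →
      ∃ z : ℝ → E, z a = x ∧ SolvesOn f z a (a + δ) := by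
  obtain ⟨K, hK⟩ := exists_lipschitzOnWith_closedBall hf (M + 1)
  obtain ⟨C, hC⟩ := ((isCompact_closedBall (0 : E) (M + 1)).image hf.continuous).isBounded.subset_closedBall 0
  have hL : (C.toNNReal : ℝ) = max C 0 := Real.coe_toNNReal' C
  have hpos : 0 < 1 / (max C 0 + 1) := by positivity
  refine ⟨1 / (max C 0 + 1), hpos, fun a x hx => ?_⟩
  have hsub : Metric.closedBall x 1 ⊆ Metric.closedBall (0 : E) (M + 1) := by
    refine Metric.closedBall_subset_closedBall' ?_
    rw [dist_zero_right]; linarith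
  set δ := 1 / (max C 0 + 1) with hδ
  let t₀ : Icc a (a + δ) := ⟨a, le_rfl, by linarith⟩
  have hPL : IsPicardLindelof (fun _ => f) t₀ x 1 0 C.toNNReal K := by
    refine IsPicardLindelof.of_time_independent (fun y hy => ?_) (hK.mono hsub) ?_
    · have : f y ∈ Metric.closedBall 0 C := hC (mem_image_of_mem _ (hsub hy))
      rw [mem_closedBall_zero_iff] at this
      rw [hL]
      exact this.trans (le_max_left _ _)
    · simp only [t₀, hL, add_sub_cancel_left, sub_self, NNReal.coe_one, NNReal.coe_zero, sub_zero]
      rw [max_eq_left hpos.le, hδ, mul_one_div, div_le_one (by positivity)]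
      linarith
  exact hPL.exists_eq_forall_mem_Icc_hasDerivWithinAt₀

/-- Maximal solutions of autonomous `C¹` equations. -/
theorem exists_maximal_solution [ProperSpace E] {f : E → E}
    (hf : ContDiff ℝ 1 f) (a : ℝ) (x : E) :
    ∃ (R : EReal) (y : ℝ → E), (a : EReal) < R ∧ y a = x ∧
      (∀ b : ℝ, (b : EReal) < R → SolvesOn f y a b) ∧
      (R ≠ ⊤ → Tendsto (fun t => ‖y t‖) (toLeft R) atTop) := by
  classical
  let S : Set ℝ := {b | ∃ z : ℝ → E, z a = x ∧ SolvesOn f z a b}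
  have hdown : ∀ b ∈ S, ∀ c ≤ b, c ∈ S := fun b ⟨z, hz, hs⟩ c hc => ⟨z, hz, hs.mono hc⟩
  choose! Y hYa hYs using fun b (hb : b ∈ S) => hb
  -- Each solution `Y t` is read at its own end point; by uniqueness this agrees with every `Y b`,
  -- `b ≥ t`.
  let y : ℝ → E := fun t => Y t t
  have hy : ∀ b ∈ S, EqOn y (Y b) (Icc a b) := by
    intro b hb t ht
    have htS := hdown b hb t ht.2
    exact (hYs t htS).eqOn hf ((hYs b hb).mono ht.2) ((hYa t htS).trans (hYa b hb).symm)
      ⟨ht.1, le_rfl⟩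
  have hsolve : ∀ b ∈ S, SolvesOn f y a b := by
    intro b hb t ht
    rw [hy b hb ht]
    exact (hYs b hb t ht).congr (hy b hb) (hy b hb ht)
  let R : EReal := sSup ((fun b : ℝ => (b : EReal)) '' S)
  have hlt : ∀ b : ℝ, (b : EReal) < R → b ∈ S := by
    intro b hb
    obtain ⟨_, ⟨c, hc, rfl⟩, hbc⟩ := lt_sSup_iff.1 hb
    exact hdown c hc b (EReal.coe_le_coe_iff.1 hbc.le)
  have hle : ∀ b ∈ S, (b : EReal) ≤ R := fun b hb => le_sSup (mem_image_of_mem _ hb)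
  obtain ⟨δ, hδ, hloc⟩ := exists_uniform_time hf ‖x‖
  obtain ⟨z, hz⟩ := hloc a x le_rfl
  have haS : a + δ ∈ S := ⟨z, hz⟩
  have haR : (a : EReal) < R :=
    lt_of_lt_of_le (EReal.coe_lt_coe_iff.2 (by linarith)) (hle _ haS)
  have haS' : a ∈ S := hlt a haR
  refine ⟨R, y, haR, hYa a haS', fun b hb => hsolve b (hlt b hb), fun hR => ?_⟩
  induction hRR : R with
  | bot => rw [hRR] at haR; simp at haR
  | top => exact absurd hRR hR
  | coe ρ =>
    rw [toLeft_coe, tendsto_atTop]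
    by_contra! hcon
    obtain ⟨M, hM⟩ := hcon
    obtain ⟨δ, hδ, hloc⟩ := exists_uniform_time hf M
    have haρ : a < ρ := by rw [hRR] at haR; exact EReal.coe_lt_coe_iff.1 haR
    -- If `‖y t‖ < M` for times arbitrarily close to `ρ`, one with `t > ρ - δ` can be continued to
    -- `t + δ > ρ`, against the definition of `R`.
    have hev : ∀ᶠ t in 𝓝[<] ρ, max a (ρ - δ) < t ∧ t < ρ :=
      Ioo_mem_nhdsLT (max_lt haρ (by linarith))
    obtain ⟨t, htM, htl, htr⟩ := ((not_eventually.1 hM).and_eventually hev).exists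
    rw [max_lt_iff] at htl
    obtain ⟨z, hzt, hz⟩ := hloc t (y t) (not_not.1 htM).le
    have htS : t ∈ S := hlt t (by rw [hRR]; exact EReal.coe_lt_coe_iff.2 htr)
    have hmem : t + δ ∈ S := by
      have h1 : EqOn (fun s => if s ≤ t then y s else z s) y (Icc a t) := fun s hs => by
        simp [hs.2]
      have h2 : EqOn (fun s => if s ≤ t then y s else z s) z (Icc t (t + δ)) := fun s hs => by
        rcases hs.1.eq_or_lt with h | h
        · simp [← h, hzt]
        · simp [not_le.2 h]
      refine ⟨fun s => if s ≤ t then y s else z s, by simp [htl.1.le, y, hYa a haS'], ?_⟩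
      refine hasDerivWithinAt_Icc_union htl.1.le (by linarith) (fun s hs => ?_) (fun s hs => ?_)
      · rw [h1 hs]
        exact (hsolve t htS s hs).congr h1 (h1 hs)
      · rw [h2 hs]
        exact (hz s hs).congr h2 (h2 hs)
    have := hle _ hmem
    rw [hRR, EReal.coe_le_coe_iff] at this
    linarith

end MaximalODE

/-! ### Piecewise `C²` solutions of the radial equation -/

section Reach

variable {g u v u' v' : ℝ → ℝ} {a b c : ℝ}

/-- `w = u''` and `v = u'` satisfy `max (u'', u' / r) + g u = 0`, in a form that makes sense
for `r = 0` and is closed. -/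
def Balance (g : ℝ → ℝ) (r u v w : ℝ) : Prop :=
  w + g u ≤ 0 ∧ v + r * g u ≤ 0 ∧ (w + g u) * (v + r * g u) = 0

theorem balance_iff_max {g : ℝ → ℝ} {r u v w : ℝ} (hr : 0 < r) :
    Balance g r u v w ↔ max w (v / r) + g u = 0 := by
  have h1 : v + r * g u = r * (v / r + g u) := by field_simp
  have h2 : max w (v / r) + g u = max (w + g u) (v / r + g u) := (max_add_add_right _ _ _).symm
  rw [Balance, h2, h1]
  constructor
  · rintro ⟨h3, h4, h5⟩
    have h4' : v / r + g u ≤ 0 := by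
      by_contra! h; nlinarith [mul_pos hr h]
    rcases mul_eq_zero.1 h5 with h | h
    · rw [h]; exact max_eq_left h4'
    · rw [(mul_eq_zero.1 h).resolve_left hr.ne']; exact max_eq_right h3
  · intro h
    have h3 : w + g u ≤ 0 := (le_max_left _ _).trans h.le
    have h4 : v / r + g u ≤ 0 := (le_max_right _ _).trans h.le
    refine ⟨h3, mul_nonpos_of_nonneg_of_nonpos hr.le h4, ?_⟩
    rcases max_choice (w + g u) (v / r + g u) with h5 | h5
    · rw [h5] at h; rw [h, zero_mul]
    · rw [h5] at h; rw [h, mul_zero, mul_zero]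

/-- `u` is a `C²` solution on `[a, b]` with derivative `v`. -/
def Step (g u v : ℝ → ℝ) (a b : ℝ) : Prop :=
  a < b ∧ ∃ w : ℝ → ℝ, ContinuousOn w (Icc a b) ∧ ∀ r ∈ Icc a b,
    HasDerivWithinAt u (v r) (Icc a b) r ∧ HasDerivWithinAt v (w r) (Icc a b) r ∧
    Balance g r (u r) (v r) (w r)

/-- `u` is a piecewise `C²` solution on `[a, b]` with derivative `v`. -/
def Reach (g u v : ℝ → ℝ) : ℝ → ℝ → Prop := Relation.ReflTransGen (Step g u v)

/-- `u` is a piecewise `C²` solution on `[a, R)` with derivative `v`. -/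
def Sol (g : ℝ → ℝ) (a : ℝ) (R : EReal) (u v : ℝ → ℝ) : Prop :=
  ∀ T : ℝ, a ≤ T → (T : EReal) < R → Reach g u v a T

theorem Step.congr (h : Step g u v a b) (hu : EqOn u' u (Icc a b)) (hv : EqOn v' v (Icc a b)) :
    Step g u' v' a b := by
  obtain ⟨hab, w, hw, H⟩ := h
  refine ⟨hab, w, hw, fun r hr => ?_⟩
  obtain ⟨h1, h2, h3⟩ := H r hr
  rw [hu hr, hv hr]
  exact ⟨h1.congr hu (hu hr), h2.congr hv (hv hr), h3⟩

theorem Step.mono {a' b' : ℝ} (h : Step g u v a b) (ha : a ≤ a') (hab : a' < b') (hb : b' ≤ b) :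
    Step g u v a' b' := by
  obtain ⟨-, w, hw, H⟩ := h
  have hsub : Icc a' b' ⊆ Icc a b := Icc_subset_Icc ha hb
  exact ⟨hab, w, hw.mono hsub, fun r hr =>
    ⟨(H r (hsub hr)).1.mono hsub, (H r (hsub hr)).2.1.mono hsub, (H r (hsub hr)).2.2⟩⟩

theorem Reach.le (h : Reach g u v a b) : a ≤ b := by
  induction h with
  | refl => exact le_rfl
  | tail _ hs ih => exact ih.trans hs.1.le

theorem Reach.congr (h : Reach g u v a b) (hu : EqOn u' u (Icc a b)) (hv : EqOn v' v (Icc a b)) :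
    Reach g u' v' a b := by
  induction h with
  | refl => exact Relation.ReflTransGen.refl
  | @tail b c hr hs ih =>
    have hab := Reach.le hr
    exact (ih (hu.mono (Icc_subset_Icc_right hs.1.le)) (hv.mono (Icc_subset_Icc_right hs.1.le))).tail
      (hs.congr (hu.mono (Icc_subset_Icc_left hab)) (hv.mono (Icc_subset_Icc_left hab)))

theorem Reach.left (h : Reach g u v a b) (hac : a ≤ c) (hcb : c ≤ b) : Reach g u v a c := by
  induction h with
  | refl => rw [le_antisymm hcb hac]; exact Relation.ReflTransGen.refl
  | @tail b d hr hs ih =>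
    rcases le_or_gt c b with h | h
    · exact ih h
    · exact Relation.ReflTransGen.tail hr (hs.mono le_rfl h hcb)

theorem Reach.hasDerivWithinAt (h : Reach g u v a b) :
    ∀ r ∈ Icc a b, a < b → HasDerivWithinAt u (v r) (Icc a b) r := by
  induction h with
  | refl => exact fun r _ h => absurd h (lt_irrefl _)
  | @tail b c hr hs ih =>
    intro r hrr hac
    have hstep : ∀ r ∈ Icc b c, HasDerivWithinAt u (v r) (Icc b c) r := by
      obtain ⟨_, w, hw, H⟩ := hs
      exact fun r hr => (H r hr).1
    rcases (Reach.le hr).eq_or_lt with h | h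
    · subst h; exact hstep r hrr
    · exact hasDerivWithinAt_Icc_union h.le hs.1.le (fun r hr => ih r hr h) hstep r hrr

theorem Reach.continuousOn (h : Reach g u v a b) : ContinuousOn u (Icc a b) := by
  rcases h.le.eq_or_lt with hab | hab
  · rw [← hab, Icc_self]; exact continuousOn_singleton _ _
  · exact fun r hr => (h.hasDerivWithinAt r hr hab).continuousWithinAt

theorem Reach.continuousOn_deriv (h : Reach g u v a b) : ContinuousOn v (Icc a b) := by
  induction h with
  | refl => rw [Icc_self]; exact continuousOn_singleton _ _
  | @tail b c hr hs ih =>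
    have hstep : ContinuousOn v (Icc b c) := by
      obtain ⟨_, w, hw, H⟩ := hs
      exact fun r hr => (H r hr).2.1.continuousWithinAt
    rw [← Icc_union_Icc_eq_Icc (Reach.le hr) hs.1.le]
    exact ih.union_of_isClosed hstep isClosed_Icc isClosed_Icc

/-- The second derivative may jump between steps, so the equation survives only with one-sided
second derivatives; these suffice for the monotonicity arguments. -/
theorem Reach.right_deriv (h : Reach g u v a b) : ∀ r ∈ Ico a b, ∃ w,
    HasDerivWithinAt u (v r) (Ici r) r ∧ HasDerivWithinAt v w (Ici r) r ∧
    Balance g r (u r) (v r) w := by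
  induction h with
  | refl => intro r hr; simp at hr
  | @tail b c hr hs ih =>
    intro r hrr
    rcases lt_or_ge r b with h | h
    · exact ih r ⟨hrr.1, h⟩
    · obtain ⟨_, w, hw, H⟩ := hs
      obtain ⟨h1, h2, h3⟩ := H r ⟨h, hrr.2.le⟩
      exact ⟨w r, hasDerivWithinAt_Ici_of_Icc ⟨h, hrr.2⟩ h1,
        hasDerivWithinAt_Ici_of_Icc ⟨h, hrr.2⟩ h2, h3⟩

theorem Reach.left_deriv (h : Reach g u v a b) : ∀ r ∈ Ioc a b, ∃ w, ∃ c < r,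
    HasDerivWithinAt v w (Icc c r) r ∧ Balance g r (u r) (v r) w := by
  induction h with
  | refl => intro r hr; simp at hr
  | @tail b c hr hs ih =>
    intro r hrr
    rcases le_or_gt r b with h | h
    · exact ih r ⟨hrr.1, h⟩
    · obtain ⟨_, w, hw, H⟩ := hs
      obtain ⟨h1, h2, h3⟩ := H r ⟨h.le, hrr.2⟩
      exact ⟨w r, b, h, h2.mono (Icc_subset_Icc_right hrr.2), h3⟩

/-- Joining two solutions which match to first order at `c`. -/
theorem Reach.glue {u₁ v₁ u₂ v₂ : ℝ → ℝ} {R : EReal} (h₁ : Reach g u₁ v₁ a c)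
    (h₂ : Sol g c R u₂ v₂) (hu : u₁ c = u₂ c) (hv : v₁ c = v₂ c) :
    ∃ u v, Sol g a R u v ∧ EqOn u u₁ (Iic c) ∧ EqOn v v₁ (Iic c) ∧
      EqOn u u₂ (Ici c) ∧ EqOn v v₂ (Ici c) := by
  have key : ∀ p q : ℝ → ℝ, p c = q c → EqOn (fun r => if r ≤ c then p r else q r) p (Iic c) ∧
      EqOn (fun r => if r ≤ c then p r else q r) q (Ici c) := by
    intro p q hpq
    refine ⟨fun r hr => if_pos hr, fun r hr => ?_⟩
    rcases (mem_Ici.1 hr).eq_or_lt with h | h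
    · simp [← h, hpq]
    · exact if_neg (not_le.2 h)
  obtain ⟨hu1, hu2⟩ := key u₁ u₂ hu
  obtain ⟨hv1, hv2⟩ := key v₁ v₂ hv
  refine ⟨_, _, fun T haT hT => ?_, hu1, hv1, hu2, hv2⟩
  have hac : Reach g (fun r => if r ≤ c then u₁ r else u₂ r) (fun r => if r ≤ c then v₁ r else v₂ r)
      a c := h₁.congr (hu1.mono Icc_subset_Iic_self) (hv1.mono Icc_subset_Iic_self)
  rcases le_or_gt T c with h | h
  · exact hac.left haT h
  · exact Relation.ReflTransGen.trans hac ((h₂ T h.le hT).congr (hu2.mono Icc_subset_Ici_self)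
      (hv2.mono Icc_subset_Ici_self))

end Reach

/-! ### Uniqueness through a reflection formula -/

section Uniqueness

variable {g u v : ℝ → ℝ} {T : ℝ}

/-- The primitive `∫₀ʳ g (u s) ds` for `r ∈ [0, T]`. -/
noncomputable def prim (g u : ℝ → ℝ) (T r : ℝ) : ℝ :=
  ∫ s in (0 : ℝ)..r, g (u (max 0 (min s T)))

/-- Clamping `s` to `[0, T]` makes the integrand continuous on the whole line, so the primitive has
a two-sided derivative even at the end points. -/
theorem continuous_clamped (hg : Continuous g) (hT : 0 ≤ T) (hu : ContinuousOn u (Icc 0 T)) :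
    Continuous fun s => g (u (max 0 (min s T))) := by
  refine hg.comp (hu.comp_continuous (by fun_prop) fun s => ?_)
  exact ⟨le_max_left _ _, max_le hT (min_le_right _ _)⟩

theorem clamp_of_mem {s : ℝ} (hs : s ∈ Icc 0 T) : max 0 (min s T) = s := by
  rw [min_eq_left hs.2, max_eq_right hs.1]

theorem hasDerivAt_prim (hg : Continuous g) (hu : ContinuousOn u (Icc 0 T)) {r : ℝ}
    (hr : r ∈ Icc 0 T) : HasDerivAt (prim g u T) (g (u r)) r := by
  have h := (continuous_clamped hg (hr.1.trans hr.2) hu).integral_hasStrictDerivAt 0 r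
  rw [clamp_of_mem hr] at h
  exact h.hasDerivAt

theorem abs_prim_sub_prim_le {u₁ u₂ : ℝ → ℝ} (hg : Continuous g)
    (hu₁ : ContinuousOn u₁ (Icc 0 T)) (hu₂ : ContinuousOn u₂ (Icc 0 T)) {r C : ℝ}
    (hr : r ∈ Icc 0 T) (hC : ∀ s ∈ Icc 0 r, |g (u₁ s) - g (u₂ s)| ≤ C) :
    |prim g u₁ T r - prim g u₂ T r| ≤ C * r := by
  have hT := hr.1.trans hr.2
  rw [prim, prim, ← intervalIntegral.integral_sub
    ((continuous_clamped hg hT hu₁).intervalIntegrable _ _)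
    ((continuous_clamped hg hT hu₂).intervalIntegrable _ _)]
  have := intervalIntegral.norm_integral_le_of_norm_le_const (a := 0) (b := r) (C := C)
    (f := fun s => g (u₁ (max 0 (min s T))) - g (u₂ (max 0 (min s T)))) (fun s hs => ?_)
  · simpa [abs_of_nonneg hr.1] using this
  · rw [uIoc_of_le hr.1] at hs
    rw [clamp_of_mem ⟨hs.1.le, hs.2.trans hr.2⟩]
    exact hC s ⟨hs.1.le, hs.2⟩

/-- The right derivative is `u'' + g u`, which `Balance` makes nonpositive. -/
theorem Reach.antitoneOn_add_prim (hg : Continuous g) (h : Reach g u v 0 T) :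
    AntitoneOn (fun r => v r + prim g u T r) (Icc 0 T) := by
  have hcont : ContinuousOn (fun r => v r + prim g u T r) (Icc 0 T) :=
    h.continuousOn_deriv.add fun r hr =>
      (hasDerivAt_prim hg h.continuousOn hr).continuousAt.continuousWithinAt
  choose! w hw using h.right_deriv
  intro s hs r hr hsr
  have hsub : Icc s r ⊆ Icc 0 T := Icc_subset_Icc hs.1 hr.2
  refine image_le_of_deriv_right_le_deriv_boundary (f' := fun x => w x + g (u x))
    (B := fun _ => v s + prim g u T s) (B' := fun _ => 0) (hcont.mono hsub) (fun x hx => ?_) le_rfl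
    continuousOn_const (fun x _ => hasDerivWithinAt_const _ _ _) (fun x hx => ?_)
    (right_mem_Icc.2 hsr)
  · have hx' : x ∈ Ico 0 T := ⟨hs.1.trans hx.1, hx.2.trans_le hr.2⟩
    exact (hw x hx').2.1.add
      (hasDerivAt_prim hg h.continuousOn (Ico_subset_Icc_self hx')).hasDerivWithinAt
  · have hx' : x ∈ Ico 0 T := ⟨hs.1.trans hx.1, hx.2.trans_le hr.2⟩
    exact (hw x hx').2.2.1

/-- One half of the reflection formula: join `v s + s * g (u s) ≤ 0` with the monotonicity of `v +
prim g u T` between `s` and `r`. -/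
theorem Reach.le_reflection (hg : Continuous g) (h : Reach g u v 0 T) {r s : ℝ} (hT : 0 < T)
    (hr : r ∈ Icc 0 T) (hs : s ∈ Icc 0 r) :
    s * g (u s) - prim g u T s ≤ -(v r + prim g u T r) := by
  have hs' : s ∈ Icc 0 T := ⟨hs.1, hs.2.trans hr.2⟩
  have h1 := h.antitoneOn_add_prim hg hs' hr hs.2
  have h2 : v s + s * g (u s) ≤ 0 := by
    rcases hs'.1.eq_or_lt with h0 | h0
    · obtain ⟨w, -, -, hw⟩ := h.right_deriv s ⟨hs.1, by rw [← h0]; exact hT⟩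
      exact hw.2.1
    · obtain ⟨w, c, -, -, hw⟩ := h.left_deriv s ⟨h0, hs'.2⟩
      exact hw.2.1
  simp only at h1
  linarith

/-- The other half: equality holds at the last `s ≤ r` where the excess `v s + s * g (u s)`
vanishes. After it the other factor of `Balance` is zero, so `v + prim g u T` is constant. -/
theorem Reach.exists_eq_reflection (hg : Continuous g) (h : Reach g u v 0 T) (hv : v 0 = 0)
    {r : ℝ} (hr : r ∈ Icc 0 T) :
    ∃ s ∈ Icc 0 r, -(v r + prim g u T r) = s * g (u s) - prim g u T s := by
  have hsub : Icc 0 r ⊆ Icc 0 T := Icc_subset_Icc_right hr.2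
  have hpcont : ContinuousOn (fun s => v s + s * g (u s)) (Icc 0 r) :=
    (h.continuousOn_deriv.mono hsub).add
      (continuousOn_id.mul (hg.comp_continuousOn (h.continuousOn.mono hsub)))
  have hcont : ContinuousOn (fun r => v r + prim g u T r) (Icc 0 T) :=
    h.continuousOn_deriv.add fun r hr =>
      (hasDerivAt_prim hg h.continuousOn hr).continuousAt.continuousWithinAt
  have hcl : IsCompact (Icc 0 r ∩ (fun s => v s + s * g (u s)) ⁻¹' {0}) :=
    isCompact_Icc.of_isClosed_subset
      (hpcont.preimage_isClosed_of_isClosed isClosed_Icc isClosed_singleton) inter_subset_left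
  -- The excess vanishes at `0` because `v 0 = 0`.
  obtain ⟨s, ⟨hs, hps⟩, hmax⟩ := hcl.exists_isGreatest ⟨0, ⟨le_rfl, hr.1⟩, by simp [hv]⟩
  refine ⟨s, hs, ?_⟩
  have hps' : v s + s * g (u s) = 0 := hps
  suffices hconst : v r + prim g u T r = v s + prim g u T s by rw [hconst]; linarith
  rcases hs.2.eq_or_lt with hsr | hsr
  · rw [hsr]
  choose! w hw using h.right_deriv
  have hcont' : ContinuousOn (fun r => v r + prim g u T r) (Icc s r) :=
    hcont.mono (Icc_subset_Icc hs.1 hr.2)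
  -- At `s` itself the factor `w + g u` need not vanish, so constancy is shown on `Ioc s r` and
  -- extended to `s` by continuity.
  have hE : EqOn (fun x => v x + prim g u T x) (fun _ => v r + prim g u T r) (Ioc s r) := by
    intro x hx
    refine (constant_of_has_deriv_right_zero
      (hcont'.mono (Icc_subset_Icc_left hx.1.le)) (fun y hy => ?_) r ⟨hx.2, le_rfl⟩).symm
    have hy' : y ∈ Ico 0 T := ⟨hs.1.trans (hx.1.le.trans hy.1), hy.2.trans_le hr.2⟩
    obtain ⟨-, h2, h3, h4, h5⟩ := hw y hy'
    have hne : v y + y * g (u y) ≠ 0 := fun h0 =>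
      absurd (hmax ⟨⟨hy'.1, hy.2.le⟩, h0⟩) (not_le.2 (hx.1.trans_le hy.1))
    have := h2.add
      (hasDerivAt_prim hg h.continuousOn (Ico_subset_Icc_self hy')).hasDerivWithinAt
    rwa [(mul_eq_zero.1 h5).resolve_right hne] at this
  have := hE.of_subset_closure hcont' continuousOn_const Ioc_subset_Icc_self
    (by rw [closure_Ioc hsr.ne])
  exact (this (left_mem_Icc.2 hsr.le)).symm

/-- Both halves of the formula are taken at the `s` that is optimal for the first solution. The
three copies of `C * T` bound the differences of the primitives at `r`, of the primitives at `s`,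
and of `s * g (u s)`. -/
theorem Reach.deriv_sub_le {u₁ v₁ u₂ v₂ : ℝ → ℝ} (hg : Continuous g) (h₁ : Reach g u₁ v₁ 0 T)
    (h₂ : Reach g u₂ v₂ 0 T) (hv₁ : v₁ 0 = 0) (hT : 0 < T) {r C : ℝ}
    (hr : r ∈ Icc 0 T) (hC : ∀ s ∈ Icc 0 r, |g (u₁ s) - g (u₂ s)| ≤ C) :
    v₂ r - v₁ r ≤ 3 * (C * T) := by
  obtain ⟨s, hs, he⟩ := h₁.exists_eq_reflection hg hv₁ hr
  have hle := h₂.le_reflection hg hT hr hs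
  have hC0 : 0 ≤ C := (abs_nonneg _).trans (hC s hs)
  have hb : ∀ t ∈ Icc 0 r, |prim g u₁ T t - prim g u₂ T t| ≤ C * T := fun t ht =>
    (abs_prim_sub_prim_le hg h₁.continuousOn h₂.continuousOn ⟨ht.1, ht.2.trans hr.2⟩
      fun x hx => hC x ⟨hx.1, hx.2.trans ht.2⟩).trans
      (mul_le_mul_of_nonneg_left (ht.2.trans hr.2) hC0)
  have h1 := abs_le.1 (hb r (right_mem_Icc.2 hr.1))
  have h2 := abs_le.1 (hb s hs)
  have h3 : s * (g (u₁ s) - g (u₂ s)) ≤ C * T := by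
    have := (abs_le.1 (hC s hs)).2
    calc s * (g (u₁ s) - g (u₂ s)) ≤ s * C := mul_le_mul_of_nonneg_left this hs.1
      _ ≤ T * C := mul_le_mul_of_nonneg_right (hs.2.trans hr.2) hC0
      _ = C * T := mul_comm _ _
  nlinarith

/-- When the excess vanishes the equation does not determine `u''`, so uniqueness for second order
equations does not apply. Instead `deriv_sub_le` bounds `v₁ - v₂` by the sup of `u₁ - u₂`, and in
the norm weighted by `exp (-(lam * s))` one integration gains a factor `1/2`. -/
theorem Reach.eqOn {u₁ v₁ u₂ v₂ : ℝ → ℝ} (hg : ContDiff ℝ 1 g) (h₁ : Reach g u₁ v₁ 0 T)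
    (h₂ : Reach g u₂ v₂ 0 T) (hv₁ : v₁ 0 = 0) (hv₂ : v₂ 0 = 0) (h0 : u₁ 0 = u₂ 0) :
    EqOn u₁ u₂ (Icc 0 T) ∧ EqOn v₁ v₂ (Icc 0 T) := by
  rcases h₁.le.eq_or_lt with hT | hT
  · subst hT
    simp [h0, hv₁, hv₂]
  have hu : EqOn u₁ u₂ (Icc 0 T) := by
    obtain ⟨K, hK⟩ := hg.locallyLipschitz.locallyLipschitzOn.exists_lipschitzOnWith_of_compact
      ((isCompact_Icc.image_of_continuousOn h₁.continuousOn).union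
        (isCompact_Icc.image_of_continuousOn h₂.continuousOn))
    have hgl : ∀ s ∈ Icc 0 T, |g (u₁ s) - g (u₂ s)| ≤ K * |u₁ s - u₂ s| := fun s hs => by
      simpa [Real.dist_eq] using hK.dist_le_mul (u₁ s) (Or.inl (mem_image_of_mem _ hs)) (u₂ s)
        (Or.inr (mem_image_of_mem _ hs))
    have hK0 : (0 : ℝ) ≤ K := K.2
    -- Since `lam ≥ 6 K T`, the bound `3 K T M exp (lam r)` on `|v₁ - v₂|` is at most the derivative
    -- of `(M / 2) exp (lam r)`.
    set lam : ℝ := 6 * K * T + 1 with hlam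
    have hlam0 : 0 ≤ lam := by positivity
    have hcont : ContinuousOn (fun s => |u₁ s - u₂ s| * Real.exp (-(lam * s))) (Icc 0 T) :=
      (h₁.continuousOn.sub h₂.continuousOn).abs.mul (by fun_prop)
    obtain ⟨s₀, hs₀, hmax⟩ := isCompact_Icc.exists_isMaxOn (nonempty_Icc.2 hT.le) hcont
    set M := |u₁ s₀ - u₂ s₀| * Real.exp (-(lam * s₀)) with hM
    have hM0 : 0 ≤ M := by positivity
    have hbd : ∀ s ∈ Icc 0 T, |u₁ s - u₂ s| ≤ M * Real.exp (lam * s) := fun s hs => by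
      have : |u₁ s - u₂ s| * Real.exp (-(lam * s)) ≤ M := hmax hs
      rwa [Real.exp_neg, ← div_eq_mul_inv, div_le_iff₀ (Real.exp_pos _)] at this
    have hder : ∀ r ∈ Ico 0 T, ‖v₁ r - v₂ r‖ ≤ M / 2 * (lam * Real.exp (lam * r)) := by
      intro r hr
      have hr' := Ico_subset_Icc_self hr
      have hC : ∀ s ∈ Icc 0 r, |g (u₁ s) - g (u₂ s)| ≤ K * (M * Real.exp (lam * r)) := by
        intro s hs
        have hs' : s ∈ Icc 0 T := ⟨hs.1, hs.2.trans hr'.2⟩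
        refine (hgl s hs').trans (mul_le_mul_of_nonneg_left ((hbd s hs').trans ?_) hK0)
        gcongr
        exact hs.2
      have e1 := h₁.deriv_sub_le hg.continuous h₂ hv₁ hT hr' hC
      have e2 := h₂.deriv_sub_le hg.continuous h₁ hv₂ hT hr' (fun s hs => by
        rw [abs_sub_comm]; exact hC s hs)
      have e3 : 0 ≤ M * Real.exp (lam * r) := by positivity
      have e4 : 3 * (K * (M * Real.exp (lam * r)) * T) ≤ M / 2 * (lam * Real.exp (lam * r)) := by
        rw [hlam]; nlinarith
      rw [Real.norm_eq_abs, abs_le]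
      constructor <;> linarith
    have hfin : ∀ s ∈ Icc 0 T, ‖u₁ s - u₂ s‖ ≤ M / 2 * Real.exp (lam * s) := by
      intro s hs
      refine image_norm_le_of_norm_deriv_right_le_deriv_boundary (f := fun s => u₁ s - u₂ s)
        (f' := fun s => v₁ s - v₂ s) (B := fun s => M / 2 * Real.exp (lam * s))
        (B' := fun s => M / 2 * (lam * Real.exp (lam * s)))
        (h₁.continuousOn.sub h₂.continuousOn) (fun x hx => ?_) ?_ (fun x => ?_) hder hs
      · exact (hasDerivWithinAt_Ici_of_Icc hx (h₁.hasDerivWithinAt x (Ico_subset_Icc_self hx) hT)).sub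
          (hasDerivWithinAt_Ici_of_Icc hx (h₂.hasDerivWithinAt x (Ico_subset_Icc_self hx) hT))
      · simp [h0]; positivity
      · have : HasDerivAt (fun s => Real.exp (lam * s)) (Real.exp (lam * x) * (lam * 1)) x :=
          ((hasDerivAt_id x).const_mul lam).exp
        exact (this.const_mul (M / 2)).congr_deriv (by ring)
    have hM2 : M ≤ M / 2 := by
      have := hfin s₀ hs₀
      rw [Real.norm_eq_abs, ← div_le_iff₀ (Real.exp_pos _), div_eq_mul_inv, ← Real.exp_neg] at this
      exact this
    intro s hs
    have := hbd s hs
    rw [show M = 0 by linarith, zero_mul] at this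
    exact sub_eq_zero.1 (abs_nonpos_iff.1 this)
  refine ⟨hu, fun r hr => ?_⟩
  exact ((uniqueDiffOn_Icc hT) r hr).eq_deriv _ (h₁.hasDerivWithinAt r hr hT)
    ((h₂.hasDerivWithinAt r hr hT).congr hu (hu hr))

/-- Two maximal solutions with the same initial value coincide. -/
theorem Sol.unique {u₁ v₁ u₂ v₂ : ℝ → ℝ} {R₁ R₂ : EReal} (hg : ContDiff ℝ 1 g)
    (h₁ : Sol g 0 R₁ u₁ v₁) (h₂ : Sol g 0 R₂ u₂ v₂) (hR₁ : 0 < R₁) (hR₂ : 0 < R₂)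
    (hv₁ : v₁ 0 = 0) (hv₂ : v₂ 0 = 0) (h0 : u₁ 0 = u₂ 0)
    (hm₁ : R₁ ≠ ⊤ → Tendsto (fun r => |u₁ r| + |v₁ r|) (toLeft R₁) atTop)
    (hm₂ : R₂ ≠ ⊤ → Tendsto (fun r => |u₂ r| + |v₂ r|) (toLeft R₂) atTop) :
    R₁ = R₂ ∧ EqOn u₁ u₂ (halfOpen R₁) ∧ EqOn v₁ v₂ (halfOpen R₁) := by
  have key : ∀ (u₁ v₁ u₂ v₂ : ℝ → ℝ) (R₁ R₂ : EReal), Sol g 0 R₁ u₁ v₁ → Sol g 0 R₂ u₂ v₂ →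
      0 < R₁ → v₁ 0 = 0 → v₂ 0 = 0 → u₁ 0 = u₂ 0 →
      (R₁ ≠ ⊤ → Tendsto (fun r => |u₁ r| + |v₁ r|) (toLeft R₁) atTop) → R₂ ≤ R₁ := by
    intro u₁ v₁ u₂ v₂ R₁ R₂ h₁ h₂ hR₁ hv₁ hv₂ h0 hm
    -- If `R₁ < R₂`, the second solution stays bounded up to `R₁`, yet it coincides before `R₁` with
    -- the first, which blows up there.
    by_contra! hlt
    have htop : R₁ ≠ ⊤ := (hlt.trans_le le_top).ne
    have hm := hm htop
    lift R₁ to ℝ using ⟨htop, (bot_le.trans_lt hR₁).ne'⟩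
    have hR : 0 < R₁ := EReal.coe_pos.1 hR₁
    have hreach := h₂ R₁ hR.le hlt
    rw [toLeft_coe] at hm
    have hc : ContinuousOn (fun r => |u₂ r| + |v₂ r|) (Icc 0 R₁) :=
      hreach.continuousOn.abs.add hreach.continuousOn_deriv.abs
    have ht : Tendsto (fun r => |u₂ r| + |v₂ r|) (𝓝[<] R₁) (𝓝 (|u₂ R₁| + |v₂ R₁|)) :=
      (hc R₁ (right_mem_Icc.2 hR.le)).mono_left (by
        rw [← nhdsWithin_Ioo_eq_nhdsLT hR]
        exact nhdsWithin_mono _ Ioo_subset_Icc_self)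
    refine not_tendsto_nhds_of_tendsto_atTop hm _ (ht.congr' ?_)
    filter_upwards [Ioo_mem_nhdsLT hR] with r hr
    obtain ⟨e1, e2⟩ := (h₁ r hr.1.le (EReal.coe_lt_coe_iff.2 hr.2)).eqOn hg
      (hreach.left hr.1.le hr.2.le) hv₁ hv₂ h0
    have hrr : r ∈ Icc 0 r := right_mem_Icc.2 hr.1.le
    rw [e1 hrr, e2 hrr]
  have hR : R₁ = R₂ := le_antisymm (key _ _ _ _ _ _ h₂ h₁ hR₂ hv₂ hv₁ h0.symm hm₂)
    (key _ _ _ _ _ _ h₁ h₂ hR₁ hv₁ hv₂ h0 hm₁)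
  subst hR
  refine ⟨rfl, fun r hr => ?_, fun r hr => ?_⟩
  · exact ((h₁ r hr.1 hr.2).eqOn hg (h₂ r hr.1 hr.2) hv₁ hv₂ h0).1 (right_mem_Icc.2 hr.1)
  · exact ((h₁ r hr.1 hr.2).eqOn hg (h₂ r hr.1 hr.2) hv₁ hv₂ h0).2 (right_mem_Icc.2 hr.1)

end Uniqueness

/-! ### Eigenvalues of a scalar matrix plus a rank one matrix -/

section Spectrum

open Polynomial in
-- As `e` is a unit vector, the rank one part has characteristic polynomial `X ^ N - c X ^ (N - 1)`;
-- adding `a` times the identity shifts the variable.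
theorem charpoly_scalar_add_rankOne {N : ℕ} (hN : 0 < N) (a c : ℝ) {e : Fin N → ℝ}
    (he : e ⬝ᵥ e = 1) :
    (Matrix.scalar (Fin N) a + c • Matrix.vecMulVec e e).charpoly =
      (X - C a) ^ (N - 1) * (X - C (a + c)) := by
  have h1 : Matrix.scalar (Fin N) a + c • Matrix.vecMulVec e e =
      Matrix.vecMulVec (c • e) e - Matrix.scalar (Fin N) (-a) := by
    rw [Matrix.smul_vecMulVec, map_neg, sub_neg_eq_add, add_comm]
  rw [h1, Matrix.charpoly_sub_scalar, Matrix.charpoly_vecMulVec, smul_dotProduct, he]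
  obtain ⟨n, rfl⟩ := Nat.exists_eq_succ_of_ne_zero hN.ne'
  simp only [Fintype.card_fin, Nat.succ_eq_add_one, Nat.add_sub_cancel, smul_eq_mul, mul_one,
    sub_comp, pow_comp, X_comp, mul_comp, C_comp, smul_eq_C_mul, map_neg, map_add]
  ring

/-- The largest eigenvalue of a matrix with eigenvalues `a` (`N - 1` times) and `a + c`. -/
theorem sum_drop_sortedEigenvalues {N : ℕ} (hN : 2 ≤ N) (a c : ℝ) {e : Fin N → ℝ}
    (he : e ⬝ᵥ e = 1) :
    ((sortedEigenvalues (Matrix.scalar (Fin N) a + c • Matrix.vecMulVec e e)).drop (N - 1)).sum =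
      max a (a + c) := by
  set l := sortedEigenvalues (Matrix.scalar (Fin N) a + c • Matrix.vecMulVec e e) with hl
  have hroots : (Matrix.scalar (Fin N) a + c • Matrix.vecMulVec e e).charpoly.roots =
      (N - 1) • {a} + {a + c} := by
    rw [charpoly_scalar_add_rankOne (by omega) a c he, Polynomial.roots_mul, Polynomial.roots_pow,
      Polynomial.roots_X_sub_C, Polynomial.roots_X_sub_C]
    exact mul_ne_zero (pow_ne_zero _ (Polynomial.X_sub_C_ne_zero _)) (Polynomial.X_sub_C_ne_zero _)
  have hmem : ∀ x, x ∈ l ↔ x = a ∨ x = a + c := by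
    intro x
    rw [hl, sortedEigenvalues, Multiset.mem_sort, hroots, Multiset.mem_add,
      Multiset.mem_nsmul_of_ne_zero (by omega), Multiset.mem_singleton, Multiset.mem_singleton]
  have hlen : l.length = N := by
    rw [hl, sortedEigenvalues, Multiset.length_sort, hroots]
    simp; omega
  have hsort : l.Pairwise (· ≤ ·) := Multiset.pairwise_sort _ _
  obtain ⟨x, hx⟩ : ∃ x, l.drop (N - 1) = [x] := by
    rw [← List.length_eq_one_iff, List.length_drop, hlen]; omega
  have hsplit := List.take_append_drop (N - 1) l
  rw [hx] at hsplit
  rw [← hsplit, List.pairwise_append] at hsort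
  have hle : ∀ y ∈ l, y ≤ x := by
    intro y hy
    rw [← hsplit, List.mem_append] at hy
    rcases hy with hy | hy
    · exact hsort.2.2 y hy x (by simp)
    · rw [List.mem_singleton.1 hy]
  have hxl : x ∈ l := by rw [← hsplit]; simp
  have h1 := hle a ((hmem a).2 (Or.inl rfl))
  have h2 := hle (a + c) ((hmem _).2 (Or.inr rfl))
  rw [hx, List.sum_singleton]
  refine le_antisymm ?_ (max_le h1 h2)
  rcases (hmem x).1 hxl with h | h
  · rw [h]; exact le_max_left _ _
  · rw [h]; exact le_max_right _ _

end Spectrum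

/-! ### The Hessian of a radial function -/

section Radial

variable {N : ℕ}

local notation "𝔼" => EuclideanSpace ℝ (Fin N)

theorem hasFDerivAt_norm {F : Type*} [NormedAddCommGroup F] [InnerProductSpace ℝ F] {y : F}
    (hy : y ≠ 0) : HasFDerivAt (fun y : F => ‖y‖) (‖y‖⁻¹ • innerSL ℝ y) y := by
  have h := (hasStrictFDerivAt_norm_sq y).hasFDerivAt.sqrt (by simpa using hy)
  simp only [Real.sqrt_sq (norm_nonneg _)] at h
  convert h using 1
  rw [← Nat.cast_smul_eq_nsmul ℝ, smul_smul]
  congr 1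
  have := norm_ne_zero_iff.2 hy
  field_simp
  norm_num

theorem contDiffAt_radial {u : ℝ → ℝ} {x : 𝔼} (hx : x ≠ 0) (hu : ContDiffAt ℝ 2 u ‖x‖) :
    ContDiffAt ℝ 2 (fun y : 𝔼 => u ‖y‖) x :=
  hu.comp x (contDiffAt_norm ℝ hx)

theorem contDiffAt_profile {u : ℝ → ℝ} {x : 𝔼} (hx : x ≠ 0)
    (hU : ContDiffAt ℝ 2 (fun y : 𝔼 => u ‖y‖) x) : ContDiffAt ℝ 2 u ‖x‖ := by
  have hn : 0 < ‖x‖ := norm_pos_iff.2 hx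
  have h1 : ContDiffAt ℝ 2 (fun t : ℝ => t • (‖x‖⁻¹ • x)) ‖x‖ := by fun_prop
  have h2 : (fun t : ℝ => t • (‖x‖⁻¹ • x)) ‖x‖ = x := by
    simp only [smul_smul, mul_inv_cancel₀ hn.ne', one_smul]
  have h3 : ContDiffAt ℝ 2 (fun y : 𝔼 => u ‖y‖) ((fun t : ℝ => t • (‖x‖⁻¹ • x)) ‖x‖) := by
    rw [h2]; exact hU
  refine (h3.comp ‖x‖ h1).congr_of_eventuallyEq ?_
  filter_upwards [Ioi_mem_nhds hn] with t ht
  have ht : 0 < t := ht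
  simp [norm_smul, abs_of_pos ht, inv_mul_cancel₀ hn.ne']

/-- The Hessian of a radial function away from the origin. -/
theorem hessian_radial {u : ℝ → ℝ} {x : 𝔼} (hx : x ≠ 0) (hu : ContDiffAt ℝ 2 u ‖x‖) :
    hessian (fun y : 𝔼 => u ‖y‖) x =
      Matrix.scalar (Fin N) (deriv u ‖x‖ / ‖x‖) +
        (deriv (deriv u) ‖x‖ - deriv u ‖x‖ / ‖x‖) •
          Matrix.vecMulVec (fun i => x i / ‖x‖) (fun i => x i / ‖x‖) := by
  have hn : 0 < ‖x‖ := norm_pos_iff.2 hx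
  have hd : ∀ᶠ y in 𝓝 x, fderiv ℝ (fun y : 𝔼 => u ‖y‖) y =
      (deriv u ‖y‖ / ‖y‖) • innerSL ℝ y := by
    have h1 : ∀ᶠ r in 𝓝 ‖x‖, ContDiffAt ℝ 2 u r := hu.eventually (by simp)
    filter_upwards [continuous_norm.continuousAt.eventually h1, isOpen_ne.mem_nhds hx] with y hy hy0
    have hdu : HasDerivAt u (deriv u ‖y‖) ‖y‖ := (hy.differentiableAt (by simp)).hasDerivAt
    have := (hdu.comp_hasFDerivAt y (hasFDerivAt_norm hy0)).fderiv
    rw [smul_smul] at this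
    rw [div_eq_mul_inv]
    exact this
  have hd2 : DifferentiableAt ℝ (deriv u) ‖x‖ := by
    have : ContDiffAt ℝ 1 (deriv u) ‖x‖ := by
      have h2 : ContDiffAt ℝ 1 (fderiv ℝ u) ‖x‖ := hu.fderiv_right (by norm_num)
      exact h2.clm_apply contDiffAt_const
    exact this.differentiableAt (by simp)
  have hphi : HasDerivAt (fun r => deriv u r / r)
      ((deriv (deriv u) ‖x‖ * ‖x‖ - deriv u ‖x‖ * 1) / ‖x‖ ^ 2) ‖x‖ :=
    hd2.hasDerivAt.div (hasDerivAt_id _) hn.ne'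
  have hF := (hphi.comp_hasFDerivAt x (hasFDerivAt_norm hx)).smul
    (innerSL ℝ : 𝔼 →L[ℝ] 𝔼 →L[ℝ] ℝ).hasFDerivAt
  have hF2 : fderiv ℝ (fderiv ℝ (fun y : 𝔼 => u ‖y‖)) x = _ :=
    (hF.congr_of_eventuallyEq hd).fderiv
  ext i j
  rw [hessian, Matrix.of_apply, hF2]
  have e1 : ∀ y : 𝔼, ∀ k, innerSL ℝ y (EuclideanSpace.single k 1) = y k := fun y k => by
    rw [innerSL_apply_apply, EuclideanSpace.inner_single_right]; simp
  by_cases hij : i = j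
  · subst hij
    simp [Matrix.vecMulVec_apply, e1]
    field_simp
  · simp [Matrix.vecMulVec_apply, hij, e1, Ne.symm hij]
    field_simp

end Radial

/-! ### The truncated Laplacian of a radial function, off the origin and at it -/

section RadialEquation

variable {N : ℕ}

local notation "𝔼" => EuclideanSpace ℝ (Fin N)

/-- `𝒫₁⁺` of a radial function away from the origin. -/
theorem truncLaplacePlus_radial (hN : 2 ≤ N) {u : ℝ → ℝ} {x : 𝔼} (hx : x ≠ 0)
    (hu : ContDiffAt ℝ 2 u ‖x‖) :
    truncLaplacePlus 1 (fun y : 𝔼 => u ‖y‖) x =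
      max (deriv (deriv u) ‖x‖) (deriv u ‖x‖ / ‖x‖) := by
  have hn : 0 < ‖x‖ := norm_pos_iff.2 hx
  have he : (fun i => x i / ‖x‖) ⬝ᵥ (fun i => x i / ‖x‖) = 1 := by
    have := EuclideanSpace.real_norm_sq_eq x
    simp only [dotProduct, ← pow_two, div_pow, ← Finset.sum_div]
    rw [← this, div_self (by positivity)]
  rw [truncLaplacePlus, hessian_radial hx hu, sum_drop_sortedEigenvalues hN _ _ he, max_comm]
  congr 1
  ring

/-- The equation extends from small spheres to the origin, wherever the radial function is
`C²`. -/
theorem truncLaplacePlus_radial_zero (hN : 2 ≤ N) {g u : ℝ → ℝ} (hg : Continuous g)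
    (hU : ContDiffAt ℝ 2 (fun y : 𝔼 => u ‖y‖) 0)
    (hev : ∀ᶠ t in 𝓝[>] (0 : ℝ), ContDiffAt ℝ 2 u t →
      max (deriv (deriv u) t) (deriv u t / t) + g (u t) = 0) :
    truncLaplacePlus 1 (fun y : 𝔼 => u ‖y‖) 0 + g (u 0) = 0 := by
  set H : 𝔼 → Matrix (Fin N) (Fin N) ℝ := hessian (fun y : 𝔼 => u ‖y‖) with hH
  -- The origin is approached along the coordinate axes: on the `k`-th one the Hessian is diagonal,
  -- with entry `u''` at `k` and `u'/t` elsewhere.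
  have hpath : ∀ k : Fin N, Tendsto (fun t : ℝ => (EuclideanSpace.single k t : 𝔼)) (𝓝[>] 0) (𝓝 0) := by
    intro k
    have h1 : Continuous fun t : ℝ => (t • EuclideanSpace.single k 1 : 𝔼) := by fun_prop
    have h2 := (h1.tendsto 0).mono_left (nhdsWithin_le_nhds (s := Ioi 0))
    rw [zero_smul] at h2
    refine h2.congr fun t => ?_
    ext l
    by_cases h : l = k <;> simp [h]
  have hcont : ∀ i j, ContinuousAt (fun x => H x i j) 0 := by
    intro i j
    have h1 : ContDiffAt ℝ 1 (fderiv ℝ (fun y : 𝔼 => u ‖y‖)) 0 := hU.fderiv_right (by norm_num)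
    have h2 : ContDiffAt ℝ 0 (fderiv ℝ (fderiv ℝ (fun y : 𝔼 => u ‖y‖))) 0 :=
      h1.fderiv_right (by norm_num)
    exact (h2.continuousAt.clm_apply continuousAt_const).clm_apply continuousAt_const
  have hlim : ∀ k i j, Tendsto (fun t : ℝ => H (EuclideanSpace.single k t) i j) (𝓝[>] 0)
      (𝓝 (H 0 i j)) := fun k i j => (hcont i j).tendsto.comp (hpath k)
  have hC2 : ∀ᶠ t in 𝓝[>] (0 : ℝ), ContDiffAt ℝ 2 u t := by
    filter_upwards [(hpath ⟨0, by omega⟩).eventually (hU.eventually (by simp)),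
      self_mem_nhdsWithin] with t ht ht0
    have ht0 : 0 < t := ht0
    have := contDiffAt_profile (by simpa using ht0.ne') ht
    simpa [abs_of_pos ht0] using this
  have hform : ∀ k i j, ∀ᶠ t in 𝓝[>] (0 : ℝ), H (EuclideanSpace.single k t) i j =
      (if i = j then deriv u t / t else 0) +
        (deriv (deriv u) t - deriv u t / t) * ((if i = k then 1 else 0) * (if j = k then 1 else 0)) := by
    intro k i j
    filter_upwards [hC2, self_mem_nhdsWithin] with t ht ht0
    have ht0 : 0 < t := ht0
    have hn : ‖(EuclideanSpace.single k t : 𝔼)‖ = t := by simp [abs_of_pos ht0]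
    rw [hH, hessian_radial (by simpa using ht0.ne') (by rwa [hn]), hn]
    have h3 : ∀ l, (EuclideanSpace.single k t : 𝔼) l / t = if l = k then 1 else 0 := by
      intro l
      by_cases h : l = k
      · simp [h, ht0.ne']
      · simp [h]
    simp only [Matrix.add_apply, Matrix.smul_apply, Matrix.vecMulVec_apply, h3, smul_eq_mul,
      Matrix.scalar_apply, Matrix.diagonal_apply]
  -- Here `N ≥ 2` supplies an axis `k ≠ i`, so that `u'/t` tends to the same diagonal entry as `u''`
  -- and the Hessian at the origin is scalar.
  have ha : ∀ i, Tendsto (fun t => deriv u t / t) (𝓝[>] 0) (𝓝 (H 0 i i)) := by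
    intro i
    have : Nontrivial (Fin N) := Fin.nontrivial_iff_two_le.2 hN
    obtain ⟨k, hk⟩ := exists_ne i
    refine (hlim k i i).congr' ((hform k i i).mono fun t ht => ?_)
    rw [ht]; simp [hk.symm]
  have hb : ∀ i, Tendsto (fun t => deriv (deriv u) t) (𝓝[>] 0) (𝓝 (H 0 i i)) := by
    intro i
    refine (hlim i i i).congr' ((hform i i i).mono fun t ht => ?_)
    rw [ht]; simp
  let i₀ : Fin N := ⟨0, by omega⟩
  have hdiag : ∀ i, H 0 i i = H 0 i₀ i₀ := fun i => tendsto_nhds_unique (ha i) (ha i₀)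
  have hoff : ∀ i j, i ≠ j → H 0 i j = 0 := by
    intro i j hij
    refine tendsto_nhds_unique (hlim i i j) (tendsto_const_nhds.congr'
      ((hform i i j).mono fun t ht => ?_))
    simp only [ht]; simp [hij, hij.symm]
  have hH0 : H 0 = Matrix.scalar (Fin N) (H 0 i₀ i₀) +
      (0 : ℝ) • Matrix.vecMulVec (Pi.single i₀ 1) (Pi.single i₀ 1) := by
    ext i j
    by_cases hij : i = j
    · subst hij; simp [hdiag i]
    · simp [hij, hoff i j hij]
  rw [truncLaplacePlus, ← hH, hH0, sum_drop_sortedEigenvalues hN _ _ (by simp), add_zero, max_self]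
  have hu0 : Tendsto u (𝓝[>] 0) (𝓝 (u 0)) := by
    have h1 := hU.continuousAt.tendsto.comp (hpath i₀)
    rw [norm_zero] at h1
    refine h1.congr' ?_
    filter_upwards [self_mem_nhdsWithin] with t ht
    have ht0 : 0 < t := ht
    simp [abs_of_pos ht0]
  have hsum := ((hb i₀).max (ha i₀)).add ((hg.tendsto _).comp hu0)
  rw [max_self] at hsum
  refine tendsto_nhds_unique hsum (tendsto_const_nhds.congr' ?_)
  filter_upwards [hev, hC2] with t h1 h2
  exact (h1 h2).symm

end RadialEquation

/-! ### Equivalence of `IsRadialSolution` and maximal `Sol` -/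

section Equivalence

variable {N : ℕ} {g u v : ℝ → ℝ} {R : EReal}

theorem exists_between_coe {r : ℝ} (h : (r : EReal) < R) : ∃ T : ℝ, r < T ∧ (T : EReal) < R := by
  obtain ⟨T, h1, h2⟩ := EReal.lt_iff_exists_real_btwn.1 h
  exact ⟨T, EReal.coe_lt_coe_iff.1 h1, h2⟩

theorem mem_nhdsWithin_halfOpen {r T : ℝ} (hr : r < T) : Icc 0 T ∈ 𝓝[halfOpen R] r := by
  filter_upwards [self_mem_nhdsWithin, mem_nhdsWithin_of_mem_nhds (Iio_mem_nhds hr)] with x hx hxT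
  exact ⟨hx.1, le_of_lt hxT⟩

theorem Icc_subset_halfOpen {T : ℝ} (hT : (T : EReal) < R) : Icc 0 T ⊆ halfOpen R :=
  fun _ hx => ⟨hx.1, (EReal.coe_le_coe_iff.2 hx.2).trans_lt hT⟩

theorem uniqueDiffOn_halfOpen : UniqueDiffOn ℝ (halfOpen R) := by
  intro r hr
  obtain ⟨T, hrT, hT⟩ := exists_between_coe hr.2
  exact (uniqueDiffOn_Icc (hr.1.trans_lt hrT) r ⟨hr.1, hrT.le⟩).mono (Icc_subset_halfOpen hT)

theorem Sol.hasDerivWithinAt (h : Sol g 0 R u v) {r : ℝ} (hr : r ∈ halfOpen R) :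
    HasDerivWithinAt u (v r) (halfOpen R) r := by
  obtain ⟨T, hrT, hT⟩ := exists_between_coe hr.2
  have hT0 := hr.1.trans_lt hrT
  exact ((h T hT0.le hT).hasDerivWithinAt r ⟨hr.1, hrT.le⟩ hT0).mono_of_mem_nhdsWithin
    (mem_nhdsWithin_halfOpen hrT)

theorem Sol.continuousOn_deriv (h : Sol g 0 R u v) : ContinuousOn v (halfOpen R) := by
  intro r hr
  obtain ⟨T, hrT, hT⟩ := exists_between_coe hr.2
  exact ((h T (hr.1.trans hrT.le) hT).continuousOn_deriv r ⟨hr.1, hrT.le⟩).mono_of_mem_nhdsWithin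
    (mem_nhdsWithin_halfOpen hrT)

theorem halfOpen_mem_nhds {r : ℝ} (hr : 0 < r) (hR : (r : EReal) < R) : halfOpen R ∈ 𝓝 r := by
  obtain ⟨T, hrT, hT⟩ := exists_between_coe hR
  exact mem_of_superset (Icc_mem_nhds hr hrT) (Icc_subset_halfOpen hT)

theorem Sol.hasDerivAt (h : Sol g 0 R u v) {r : ℝ} (hr : 0 < r) (hR : (r : EReal) < R) :
    HasDerivAt u (v r) r :=
  (h.hasDerivWithinAt ⟨hr.le, hR⟩).hasDerivAt (halfOpen_mem_nhds hr hR)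

theorem contDiffOn_succ_of_hasDerivWithinAt {n : ℕ} {s : Set ℝ} (hs : UniqueDiffOn ℝ s)
    (hu : ∀ r ∈ s, HasDerivWithinAt u (v r) s r) (hv : ContDiffOn ℝ n v s) :
    ContDiffOn ℝ (n + 1) u s := by
  rw [contDiffOn_succ_iff_derivWithin hs]
  refine ⟨fun r hr => (hu r hr).differentiableWithinAt, by simp, hv.congr fun r hr => ?_⟩
  exact (hu r hr).derivWithin (hs r hr)

theorem Reach.exists_partition {a b : ℝ} (h : Reach g u v a b) :
    ∃ (n : ℕ) (p : ℕ → ℝ), p 0 = a ∧ p n = b ∧ ∀ i < n, Step g u v (p i) (p (i + 1)) := by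
  induction h with
  | refl => exact ⟨0, fun _ => a, rfl, rfl, by simp⟩
  | @tail b c _ hs ih =>
    obtain ⟨n, p, h0, hn, hp⟩ := ih
    refine ⟨n + 1, fun i => if i ≤ n then p i else c, by simp [h0], by simp, fun i hi => ?_⟩
    rcases (Nat.lt_succ_iff.1 hi).eq_or_lt with h | h
    · subst h; simpa [hn] using hs
    · simpa [h.le, Nat.succ_le_of_lt h] using hp i h

theorem Step.contDiffOn {a b : ℝ} (h : Step g u v a b) : ContDiffOn ℝ 2 u (Icc a b) := by
  obtain ⟨hab, w, hw, H⟩ := h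
  have hs := uniqueDiffOn_Icc hab
  have h1 : ContDiffOn ℝ ((0 : ℕ) + 1) v (Icc a b) :=
    contDiffOn_succ_of_hasDerivWithinAt hs (fun r hr => (H r hr).2.1) (contDiffOn_zero.2 hw)
  have h2 : ContDiffOn ℝ ((1 : ℕ) + 1) u (Icc a b) :=
    contDiffOn_succ_of_hasDerivWithinAt hs (fun r hr => (H r hr).1) (by simpa using h1)
  simpa [one_add_one_eq_two] using h2

/-- Where `u` is `C²`, the left derivative of `v` is the true second derivative, so break points
need no separate treatment. -/
theorem Sol.max_eq (h : Sol g 0 R u v) {r : ℝ} (hr : 0 < r) (hR : (r : EReal) < R)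
    (hu : ContDiffAt ℝ 2 u r) : max (deriv (deriv u) r) (deriv u r / r) + g (u r) = 0 := by
  obtain ⟨w, c, hc, hw, hB⟩ := (h r hr.le hR).left_deriv r ⟨hr, le_rfl⟩
  have hd : HasDerivAt (deriv u) (deriv (deriv u) r) r := by
    have h2 : ContDiffAt ℝ 1 (fderiv ℝ u) r := hu.fderiv_right (by norm_num)
    have h3 : ContDiffAt ℝ 1 (deriv u) r := h2.clm_apply contDiffAt_const
    exact (h3.differentiableAt (by simp)).hasDerivAt
  have hev : ∀ s ∈ Ioc (max c 0) r, deriv u s = v s := fun s hs =>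
    (h.hasDerivAt ((le_max_right _ _).trans_lt hs.1)
      ((EReal.coe_le_coe_iff.2 hs.2).trans_lt hR)).deriv
  have hlt : max c 0 < r := max_lt hc hr
  have hrr : r ∈ Ioc (max c 0) r := ⟨hlt, le_rfl⟩
  have hsub : Ioc (max c 0) r ⊆ Icc c r := fun s hs => ⟨((le_max_left _ _).trans_lt hs.1).le, hs.2⟩
  have heq := (uniqueDiffOn_Ioc (max c 0) r r hrr).eq_deriv _ (hw.mono hsub)
    (hd.hasDerivWithinAt.congr (fun s hs => (hev s hs).symm) (hev r hrr).symm)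
  rw [hev r hrr, ← heq]
  exact (balance_iff_max hr).1 hB

theorem eventually_toLeft_of_lt {a : ℝ} (h : (a : EReal) < R) :
    ∀ᶠ r : ℝ in toLeft R, a < r ∧ (r : EReal) < R := by
  have h : ∀ᶠ x in 𝓝[<] R, (a : EReal) < x ∧ x < R := Ioo_mem_nhdsLT h
  filter_upwards [preimage_mem_comap h] with r hr
  exact ⟨EReal.coe_lt_coe_iff.1 hr.1, hr.2⟩

theorem Sol.isRadialSolution (hN : 2 ≤ N) (hg : Continuous g) (hR : 0 < R) (h : Sol g 0 R u v)
    (hv : v 0 = 0) (hmax : R ≠ ⊤ → Tendsto (fun r => |u r| + |v r|) (toLeft R) atTop) :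
    IsRadialSolution N 1 g R u where
  radius_pos := hR
  piecewise := by
    refine ⟨?_, fun T hT hTR => ?_⟩
    · have := contDiffOn_succ_of_hasDerivWithinAt (n := 0) uniqueDiffOn_halfOpen
        (fun r hr => h.hasDerivWithinAt hr) (contDiffOn_zero.2 h.continuousOn_deriv)
      simpa using this
    · obtain ⟨n, p, h0, hn, hp⟩ := (h T hT.le hTR).exists_partition
      exact ⟨n, p, h0, hn, fun i hi => ⟨(hp i hi).1, (hp i hi).contDiffOn⟩⟩
  deriv_zero := by
    obtain ⟨T, hT, hTR⟩ := exists_between_coe (r := 0) hR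
    have := (h T hT.le hTR).hasDerivWithinAt 0 ⟨le_rfl, hT.le⟩ hT
    rw [hv] at this
    exact hasDerivWithinAt_Ici_of_Icc ⟨le_rfl, hT⟩ this
  equation := by
    intro x hx hU
    rcases eq_or_ne x 0 with rfl | hx0
    · rw [norm_zero]
      refine truncLaplacePlus_radial_zero hN hg hU ?_
      obtain ⟨T, hT, hTR⟩ := exists_between_coe (r := 0) hR
      filter_upwards [Ioo_mem_nhdsGT hT] with t ht
      exact h.max_eq ht.1 ((EReal.coe_lt_coe_iff.2 ht.2).trans hTR)
    · have hu := contDiffAt_profile hx0 hU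
      rw [truncLaplacePlus_radial hN hx0 hu]
      exact h.max_eq (norm_pos_iff.2 hx0) hx hu
  maximal := by
    intro hRt
    refine (hmax hRt).congr' ?_
    filter_upwards [eventually_toLeft_of_lt (a := 0) hR] with r hr
    rw [(h.hasDerivAt hr.1 hr.2).deriv]

/-- Inside the interval `Balance` is the equation at a point of norm `r`. Its three conditions are
closed, so they pass to the end points, `r = 0` included. -/
theorem step_of_contDiffOn (hN : 2 ≤ N) (hg : Continuous g) (hu : IsRadialSolution N 1 g R u)
    (hv : ∀ r ∈ halfOpen R, HasDerivWithinAt u (v r) (halfOpen R) r)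
    {a b : ℝ} (hab : a < b) (ha : 0 ≤ a) (hb : (b : EReal) < R) (hC : ContDiffOn ℝ 2 u (Icc a b)) :
    Step g u v a b := by
  have hs := uniqueDiffOn_Icc hab
  have hsub : Icc a b ⊆ halfOpen R := (Icc_subset_Icc_left ha).trans (Icc_subset_halfOpen hb)
  have hdu : ∀ r ∈ Icc a b, HasDerivWithinAt u (v r) (Icc a b) r := fun r hr =>
    (hv r (hsub hr)).mono hsub
  have hv1 : ContDiffOn ℝ 1 v (Icc a b) := by
    have h2 : ContDiffOn ℝ (1 + 1) u (Icc a b) := by simpa [one_add_one_eq_two] using hC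
    exact ((contDiffOn_succ_iff_derivWithin hs).1 h2).2.2.congr fun r hr =>
      ((hdu r hr).derivWithin (hs r hr)).symm
  have hw := ((contDiffOn_one_iff_derivWithin hs).1 hv1).2
  set w := derivWithin v (Icc a b) with hwdef
  have hdv : ∀ r ∈ Icc a b, HasDerivWithinAt v (w r) (Icc a b) r := fun r hr =>
    (hv1.differentiableOn (by simp) r hr).hasDerivWithinAt
  have hB : ∀ r ∈ Ioo a b, Balance g r (u r) (v r) (w r) := by
    intro r hr
    have hr0 : 0 < r := ha.trans_lt hr.1
    have hrR : (r : EReal) < R := (EReal.coe_lt_coe_iff.2 hr.2).trans hb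
    have hu2 : ContDiffAt ℝ 2 u r := hC.contDiffAt (Icc_mem_nhds hr.1 hr.2)
    let x : EuclideanSpace ℝ (Fin N) := EuclideanSpace.single ⟨0, by omega⟩ r
    have hn : ‖x‖ = r := by simp [x, abs_of_pos hr0]
    have hx0 : x ≠ 0 := by rw [← norm_pos_iff, hn]; exact hr0
    have heq := hu.equation x (by rwa [hn]) (contDiffAt_radial hx0 (by rwa [hn]))
    rw [truncLaplacePlus_radial hN hx0 (by rwa [hn]), hn] at heq
    have hd : ∀ s ∈ Ioo a b, deriv u s = v s := fun s hs' =>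
      ((hdu s (Ioo_subset_Icc_self hs')).hasDerivAt (Icc_mem_nhds hs'.1 hs'.2)).deriv
    have hdd : deriv (deriv u) r = w r := by
      rw [Filter.EventuallyEq.deriv_eq (f := v)
        (by filter_upwards [Ioo_mem_nhds hr.1 hr.2] with s hs' using hd s hs')]
      exact ((hdv r (Ioo_subset_Icc_self hr)).hasDerivAt (Icc_mem_nhds hr.1 hr.2)).deriv
    rw [hdd, hd r hr] at heq
    exact (balance_iff_max hr0).2 heq
  have hgu : ContinuousOn (fun r => g (u r)) (Icc a b) := hg.comp_continuousOn hC.continuousOn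
  have c1 : ContinuousOn (fun r => w r + g (u r)) (Icc a b) := hw.add hgu
  have c2 : ContinuousOn (fun r => v r + r * g (u r)) (Icc a b) :=
    hv1.continuousOn.add (continuousOn_id.mul hgu)
  have hcl : closure (Ioo a b) = Icc a b := closure_Ioo hab.ne
  refine ⟨hab, w, hw, fun r hr => ⟨hdu r hr, hdv r hr, ?_, ?_, ?_⟩⟩
  · exact le_on_closure (f := fun r => w r + g (u r)) (g := fun _ => 0)
      (fun s hs' => (hB s hs').1) (by rwa [hcl]) continuousOn_const (by rwa [hcl])
  · exact le_on_closure (f := fun r => v r + r * g (u r)) (g := fun _ => 0)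
      (fun s hs' => (hB s hs').2.1) (by rwa [hcl]) continuousOn_const (by rwa [hcl])
  · have hE : EqOn (fun r => (w r + g (u r)) * (v r + r * g (u r))) (fun _ => 0) (Ioo a b) :=
      fun s hs' => (hB s hs').2.2
    exact hE.of_subset_closure (c1.mul c2) continuousOn_const Ioo_subset_Icc_self hcl.ge hr

theorem IsRadialSolution.exists_sol (hN : 2 ≤ N) (hg : Continuous g)
    (hu : IsRadialSolution N 1 g R u) : ∃ v, Sol g 0 R u v ∧ v 0 = 0 ∧
      (R ≠ ⊤ → Tendsto (fun r => |u r| + |v r|) (toLeft R) atTop) := by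
  have hR := hu.radius_pos
  have huniq := uniqueDiffOn_halfOpen (R := R)
  have hv : ∀ r ∈ halfOpen R,
      HasDerivWithinAt u (derivWithin u (halfOpen R) r) (halfOpen R) r := fun r hr =>
    (hu.piecewise.1.differentiableOn (by simp) r hr).hasDerivWithinAt
  have h0 : (0 : ℝ) ∈ halfOpen R := ⟨le_rfl, hR⟩
  refine ⟨derivWithin u (halfOpen R), fun T hT hTR => ?_, ?_, fun hRt => ?_⟩
  · rcases hT.eq_or_lt with rfl | hT
    · exact Relation.ReflTransGen.refl
    obtain ⟨n, a, ha0, han, ha⟩ := hu.piecewise.2 T hT hTR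
    have hle : ∀ i ≤ n, a i ≤ T := fun i hi => by
      induction hi using Nat.decreasingInduction with
      | self => exact han.le
      | of_succ k hk ih => exact (ha k hk).1.le.trans ih
    have hreach : ∀ i ≤ n, Reach g u (derivWithin u (halfOpen R)) 0 (a i) := by
      intro i
      induction i with
      | zero => intro _; rw [ha0]; exact Relation.ReflTransGen.refl
      | succ i ih =>
        intro hi
        have hr := ih (by omega)
        exact Relation.ReflTransGen.tail hr (step_of_contDiffOn hN hg hu hv (ha i hi).1 hr.le
          ((EReal.coe_le_coe_iff.2 (hle _ hi)).trans_lt hTR) (ha i hi).2)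
    exact han ▸ hreach n le_rfl
  · exact (hu.deriv_zero.mono fun r hr => hr.1).derivWithin (huniq 0 h0)
  · refine (hu.maximal hRt).congr' ?_
    filter_upwards [eventually_toLeft_of_lt (a := 0) hR] with r hr
    rw [derivWithin_of_mem_nhds (halfOpen_mem_nhds hr.1 hr.2)]

end Equivalence

/-! ### Monotonicity, first zeros and barriers -/

section Calculus

variable {f f' : ℝ → ℝ} {a b : ℝ}

theorem strictAntiOn_of_hasDerivAt_neg (hc : ContinuousOn f (Icc a b))
    (hd : ∀ t ∈ Ioo a b, HasDerivAt f (f' t) t) (hneg : ∀ t ∈ Ioo a b, f' t < 0) :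
    StrictAntiOn f (Icc a b) := by
  refine strictAntiOn_of_deriv_neg (convex_Icc a b) hc fun t ht => ?_
  rw [interior_Icc] at ht
  rw [(hd t ht).deriv]
  exact hneg t ht

theorem strictMonoOn_of_hasDerivAt_pos (hc : ContinuousOn f (Icc a b))
    (hd : ∀ t ∈ Ioo a b, HasDerivAt f (f' t) t) (hpos : ∀ t ∈ Ioo a b, 0 < f' t) :
    StrictMonoOn f (Icc a b) := by
  refine strictMonoOn_of_deriv_pos (convex_Icc a b) hc fun t ht => ?_
  rw [interior_Icc] at ht
  rw [(hd t ht).deriv]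
  exact hpos t ht

theorem le_add_mul_of_hasDerivAt_le {C : ℝ} (hab : a ≤ b) (hc : ContinuousOn f (Icc a b))
    (hd : ∀ t ∈ Ioo a b, HasDerivAt f (f' t) t) (hle : ∀ t ∈ Ioo a b, f' t ≤ C) :
    f b ≤ f a + C * (b - a) := by
  have := (convex_Icc a b).image_sub_le_mul_sub_of_deriv_le hc
    (fun t ht => by rw [interior_Icc] at ht; exact (hd t ht).differentiableAt.differentiableWithinAt)
    (C := C) (fun t ht => by rw [interior_Icc] at ht; rw [(hd t ht).deriv]; exact hle t ht)
    a (left_mem_Icc.2 hab) b (right_mem_Icc.2 hab) hab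
  linarith

theorem add_mul_le_of_le_hasDerivAt {C : ℝ} (hab : a ≤ b) (hc : ContinuousOn f (Icc a b))
    (hd : ∀ t ∈ Ioo a b, HasDerivAt f (f' t) t) (hle : ∀ t ∈ Ioo a b, C ≤ f' t) :
    f a + C * (b - a) ≤ f b := by
  have := le_add_mul_of_hasDerivAt_le (f := fun t => -f t) (f' := fun t => -f' t) (C := -C) hab
    hc.neg (fun t ht => (hd t ht).neg) (fun t ht => neg_le_neg (hle t ht))
  linarith

/-- The first zero of a function which starts negative and becomes nonnegative. -/
theorem exists_first_zero (hc : ContinuousOn f (Icc a b)) (hab : a ≤ b) (ha : f a < 0)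
    (hb : 0 ≤ f b) : ∃ c ∈ Ioc a b, f c = 0 ∧ ∀ t ∈ Ico a c, f t < 0 := by
  have hK : IsCompact (Icc a b ∩ f ⁻¹' Ici 0) :=
    isCompact_Icc.of_isClosed_subset (hc.preimage_isClosed_of_isClosed isClosed_Icc isClosed_Ici)
      inter_subset_left
  obtain ⟨c, ⟨hcab, hfc⟩, hmin⟩ := hK.exists_isLeast ⟨b, right_mem_Icc.2 hab, hb⟩
  have hfc : 0 ≤ f c := hfc
  have hneg : ∀ t ∈ Ico a c, f t < 0 := fun t ht => by
    by_contra! h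
    exact absurd (hmin ⟨⟨ht.1, ht.2.le.trans hcab.2⟩, h⟩) (not_le.2 ht.2)
  have hac : a < c := lt_of_le_of_ne hcab.1 (by rintro rfl; linarith)
  refine ⟨c, ⟨hac, hcab.2⟩, le_antisymm ?_ hfc, hneg⟩
  have := le_on_closure (f := f) (g := fun _ => 0) (s := Ico a c) (fun t ht => (hneg t ht).le)
    (by rw [closure_Ico hac.ne]; exact hc.mono (Icc_subset_Icc_right hcab.2)) continuousOn_const
    (x := c) (by rw [closure_Ico hac.ne]; exact right_mem_Icc.2 hac.le)
  exact this

/-- The first zero of a function which starts nonpositive and decreasing. -/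
theorem exists_first_zero_of_deriv_neg {d : ℝ} (hc : ContinuousOn f (Icc a b)) (hab : a < b)
    (ha : f a ≤ 0) (hd : HasDerivWithinAt f d (Ici a) a) (hd0 : d < 0) (hb : 0 ≤ f b) :
    ∃ c ∈ Ioc a b, f c = 0 ∧ ∀ t ∈ Ioo a c, f t < 0 := by
  have hev : ∀ᶠ t in 𝓝[>] a, f t < 0 := by
    have hs := (hasDerivWithinAt_iff_tendsto_slope' (by simp)).1 (hasDerivWithinAt_Ioi_iff_Ici.2 hd)
    filter_upwards [hs.eventually (gt_mem_nhds hd0), self_mem_nhdsWithin] with t ht hta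
    have hta : a < t := hta
    rw [slope_def_field, div_neg_iff] at ht
    rcases ht with h | h <;> linarith
  obtain ⟨a', ha', hlt⟩ := (mem_nhdsGT_iff_exists_Ioc_subset.1 hev)
  have ha' : a < a' := ha'
  have hlt : ∀ t ∈ Ioc a a', f t < 0 := fun t ht => hlt ht
  have hab' : a' < b := by
    by_contra! h
    exact absurd (hlt b ⟨hab, h⟩) (not_lt.2 hb)
  obtain ⟨c, hcm, hc0, hcn⟩ := exists_first_zero (hc.mono (Icc_subset_Icc_left ha'.le)) hab'.le
    (hlt a' ⟨ha', le_rfl⟩) hb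
  refine ⟨c, ⟨ha'.trans hcm.1, hcm.2⟩, hc0, fun t ht => ?_⟩
  rcases le_or_gt t a' with h | h
  · exact hlt t ⟨ht.1, h⟩
  · exact hcn t ⟨h.le, ht.2⟩

/-- A level which the function can only cross downwards is a barrier from above. -/
theorem le_of_deriv_neg_at_level {c : ℝ} (hc : ContinuousOn f (Icc a b))
    (hd : ∀ t ∈ Ico a b, HasDerivWithinAt f (f' t) (Ici t) t) (ha : f a ≤ c)
    (hneg : ∀ t ∈ Ico a b, f t = c → f' t < 0) : ∀ t ∈ Icc a b, f t ≤ c := fun _ ht =>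
  image_le_of_deriv_right_lt_deriv_boundary' hc hd ha continuousOn_const
    (fun _ _ => hasDerivWithinAt_const _ _ _) hneg ht

/-- A level which the function can only cross upwards is a barrier from below. -/
theorem le_of_deriv_pos_at_level {c : ℝ} (hc : ContinuousOn f (Icc a b))
    (hd : ∀ t ∈ Ico a b, HasDerivWithinAt f (f' t) (Ici t) t) (ha : c ≤ f a)
    (hpos : ∀ t ∈ Ico a b, f t = c → 0 < f' t) : ∀ t ∈ Icc a b, c ≤ f t := fun t ht =>
  neg_le_neg_iff.1 (le_of_deriv_neg_at_level (f := fun t => -f t) (f' := fun t => -f' t) hc.neg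
    (fun t ht => (hd t ht).neg) (neg_le_neg ha)
    (fun t ht h => neg_neg_of_pos (hpos t ht (neg_inj.1 h))) t ht)

end Calculus

/-! ### Limits at the end of the interval of existence -/

section LeftLimit

variable {R : EReal} {a : ℝ} {u : ℝ → ℝ}

theorem toLeft_neBot (h : (a : EReal) < R) : (toLeft R).NeBot := by
  induction R with
  | bot => simp at h
  | top => rw [toLeft_top]; infer_instance
  | coe ρ => rw [toLeft_coe]; infer_instance

theorem tendsto_atBot_toLeft
    (hanti : ∀ s t : ℝ, a ≤ s → s ≤ t → (t : EReal) < R → u t ≤ u s)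
    (hunb : ∀ C : ℝ, ∃ t : ℝ, a ≤ t ∧ (t : EReal) < R ∧ u t ≤ C) : Tendsto u (toLeft R) atBot := by
  refine tendsto_atBot.2 fun C => ?_
  obtain ⟨t, hat, htR, ht⟩ := hunb C
  filter_upwards [eventually_toLeft_of_lt htR] with s hs
  exact (hanti t s hat hs.1.le hs.2).trans ht

theorem tendsto_atTop_toLeft
    (hmono : ∀ s t : ℝ, a ≤ s → s ≤ t → (t : EReal) < R → u s ≤ u t)
    (hunb : ∀ C : ℝ, ∃ t : ℝ, a ≤ t ∧ (t : EReal) < R ∧ C ≤ u t) : Tendsto u (toLeft R) atTop := by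
  refine tendsto_atTop.2 fun C => ?_
  obtain ⟨t, hat, htR, ht⟩ := hunb C
  filter_upwards [eventually_toLeft_of_lt htR] with s hs
  exact ht.trans (hmono t s hat hs.1.le hs.2)

end LeftLimit

/-! ### Signs and monotonicity of `g` -/

namespace IsBistable

variable {g : ℝ → ℝ} {α β : ℝ}

theorem continuous (hg : IsBistable g α β) : Continuous g := hg.contDiff.continuous

theorem hasDerivAt (hg : IsBistable g α β) (s : ℝ) : HasDerivAt g (deriv g s) s :=
  (hg.contDiff.differentiable (by simp) s).hasDerivAt

theorem continuous_deriv (hg : IsBistable g α β) : Continuous (deriv g) :=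
  hg.contDiff.continuous_deriv (by simp)

theorem alpha_pos (hg : IsBistable g α β) : 0 < α := hg.beta_pos.trans hg.beta_lt_alpha

theorem zero (hg : IsBistable g α β) : g 0 = 0 := by
  have := hg.odd 0
  rw [neg_zero] at this
  linarith

theorem alpha_zero (hg : IsBistable g α β) : g α = 0 := by
  refine le_antisymm ?_ ?_
  · exact le_on_closure (f := g) (g := fun _ => 0) (s := Ioi α) (fun t ht => (hg.neg t ht).le)
      hg.continuous.continuousOn continuousOn_const (x := α) (by rw [closure_Ioi]; exact self_mem_Ici)
  · exact le_on_closure (f := fun _ => 0) (g := g) (s := Ioo 0 α) (fun t ht => (hg.pos t ht).le)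
      continuousOn_const hg.continuous.continuousOn (x := α)
      (by rw [closure_Ioo hg.alpha_pos.ne]; exact right_mem_Icc.2 hg.alpha_pos.le)

theorem neg_of_mem_neg (hg : IsBistable g α β) {s : ℝ} (h1 : -α < s) (h2 : s < 0) : g s < 0 := by
  have h := hg.pos (-s) ⟨by linarith, by linarith⟩
  rw [hg.odd] at h
  linarith

theorem pos_of_lt_neg_alpha (hg : IsBistable g α β) {s : ℝ} (h : s < -α) : 0 < g s := by
  have h := hg.neg (-s) (show α < -s by linarith)
  rw [hg.odd] at h
  linarith

theorem deriv_even (hg : IsBistable g α β) (s : ℝ) : deriv g (-s) = deriv g s := by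
  have h1 : HasDerivAt (fun x => g (-x)) (-deriv g (-s)) s := by
    exact ((hg.hasDerivAt (-s)).comp s (hasDerivAt_neg s)).congr_deriv (by simp)
  have h2 : HasDerivAt (fun x => g (-x)) (-deriv g s) s := by
    have : (fun x => g (-x)) = fun x => -g x := funext hg.odd
    rw [this]
    exact (hg.hasDerivAt s).neg
  exact neg_inj.1 (h1.unique h2)

theorem deriv_pos_of_abs_lt (hg : IsBistable g α β) {s : ℝ} (h : |s| < β) : 0 < deriv g s := by
  rcases abs_cases s with ⟨h1, h2⟩ | ⟨h1, h2⟩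
  · exact hg.deriv_pos s ⟨h2, h1 ▸ h⟩
  · rw [← hg.deriv_even]
    exact hg.deriv_pos (-s) ⟨by linarith, h1 ▸ h⟩

theorem deriv_neg_of_lt_abs (hg : IsBistable g α β) {s : ℝ} (h : β < |s|) : deriv g s < 0 := by
  rcases abs_cases s with ⟨h1, h2⟩ | ⟨h1, h2⟩
  · exact hg.deriv_neg s (h1 ▸ h)
  · rw [← hg.deriv_even]
    exact hg.deriv_neg (-s) (h1 ▸ h)

theorem deriv_nonneg_of_abs_le (hg : IsBistable g α β) {s : ℝ} (h : |s| ≤ β) : 0 ≤ deriv g s := by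
  have hcl : closure (Ioo (-β) β) = Icc (-β) β := closure_Ioo (by linarith [hg.beta_pos])
  exact le_on_closure (f := fun _ => 0) (g := deriv g) (s := Ioo (-β) β)
    (fun t ht => (hg.deriv_pos_of_abs_lt (abs_lt.2 ht)).le)
    continuousOn_const hg.continuous_deriv.continuousOn (by rw [hcl]; exact abs_le.1 h)

theorem deriv_nonpos_of_le_abs (hg : IsBistable g α β) {s : ℝ} (h : β ≤ |s|) : deriv g s ≤ 0 := by
  have key : ∀ t, β ≤ t → deriv g t ≤ 0 := fun t ht =>
    le_on_closure (f := deriv g) (g := fun _ => 0) (s := Ioi β) (fun t ht => (hg.deriv_neg t ht).le)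
      hg.continuous_deriv.continuousOn continuousOn_const (by rw [closure_Ioi]; exact ht)
  rcases abs_cases s with ⟨h1, h2⟩ | ⟨h1, h2⟩
  · exact key s (h1 ▸ h)
  · rw [← hg.deriv_even]
    exact key (-s) (h1 ▸ h)

theorem antitoneOn_Ici (hg : IsBistable g α β) : AntitoneOn g (Ici β) := by
  refine antitoneOn_of_deriv_nonpos (convex_Ici β) hg.continuous.continuousOn
    (hg.contDiff.differentiable (by simp)).differentiableOn fun t ht => ?_
  rw [interior_Ici] at ht
  exact (hg.deriv_neg t ht).le

theorem antitoneOn_Iic (hg : IsBistable g α β) : AntitoneOn g (Iic (-β)) := by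
  refine antitoneOn_of_deriv_nonpos (convex_Iic (-β)) hg.continuous.continuousOn
    (hg.contDiff.differentiable (by simp)).differentiableOn fun t ht => ?_
  rw [interior_Iic] at ht
  rw [← hg.deriv_even]
  exact (hg.deriv_neg (-t) (lt_neg.1 (mem_Iio.1 ht) : β < -t)).le

theorem monotoneOn_Icc (hg : IsBistable g α β) : MonotoneOn g (Icc (-β) β) := by
  refine monotoneOn_of_deriv_nonneg (convex_Icc _ _) hg.continuous.continuousOn
    (hg.contDiff.differentiable (by simp)).differentiableOn fun t ht => ?_
  rw [interior_Icc] at ht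
  exact (hg.deriv_pos_of_abs_lt (abs_lt.2 ht)).le

end IsBistable

/-! ### The potential well -/

/-- The potential `G(y) = ∫₀ʸ g`. -/
noncomputable def potential (g : ℝ → ℝ) (y : ℝ) : ℝ := ∫ s in (0 : ℝ)..y, g s

namespace IsBistable

variable {g : ℝ → ℝ} {α β : ℝ}

theorem hasDerivAt_potential (hg : IsBistable g α β) (y : ℝ) :
    HasDerivAt (potential g) (g y) y :=
  (hg.continuous.integral_hasStrictDerivAt 0 y).hasDerivAt

theorem continuous_potential (hg : IsBistable g α β) : Continuous (potential g) :=
  continuous_iff_continuousAt.2 fun y => (hg.hasDerivAt_potential y).continuousAt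

theorem potential_neg (hg : IsBistable g α β) (y : ℝ) : potential g (-y) = potential g y := by
  have h := intervalIntegral.integral_comp_neg (a := 0) (b := y) g
  simp only [hg.odd, intervalIntegral.integral_neg, neg_zero] at h
  have h2 := intervalIntegral.integral_symm (f := g) (μ := MeasureTheory.volume) 0 (-y)
  simp only [potential]
  linarith

theorem potential_abs (hg : IsBistable g α β) (y : ℝ) : potential g |y| = potential g y := by
  rcases abs_choice y with h | h
  · rw [h]
  · rw [h, hg.potential_neg]

theorem strictMonoOn_potential (hg : IsBistable g α β) : StrictMonoOn (potential g) (Icc 0 α) :=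
  strictMonoOn_of_hasDerivAt_pos hg.continuous_potential.continuousOn
    (fun t _ => hg.hasDerivAt_potential t) (fun t ht => hg.pos t ht)

theorem strictAntiOn_potential (hg : IsBistable g α β) : StrictAntiOn (potential g) (Ici α) := by
  refine strictAntiOn_of_deriv_neg (convex_Ici α) hg.continuous_potential.continuousOn fun t ht => ?_
  rw [interior_Ici] at ht
  rw [(hg.hasDerivAt_potential t).deriv]
  exact hg.neg t ht

/-- The potential is even, increases on `[0, α]` and decreases beyond, so its maximum, attained
exactly at `±α`, is the energy threshold. -/
theorem potential_le (hg : IsBistable g α β) (y : ℝ) : potential g y ≤ potential g α := by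
  rw [← hg.potential_abs]
  rcases le_total |y| α with h | h
  · exact hg.strictMonoOn_potential.monotoneOn ⟨abs_nonneg y, h⟩ (right_mem_Icc.2 hg.alpha_pos.le) h
  · exact hg.strictAntiOn_potential.antitoneOn self_mem_Ici h h

theorem potential_lt (hg : IsBistable g α β) {y : ℝ} (hy : |y| < α) :
    potential g y < potential g α := by
  rw [← hg.potential_abs]
  exact hg.strictMonoOn_potential ⟨abs_nonneg y, hy.le⟩ (right_mem_Icc.2 hg.alpha_pos.le) hy

theorem abs_eq_of_potential_eq (hg : IsBistable g α β) {y : ℝ}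
    (hy : potential g y = potential g α) : |y| = α := by
  rw [← hg.potential_abs] at hy
  rcases le_total |y| α with h | h
  · exact hg.strictMonoOn_potential.injOn ⟨abs_nonneg y, h⟩ (right_mem_Icc.2 hg.alpha_pos.le) hy
  · exact hg.strictAntiOn_potential.injOn h self_mem_Ici hy

end IsBistable

/-! ### Uniqueness backwards in time -/

section BackwardUniqueness

variable {E : Type*} [NormedAddCommGroup E] [NormedSpace ℝ E] [ProperSpace E]

/-- Used to show that a nonconstant solution does not reach an equilibrium in finite time. -/
theorem SolvesOn.eqOn_left {f : E → E} (hf : ContDiff ℝ 1 f) {y z : ℝ → E} {a b : ℝ}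
    (hy : SolvesOn f y a b) (hz : SolvesOn f z a b) (h : y b = z b) : EqOn y z (Icc a b) := by
  obtain ⟨M₁, hM₁⟩ :=
    (isCompact_Icc.image_of_continuousOn hy.continuousOn).isBounded.subset_closedBall 0
  obtain ⟨M₂, hM₂⟩ :=
    (isCompact_Icc.image_of_continuousOn hz.continuousOn).isBounded.subset_closedBall 0
  obtain ⟨K, hK⟩ := exists_lipschitzOnWith_closedBall hf (max M₁ M₂)
  have hleft : ∀ x : ℝ → E, SolvesOn f x a b → ∀ t ∈ Ioc a b,
      HasDerivWithinAt x (f (x t)) (Iic t) t := fun x hx t ht =>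
    (hx t (Ioc_subset_Icc_self ht)).mono_of_mem_nhdsWithin
      (mem_of_superset (Icc_mem_nhdsLE ht.1) (Icc_subset_Icc_right ht.2))
  refine ODE_solution_unique_of_mem_Icc_left (v := fun _ => f)
    (s := fun _ => Metric.closedBall 0 (max M₁ M₂)) (K := K) (fun _ _ => hK) hy.continuousOn
    (hleft y hy) ?_ hz.continuousOn (hleft z hz) ?_ h
  · exact fun t ht => Metric.closedBall_subset_closedBall (le_max_left _ _)
      (hM₁ (mem_image_of_mem _ (Ioc_subset_Icc_self ht)))
  · exact fun t ht => Metric.closedBall_subset_closedBall (le_max_right _ _)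
      (hM₂ (mem_image_of_mem _ (Ioc_subset_Icc_self ht)))

end BackwardUniqueness

/-! ### Unboundedness from a derivative bounded away from zero -/

section LinearGrowth

variable {f f' : ℝ → ℝ} {s k : ℝ}

theorem exists_le_of_deriv_le (hk : 0 < k) (hc : ∀ t, ContinuousOn f (Icc s t))
    (hd : ∀ t, s < t → HasDerivAt f (f' t) t) (hle : ∀ t, s < t → f' t ≤ -k) (C : ℝ) :
    ∃ t, s < t ∧ f t ≤ C := by
  have hpos : 0 < |f s - C| / k + 1 := by positivity
  refine ⟨s + (|f s - C| / k + 1), by linarith, ?_⟩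
  have := le_add_mul_of_hasDerivAt_le (b := s + (|f s - C| / k + 1)) (by linarith) (hc _)
    (fun t ht => hd t ht.1) (fun t ht => hle t ht.1)
  have h2 : k * (|f s - C| / k) = |f s - C| := by field_simp
  have h3 := le_abs_self (f s - C)
  nlinarith

theorem exists_ge_of_le_deriv (hk : 0 < k) (hc : ∀ t, ContinuousOn f (Icc s t))
    (hd : ∀ t, s < t → HasDerivAt f (f' t) t) (hle : ∀ t, s < t → k ≤ f' t) (C : ℝ) :
    ∃ t, s < t ∧ C ≤ f t := by
  obtain ⟨t, h1, h2⟩ := exists_le_of_deriv_le (f := fun t => -f t) (f' := fun t => -f' t) hk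
    (fun t => (hc t).neg) (fun t ht => (hd t ht).neg) (fun t ht => neg_le_neg (hle t ht)) (-C)
  exact ⟨t, h1, neg_le_neg_iff.1 h2⟩

end LinearGrowth

/-! ### The free regime and the drift -/

/-- `(u, v)` is the maximal solution of `u' = v`, `v' = -g u` on `[a, R)`. -/
structure Free (g : ℝ → ℝ) (a : ℝ) (R : EReal) (u v : ℝ → ℝ) : Prop where
  lt : (a : EReal) < R
  der_u : ∀ t : ℝ, a ≤ t → (t : EReal) < R → HasDerivWithinAt u (v t) (Ici a) t
  der_v : ∀ t : ℝ, a ≤ t → (t : EReal) < R → HasDerivWithinAt v (-g (u t)) (Ici a) t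
  max : R ≠ ⊤ → Tendsto (fun r => |u r| + |v r|) (toLeft R) atTop

/-- `u` is the maximal solution of `u' = -t g u` on `[a, R)`. -/
structure Drift (g : ℝ → ℝ) (a : ℝ) (R : EReal) (u : ℝ → ℝ) : Prop where
  lt : (a : EReal) < R
  der : ∀ t : ℝ, a ≤ t → (t : EReal) < R → HasDerivWithinAt u (-(t * g (u t))) (Ici a) t
  max : R ≠ ⊤ → Tendsto (fun r => |u r|) (toLeft R) atTop

theorem coe_lt_of_le {s t : ℝ} {R : EReal} (h : s ≤ t) (ht : (t : EReal) < R) : (s : EReal) < R :=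
  (EReal.coe_le_coe_iff.2 h).trans_lt ht

theorem hasDerivWithinAt_Ici_of_forall_Icc {E : Type*} [NormedAddCommGroup E] [NormedSpace ℝ E]
    {y : ℝ → E} {d : E} {a t : ℝ} {R : EReal}
    (hat : a ≤ t) (htR : (t : EReal) < R)
    (h : ∀ b : ℝ, (b : EReal) < R → t ∈ Icc a b → HasDerivWithinAt y d (Icc a b) t) :
    HasDerivWithinAt y d (Ici a) t := by
  obtain ⟨T, hT, hTR⟩ := exists_between_coe htR
  refine (h T hTR ⟨hat, hT.le⟩).mono_of_mem_nhdsWithin ?_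
  filter_upwards [self_mem_nhdsWithin, mem_nhdsWithin_of_mem_nhds (Iio_mem_nhds hT)] with x hx hxT
  exact ⟨hx, le_of_lt hxT⟩

/-- The vector field of `u'' = -g u`. -/
def freeField (g : ℝ → ℝ) (p : ℝ × ℝ) : ℝ × ℝ := (p.2, -g p.1)

/-- The vector field of `u' = -t g u`, made autonomous. -/
def driftField (g : ℝ → ℝ) (p : ℝ × ℝ) : ℝ × ℝ := (1, -(p.1 * g p.2))

theorem contDiff_freeField {g : ℝ → ℝ} (hg : ContDiff ℝ 1 g) : ContDiff ℝ 1 (freeField g) :=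
  contDiff_snd.prodMk (hg.comp contDiff_fst).neg

theorem contDiff_driftField {g : ℝ → ℝ} (hg : ContDiff ℝ 1 g) : ContDiff ℝ 1 (driftField g) :=
  contDiff_const.prodMk (contDiff_fst.mul (hg.comp contDiff_snd)).neg

theorem exists_free {g : ℝ → ℝ} (hg : ContDiff ℝ 1 g) (a y₀ v₀ : ℝ) :
    ∃ (R : EReal) (u v : ℝ → ℝ), Free g a R u v ∧ u a = y₀ ∧ v a = v₀ := by
  obtain ⟨R, y, hR, ha, hs, hm⟩ := exists_maximal_solution (contDiff_freeField hg) a (y₀, v₀)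
  have hder : ∀ t : ℝ, a ≤ t → (t : EReal) < R →
      HasDerivWithinAt y (freeField g (y t)) (Ici a) t := fun t hat htR =>
    hasDerivWithinAt_Ici_of_forall_Icc hat htR fun b hb ht => hs b hb t ht
  refine ⟨R, fun t => (y t).1, fun t => (y t).2, ⟨hR, fun t hat htR => ?_, fun t hat htR => ?_,
    fun hRt => ?_⟩, by simp [ha], by simp [ha]⟩
  · exact (ContinuousLinearMap.fst ℝ ℝ ℝ).hasFDerivAt.comp_hasDerivWithinAt t (hder t hat htR)
  · exact (ContinuousLinearMap.snd ℝ ℝ ℝ).hasFDerivAt.comp_hasDerivWithinAt t (hder t hat htR)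
  · refine tendsto_atTop_mono (fun t => ?_) (hm hRt)
    rw [Prod.norm_def]
    exact max_le (le_add_of_nonneg_right (abs_nonneg _)) (le_add_of_nonneg_left (abs_nonneg _))

theorem exists_drift {g : ℝ → ℝ} (hg : ContDiff ℝ 1 g) (a y₀ : ℝ) :
    ∃ (R : EReal) (u : ℝ → ℝ), Drift g a R u ∧ u a = y₀ := by
  obtain ⟨R, y, hR, ha, hs, hm⟩ := exists_maximal_solution (contDiff_driftField hg) a (a, y₀)
  have hder : ∀ t : ℝ, a ≤ t → (t : EReal) < R →
      HasDerivWithinAt y (driftField g (y t)) (Ici a) t := fun t hat htR =>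
    hasDerivWithinAt_Ici_of_forall_Icc hat htR fun b hb ht => hs b hb t ht
  -- The first component has derivative `1` and starts at `a`, so it is the time.
  have htime : ∀ t : ℝ, a ≤ t → (t : EReal) < R → (y t).1 = t := by
    intro t hat htR
    have h1 : ∀ s ∈ Icc a t, HasDerivWithinAt (fun s => (y s).1) 1 (Ici a) s := fun s hs =>
      (ContinuousLinearMap.fst ℝ ℝ ℝ).hasFDerivAt.comp_hasDerivWithinAt s
        (hder s hs.1 (coe_lt_of_le hs.2 htR))
    refine eq_of_has_deriv_right_eq (f := fun s => (y s).1) (g := fun s => s) (f' := fun _ => 1)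
      (a := a) (b := t) (fun s hs => ?_) (fun s _ => hasDerivWithinAt_id _ _)
      (fun s hs => ((h1 s hs).mono Icc_subset_Ici_self).continuousWithinAt) continuousOn_id
      (by simp [ha]) t ⟨hat, le_rfl⟩
    exact (h1 s (Ico_subset_Icc_self hs)).mono (Ici_subset_Ici.2 hs.1)
  refine ⟨R, fun t => (y t).2, ⟨hR, fun t hat htR => ?_, fun hRt => ?_⟩, by simp [ha]⟩
  · have := (ContinuousLinearMap.snd ℝ ℝ ℝ).hasFDerivAt.comp_hasDerivWithinAt t (hder t hat htR)
    refine this.congr_deriv ?_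
    simp [driftField, htime t hat htR]
  · lift R to ℝ using ⟨hRt, (bot_le.trans_lt hR).ne'⟩
    -- The norm of the pair blows up while its time component stays bounded before a finite `R`;
    -- hence `u` itself blows up.
    have h1 : Tendsto (fun t => -(|a| + |R|) + ‖y t‖) (toLeft R) atTop :=
      tendsto_atTop_add_const_left _ _ (hm hRt)
    refine tendsto_atTop_mono' _ ?_ h1
    filter_upwards [eventually_toLeft_of_lt hR] with t ht
    have htR := EReal.coe_lt_coe_iff.1 ht.2
    rw [Prod.norm_def, htime t ht.1.le ht.2, Real.norm_eq_abs, Real.norm_eq_abs]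
    have h2 : |t| ≤ |a| + |R| := by
      rw [abs_le]
      constructor
      · linarith [neg_abs_le a, abs_nonneg R]
      · linarith [le_abs_self R, abs_nonneg a]
    have h3 : max |t| |(y t).2| ≤ (|a| + |R|) + |(y t).2| :=
      max_le (by linarith [abs_nonneg (y t).2]) (by linarith [abs_nonneg a, abs_nonneg R])
    linarith

namespace Free

variable {g u v : ℝ → ℝ} {a : ℝ} {R : EReal} {α β : ℝ}

theorem hasDerivAt_u (h : Free g a R u v) {t : ℝ} (hat : a < t) (ht : (t : EReal) < R) :
    HasDerivAt u (v t) t :=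
  (h.der_u t hat.le ht).hasDerivAt (Ici_mem_nhds hat)

theorem hasDerivAt_v (h : Free g a R u v) {t : ℝ} (hat : a < t) (ht : (t : EReal) < R) :
    HasDerivAt v (-g (u t)) t :=
  (h.der_v t hat.le ht).hasDerivAt (Ici_mem_nhds hat)

theorem continuousOn_u (h : Free g a R u v) {s t : ℝ} (hs : a ≤ s) (ht : (t : EReal) < R) :
    ContinuousOn u (Icc s t) := fun r hr =>
  (h.der_u r (hs.trans hr.1) (coe_lt_of_le hr.2 ht)).continuousWithinAt.mono
    (fun _ hx => hs.trans hx.1)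

theorem continuousOn_v (h : Free g a R u v) {s t : ℝ} (hs : a ≤ s) (ht : (t : EReal) < R) :
    ContinuousOn v (Icc s t) := fun r hr =>
  (h.der_v r (hs.trans hr.1) (coe_lt_of_le hr.2 ht)).continuousWithinAt.mono
    (fun _ hx => hs.trans hx.1)

theorem energy (hg : IsBistable g α β) (h : Free g a R u v) {t : ℝ} (hat : a ≤ t)
    (ht : (t : EReal) < R) : v t ^ 2 / 2 + potential g (u t) = v a ^ 2 / 2 + potential g (u a) := by
  refine constant_of_has_deriv_right_zero (f := fun t => v t ^ 2 / 2 + potential g (u t))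
    (a := a) (b := t) ?_ (fun s hs => ?_) t ⟨hat, le_rfl⟩
  · exact ((h.continuousOn_v le_rfl ht).pow 2 |>.div_const 2).add
      (hg.continuous_potential.comp_continuousOn (h.continuousOn_u le_rfl ht))
  · have hsR := coe_lt_of_le hs.2.le ht
    have h1 := ((h.der_v s hs.1 hsR).pow 2).div_const 2
    have h2 := (hg.hasDerivAt_potential (u s)).comp_hasDerivWithinAt s (h.der_u s hs.1 hsR)
    refine ((h1.add h2).mono (Ici_subset_Ici.2 hs.1)).congr_deriv ?_
    norm_num
    ring

/-- A bound on `u` bounds `v' = -g u`, so on a bounded interval `v` is bounded too, which excludes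
blow-up at a finite `R`. -/
theorem eq_top_of_bounded (hg : Continuous g) (h : Free g a R u v) {C : ℝ}
    (hC : ∀ t : ℝ, a ≤ t → (t : EReal) < R → |u t| ≤ C) : R = ⊤ := by
  by_contra hRt
  have hm := h.max hRt
  have hlt := h.lt
  lift R to ℝ using ⟨hRt, (bot_le.trans_lt h.lt).ne'⟩
  have haR := EReal.coe_lt_coe_iff.1 hlt
  obtain ⟨K, hK⟩ := (isCompact_Icc (a := -C) (b := C)).exists_bound_of_continuousOn hg.continuousOn
  have := toLeft_neBot hlt
  obtain ⟨t, ht, htR⟩ := ((hm.eventually_gt_atTop (C + (|v a| + K * (R - a)))).and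
    (eventually_toLeft_of_lt hlt)).exists
  have hgK : ∀ s ∈ Icc a t, |g (u s)| ≤ K := fun s hs =>
    hK _ (abs_le.1 (hC s hs.1 (coe_lt_of_le hs.2 htR.2)))
  have hK0 : 0 ≤ K := (abs_nonneg _).trans (hgK t ⟨htR.1.le, le_rfl⟩)
  have h1 := le_add_mul_of_hasDerivAt_le htR.1.le (h.continuousOn_v le_rfl htR.2)
    (fun s hs => h.hasDerivAt_v hs.1 (coe_lt_of_le hs.2.le htR.2))
    (fun s hs => (abs_le.1 ((abs_neg _).trans_le (hgK s (Ioo_subset_Icc_self hs)))).2)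
  have h2 := add_mul_le_of_le_hasDerivAt htR.1.le (h.continuousOn_v le_rfl htR.2)
    (fun s hs => h.hasDerivAt_v hs.1 (coe_lt_of_le hs.2.le htR.2))
    (fun s hs => (abs_le.1 ((abs_neg _).trans_le (hgK s (Ioo_subset_Icc_self hs)))).1)
  have h3 : K * (t - a) ≤ K * (R - a) :=
    mul_le_mul_of_nonneg_left (by linarith [EReal.coe_lt_coe_iff.1 htR.2]) hK0
  have h4 : |v t| ≤ |v a| + K * (R - a) :=
    abs_le.2 ⟨by linarith [neg_abs_le (v a)], by linarith [le_abs_self (v a)]⟩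
  linarith [hC t htR.1.le htR.2]

/-- Admissibility of the free regime: the first factor of `Balance` vanishes identically, and only
the sign of the excess remains to be required. -/
theorem step (hg : Continuous g) (h : Free g a R u v) {s t : ℝ} (hs : a ≤ s) (hst : s < t)
    (ht : (t : EReal) < R) (hq : ∀ r ∈ Icc s t, v r + r * g (u r) ≤ 0) : Step g u v s t := by
  have hsub : Icc s t ⊆ Ici a := fun _ hx => hs.trans hx.1
  refine ⟨hst, fun r => -g (u r), (hg.comp_continuousOn (h.continuousOn_u hs ht)).neg,
    fun r hr => ⟨?_, ?_, ?_⟩⟩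
  · exact (h.der_u r (hs.trans hr.1) (coe_lt_of_le hr.2 ht)).mono hsub
  · exact (h.der_v r (hs.trans hr.1) (coe_lt_of_le hr.2 ht)).mono hsub
  · exact ⟨by simp, hq r hr, by simp⟩

theorem reach (hg : Continuous g) (h : Free g a R u v) {t : ℝ} (hat : a ≤ t)
    (ht : (t : EReal) < R) (hq : ∀ r ∈ Icc a t, v r + r * g (u r) ≤ 0) : Reach g u v a t := by
  rcases hat.eq_or_lt with rfl | hat
  · exact Relation.ReflTransGen.refl
  · exact Relation.ReflTransGen.single (h.step hg le_rfl hat ht hq)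

theorem sol (hg : Continuous g) (h : Free g a R u v)
    (hq : ∀ r : ℝ, a ≤ r → (r : EReal) < R → v r + r * g (u r) ≤ 0) : Sol g a R u v :=
  fun _ hT hTR => h.reach hg hT hTR fun r hr => hq r hr.1 (coe_lt_of_le hr.2 hTR)

/-- A solution does not reach an equilibrium in finite time. -/
theorem eq_of_equilibrium (hg : ContDiff ℝ 1 g) (h : Free g a R u v) {t z : ℝ} (hat : a ≤ t)
    (ht : (t : EReal) < R) (hz : g z = 0) (hu : u t = z) (hv : v t = 0) : u a = z := by
  have h1 : SolvesOn (freeField g) (fun s => (u s, v s)) a t := fun s hs =>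
    ((h.der_u s hs.1 (coe_lt_of_le hs.2 ht)).prodMk (h.der_v s hs.1 (coe_lt_of_le hs.2 ht))).mono
      Icc_subset_Ici_self
  have h2 : SolvesOn (freeField g) (fun _ => (z, 0)) a t := fun s _ =>
    (hasDerivWithinAt_const s (Icc a t) ((z, 0) : ℝ × ℝ)).congr_deriv
      (Prod.ext (by simp [freeField]) (by simp [freeField, hz]))
  have := h1.eqOn_left (contDiff_freeField hg) h2 (by simp [hu, hv]) (left_mem_Icc.2 hat)
  exact congrArg Prod.fst this

/-- The two terms in `g (u t)` cancel, so for `t > 0` the sign of `g'(u) v` alone decides whether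
the excess grows. -/
theorem hasDerivAt_excess (hg : IsBistable g α β) (h : Free g a R u v) {t : ℝ} (hat : a < t)
    (ht : (t : EReal) < R) :
    HasDerivAt (fun t => v t + t * g (u t)) (t * (deriv g (u t) * v t)) t := by
  have h1 := (hasDerivAt_id t).mul ((hg.hasDerivAt (u t)).comp t (h.hasDerivAt_u hat ht))
  refine ((h.hasDerivAt_v hat ht).add h1).congr_deriv ?_
  simp

theorem continuousOn_excess (hg : Continuous g) (h : Free g a R u v) {s t : ℝ} (hs : a ≤ s)
    (ht : (t : EReal) < R) : ContinuousOn (fun t => v t + t * g (u t)) (Icc s t) :=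
  (h.continuousOn_v hs ht).add (continuousOn_id.mul (hg.comp_continuousOn (h.continuousOn_u hs ht)))

end Free

namespace Drift

variable {g u : ℝ → ℝ} {a : ℝ} {R : EReal} {α β : ℝ}

theorem hasDerivAt (h : Drift g a R u) {t : ℝ} (hat : a < t) (ht : (t : EReal) < R) :
    HasDerivAt u (-(t * g (u t))) t :=
  (h.der t hat.le ht).hasDerivAt (Ici_mem_nhds hat)

theorem continuousOn (h : Drift g a R u) {s t : ℝ} (hs : a ≤ s) (ht : (t : EReal) < R) :
    ContinuousOn u (Icc s t) := fun r hr =>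
  (h.der r (hs.trans hr.1) (coe_lt_of_le hr.2 ht)).continuousWithinAt.mono
    (fun _ hx => hs.trans hx.1)

theorem eq_top_of_bounded (h : Drift g a R u) {C : ℝ}
    (hC : ∀ t : ℝ, a ≤ t → (t : EReal) < R → |u t| ≤ C) : R = ⊤ := by
  by_contra hRt
  have := toLeft_neBot h.lt
  obtain ⟨t, ht, htR⟩ := (((h.max hRt).eventually_gt_atTop C).and
    (eventually_toLeft_of_lt h.lt)).exists
  exact absurd (hC t htR.1.le htR.2) (not_le.2 ht)

/-- Admissibility of the drift: the excess vanishes identically and `w + g u = r² g(u) g'(u)`. The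
condition holds for `u` in `(-∞, -α]`, `[-β, 0]` and `[β, α]`. -/
theorem step (hg : IsBistable g α β) (h : Drift g a R u) {s t : ℝ} (hs : a ≤ s) (hst : s < t)
    (ht : (t : EReal) < R) (hq : ∀ r ∈ Icc s t, g (u r) * deriv g (u r) ≤ 0) :
    Step g u (fun r => -(r * g (u r))) s t := by
  have hsub : Icc s t ⊆ Ici a := fun _ hx => hs.trans hx.1
  have hcu := h.continuousOn hs ht
  refine ⟨hst, fun r => -(g (u r) - r ^ 2 * (g (u r) * deriv g (u r))), ?_,
    fun r hr => ⟨?_, ?_, ?_⟩⟩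
  · have hgu := hg.continuous.comp_continuousOn hcu
    have hdu := hg.continuous_deriv.comp_continuousOn hcu
    exact (hgu.sub ((continuousOn_id.pow 2).mul (hgu.mul hdu))).neg
  · exact (h.der r (hs.trans hr.1) (coe_lt_of_le hr.2 ht)).mono hsub
  · have h1 := (h.der r (hs.trans hr.1) (coe_lt_of_le hr.2 ht)).mono hsub
    have h2 := (hasDerivWithinAt_id r (Icc s t)).mul
      ((hg.hasDerivAt (u r)).comp_hasDerivWithinAt r h1)
    refine h2.neg.congr_deriv ?_
    simp only [id, Function.comp]
    ring
  · refine ⟨?_, by simp, by simp⟩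
    have := mul_nonpos_of_nonneg_of_nonpos (sq_nonneg r) (hq r hr)
    linarith

theorem reach (hg : IsBistable g α β) (h : Drift g a R u) {t : ℝ} (hat : a ≤ t)
    (ht : (t : EReal) < R) (hq : ∀ r ∈ Icc a t, g (u r) * deriv g (u r) ≤ 0) :
    Reach g u (fun r => -(r * g (u r))) a t := by
  rcases hat.eq_or_lt with rfl | hat
  · exact Relation.ReflTransGen.refl
  · exact Relation.ReflTransGen.single (h.step hg le_rfl hat ht hq)

theorem sol (hg : IsBistable g α β) (h : Drift g a R u)
    (hq : ∀ r : ℝ, a ≤ r → (r : EReal) < R → g (u r) * deriv g (u r) ≤ 0) :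
    Sol g a R u (fun r => -(r * g (u r))) :=
  fun _ hT hTR => h.reach hg hT hTR fun r hr => hq r hr.1 (coe_lt_of_le hr.2 hTR)

/-- A solution does not reach an equilibrium in finite time. -/
theorem eq_of_equilibrium (hg : ContDiff ℝ 1 g) (h : Drift g a R u) {t z : ℝ} (hat : a ≤ t)
    (ht : (t : EReal) < R) (hz : g z = 0) (hu : u t = z) : u a = z := by
  have h1 : SolvesOn (driftField g) (fun s => (s, u s)) a t := fun s hs =>
    ((hasDerivWithinAt_id s _).prodMk (h.der s hs.1 (coe_lt_of_le hs.2 ht))).mono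
      Icc_subset_Ici_self
  have h2 : SolvesOn (driftField g) (fun s => (s, z)) a t := fun s _ => by
    simpa [driftField, hz] using
      (hasDerivWithinAt_id s (Icc a t)).prodMk (hasDerivWithinAt_const s (Icc a t) z)
  have := h1.eqOn_left (contDiff_driftField hg) h2 (by simp [hu]) (left_mem_Icc.2 hat)
  exact congrArg Prod.snd this

end Drift

/-! ### Profiles starting outside `[0, α]` -/

variable {g : ℝ → ℝ} {α β : ℝ}

/-- A solution of small energy stays in the potential well. -/
theorem Free.abs_le (hg : IsBistable g α β) {a ζ : ℝ} {R : EReal} {u v : ℝ → ℝ}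
    (h : Free g a R u v) (hζα : ζ < α) (hua : |u a| ≤ ζ)
    (hE : v a ^ 2 / 2 + potential g (u a) ≤ potential g ζ) {t : ℝ} (ht : a ≤ t)
    (htR : (t : EReal) < R) : |u t| ≤ ζ := by
  by_contra! hlt
  have hζ : 0 ≤ ζ := (abs_nonneg _).trans hua
  -- Otherwise `|u|` takes the value `min (|u t|) α`, which lies in `(ζ, α]`, where the potential
  -- exceeds the available energy.
  obtain ⟨s, hs, hus⟩ := intermediate_value_Icc ht (h.continuousOn_u le_rfl htR).abs
    (show min (|u t|) α ∈ Icc (|u a|) (|u t|) from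
      ⟨hua.trans (lt_min hlt hζα).le, min_le_left _ _⟩)
  have hus : |u s| = min (|u t|) α := hus
  have he := h.energy hg hs.1 (coe_lt_of_le hs.2 htR)
  have hG := hg.strictMonoOn_potential ⟨hζ, hζα.le⟩
    ⟨(hζ.trans_lt (lt_min hlt hζα)).le, min_le_right _ _⟩ (lt_min hlt hζα)
  rw [← hg.potential_abs (u s), hus] at he
  nlinarith [sq_nonneg (v s)]

/-- Solutions starting above `α` increase to `+∞`. -/
theorem exists_sol_above (hg : IsBistable g α β) {ξ : ℝ} (hξ : α < ξ) :
    ∃ (R : EReal) (u v : ℝ → ℝ), 0 < R ∧ Sol g 0 R u v ∧ u 0 = ξ ∧ v 0 = 0 ∧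
      (∀ r : ℝ, 0 < r → (r : EReal) < R → 0 < v r) ∧ Tendsto u (toLeft R) atTop := by
  obtain ⟨R, u, v, h, hu0, hv0⟩ := exists_free hg.contDiff 0 ξ 0
  have hα := hg.alpha_pos
  have hu : ∀ t : ℝ, 0 ≤ t → (t : EReal) < R → ξ ≤ u t := by
    intro t ht htR
    by_contra! hlt
    obtain ⟨s, hs, hus⟩ := intermediate_value_Icc' ht (h.continuousOn_u le_rfl htR)
      (show max (u t) α ∈ Icc (u t) (u 0) from
        ⟨le_max_left _ _, by rw [hu0]; exact (max_lt hlt hξ).le⟩)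
    have he := h.energy hg hs.1 (coe_lt_of_le hs.2 htR)
    have hG := hg.strictAntiOn_potential (mem_Ici.2 (le_max_right (u t) α)) (mem_Ici.2 hξ.le)
      (max_lt hlt hξ)
    rw [hus, hu0, hv0] at he
    nlinarith [sq_nonneg (v s)]
  have hvmono : ∀ t : ℝ, (t : EReal) < R → StrictMonoOn v (Icc 0 t) := fun t htR =>
    strictMonoOn_of_hasDerivAt_pos (h.continuousOn_v le_rfl htR)
      (fun s hs => h.hasDerivAt_v hs.1 (coe_lt_of_le hs.2.le htR)) fun s hs =>
      neg_pos.2 (hg.neg _ (hξ.trans_le (hu s hs.1.le (coe_lt_of_le hs.2.le htR))))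
  have hv : ∀ t : ℝ, 0 < t → (t : EReal) < R → 0 < v t := fun t ht htR => by
    have := hvmono t htR (left_mem_Icc.2 ht.le) (right_mem_Icc.2 ht.le) ht
    rwa [hv0] at this
  -- Above `β`, `g' < 0` and `v > 0` make the excess, zero at the start, decrease: the free regime
  -- lasts up to `R`.
  have hq : ∀ t : ℝ, 0 ≤ t → (t : EReal) < R → v t + t * g (u t) ≤ 0 := fun t ht htR => by
    have := (strictAntiOn_of_hasDerivAt_neg (h.continuousOn_excess hg.continuous le_rfl htR)
      (fun s hs => h.hasDerivAt_excess hg hs.1 (coe_lt_of_le hs.2.le htR)) fun s hs => by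
        have hsR := coe_lt_of_le hs.2.le htR
        have h1 := hg.deriv_neg (u s) (by
          have := hu s hs.1.le hsR
          have := hg.beta_lt_alpha
          simp only [mem_Ioi]; linarith)
        exact mul_neg_of_pos_of_neg hs.1 (mul_neg_of_neg_of_pos h1 (hv s hs.1 hsR))).antitoneOn
      (left_mem_Icc.2 ht) (right_mem_Icc.2 ht) ht
    simpa [hv0] using this
  refine ⟨R, u, v, h.lt, h.sol hg.continuous hq, hu0, hv0, hv,
    tendsto_atTop_toLeft (a := 0) (fun s t hs hst htR => ?_) fun C => ?_⟩
  · exact (strictMonoOn_of_hasDerivAt_pos (h.continuousOn_u hs htR)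
      (fun r hr => h.hasDerivAt_u (hs.trans_lt hr.1) (coe_lt_of_le hr.2.le htR))
      fun r hr => hv r (hs.trans_lt hr.1) (coe_lt_of_le hr.2.le htR)).monotoneOn
      (left_mem_Icc.2 hst) (right_mem_Icc.2 hst) hst
  · by_contra! hcon
    obtain rfl : R = ⊤ := h.eq_top_of_bounded hg.continuous (C := C) fun t ht htR =>
      abs_le.2 ⟨by linarith [hu t ht htR, hcon t ht htR], (hcon t ht htR).le⟩
    obtain ⟨t, ht1, ht2⟩ := exists_ge_of_le_deriv (s := 1) (hv 1 one_pos (EReal.coe_lt_top _))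
      (fun t => h.continuousOn_u zero_le_one (EReal.coe_lt_top t))
      (fun t ht => h.hasDerivAt_u (by linarith) (EReal.coe_lt_top t))
      (fun t ht => (hvmono t (EReal.coe_lt_top t)).monotoneOn ⟨zero_le_one, ht.le⟩
        ⟨by linarith, le_rfl⟩ ht.le) C
    exact absurd (hcon t (by linarith) (EReal.coe_lt_top t)) (not_lt.2 ht2)

/-- Below `-α`, solutions of the first order equation decrease to `-∞`. -/
theorem exists_sol_below (hg : IsBistable g α β) {a u₀ : ℝ} (ha : 0 ≤ a) (hu₀ : u₀ < -α) :
    ∃ (R : EReal) (u v : ℝ → ℝ), a < R ∧ Sol g a R u v ∧ u a = u₀ ∧ v a = -(a * g u₀) ∧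
      (∀ r : ℝ, a < r → (r : EReal) < R → v r < 0) ∧ Tendsto u (toLeft R) atBot := by
  obtain ⟨R, u, h, hu0⟩ := exists_drift hg.contDiff a u₀
  -- The barrier is the midpoint of `u₀` and `-α` rather than `u₀`: for `a = 0` the drift vanishes
  -- at the start, so the level `u₀` is not crossed with negative slope.
  set c := (u₀ - α) / 2 with hc
  have hcα : c < -α := by rw [hc]; linarith
  have hβα := hg.beta_lt_alpha
  have hα := hg.alpha_pos
  have hu : ∀ t : ℝ, a ≤ t → (t : EReal) < R → u t ≤ c := fun t ht htR =>
    le_of_deriv_neg_at_level (h.continuousOn le_rfl htR)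
      (fun s hs => (h.der s hs.1 (coe_lt_of_le hs.2.le htR)).mono (Ici_subset_Ici.2 hs.1))
      (by rw [hu0, hc]; linarith) (fun s hs hsc => by
        have has : a < s := lt_of_le_of_ne hs.1 (by
          rintro rfl
          rw [hu0, hc] at hsc
          linarith)
        rw [hsc]
        exact neg_neg_of_pos (mul_pos (ha.trans_lt has) (hg.pos_of_lt_neg_alpha hcα)))
      t ⟨ht, le_rfl⟩
  have hgpos : ∀ t : ℝ, a ≤ t → (t : EReal) < R → 0 < g (u t) := fun t ht htR =>
    hg.pos_of_lt_neg_alpha ((hu t ht htR).trans_lt hcα)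
  have hv : ∀ t : ℝ, a < t → (t : EReal) < R → -(t * g (u t)) < 0 := fun t ht htR =>
    neg_neg_of_pos (mul_pos (ha.trans_lt ht) (hgpos t ht.le htR))
  have hsol := h.sol hg fun r hr hrR => by
    refine mul_nonpos_of_nonneg_of_nonpos (hgpos r hr hrR).le (hg.deriv_nonpos_of_le_abs ?_)
    have := hu r hr hrR
    rw [abs_of_neg] <;> linarith
  have hanti : ∀ s t : ℝ, a ≤ s → s ≤ t → (t : EReal) < R → u t ≤ u s := fun s t hs hst htR =>
    (strictAntiOn_of_hasDerivAt_neg (h.continuousOn hs htR)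
      (fun r hr => h.hasDerivAt (hs.trans_lt hr.1) (coe_lt_of_le hr.2.le htR))
      fun r hr => hv r (hs.trans_lt hr.1) (coe_lt_of_le hr.2.le htR)).antitoneOn
      (left_mem_Icc.2 hst) (right_mem_Icc.2 hst) hst
  refine ⟨R, u, _, h.lt, hsol, hu0, by simp only [hu0], hv,
    tendsto_atBot_toLeft hanti fun C => ?_⟩
  by_contra! hcon
  obtain rfl : R = ⊤ := h.eq_top_of_bounded (C := -C) fun t ht htR =>
    abs_le.2 ⟨by linarith [hcon t ht htR], by linarith [hcon t ht htR, hu t ht htR]⟩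
  -- Starting at `a + 1` ensures `t ≥ 1`, hence `t * g (u t) ≥ g c`.
  obtain ⟨t, ht1, ht2⟩ := exists_le_of_deriv_le (s := a + 1) (hg.pos_of_lt_neg_alpha hcα)
    (fun t => h.continuousOn (by linarith) (EReal.coe_lt_top t))
    (fun t ht => h.hasDerivAt (by linarith) (EReal.coe_lt_top t))
    (fun t ht => by
      have hut := hu t (by linarith) (EReal.coe_lt_top t)
      have h1 : g c ≤ g (u t) := hg.antitoneOn_Iic (mem_Iic.2 (by linarith))
        (mem_Iic.2 (by linarith)) hut
      have h2 := hgpos t (by linarith) (EReal.coe_lt_top t)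
      nlinarith) C
  exact absurd (hcon t (by linarith) (EReal.coe_lt_top t)) (not_lt.2 ht2)

/-- In `[-β, 0)`, solutions of the first order equation increase to `0`. -/
theorem exists_sol_to_zero (hg : IsBistable g α β) {a u₀ : ℝ} (ha : 0 ≤ a) (hu₀ : -β ≤ u₀)
    (hu₀' : u₀ < 0) :
    ∃ u v : ℝ → ℝ, Sol g a ⊤ u v ∧ u a = u₀ ∧ v a = -(a * g u₀) ∧
      (∀ r : ℝ, a < r → 0 < v r) ∧ Tendsto u atTop (𝓝 0) := by
  obtain ⟨R, u, h, hu0⟩ := exists_drift hg.contDiff a u₀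
  have hβα := hg.beta_lt_alpha
  have hβ := hg.beta_pos
  have hneg : ∀ t : ℝ, a ≤ t → (t : EReal) < R → u t < 0 := by
    intro t ht htR
    by_contra! hcon
    obtain ⟨c, hc, hc0, -⟩ := exists_first_zero (h.continuousOn le_rfl htR) ht (by rwa [hu0]) hcon
    have := h.eq_of_equilibrium hg.contDiff hc.1.le (coe_lt_of_le hc.2 htR) hg.zero hc0
    linarith
  have hge : ∀ t : ℝ, a ≤ t → (t : EReal) < R → u₀ ≤ u t := by
    intro t ht htR
    -- The drift may vanish at the start, so levels `c < u₀` serve as barriers; raising them to `-(α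
    -- + β) / 2` or more keeps them above `-α`, where `g < 0`.
    refine le_of_forall_lt_imp_le_of_dense fun c hc => ?_
    have hc' : max c (-(α + β) / 2) < u₀ := max_lt hc (by linarith)
    refine (le_max_left _ (-(α + β) / 2)).trans
      (le_of_deriv_pos_at_level (h.continuousOn le_rfl htR)
        (fun s hs => (h.der s hs.1 (coe_lt_of_le hs.2.le htR)).mono (Ici_subset_Ici.2 hs.1))
        (by rw [hu0]; exact hc'.le) (fun s hs hsc => ?_) t ⟨ht, le_rfl⟩)
    have has : a < s := lt_of_le_of_ne hs.1 (by rintro rfl; rw [hu0] at hsc; linarith)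
    have h1 : g (u s) < 0 := hg.neg_of_mem_neg
      (by rw [hsc]; exact lt_of_lt_of_le (by linarith) (le_max_right _ _))
      (hneg s hs.1 (coe_lt_of_le hs.2.le htR))
    exact neg_pos.2 (mul_neg_of_pos_of_neg (ha.trans_lt has) h1)
  obtain rfl : R = ⊤ := h.eq_top_of_bounded (C := β) fun t ht htR =>
    abs_le.2 ⟨by linarith [hge t ht htR], by linarith [hneg t ht htR]⟩
  have hneg : ∀ t : ℝ, a ≤ t → u t < 0 := fun t ht => hneg t ht (EReal.coe_lt_top t)
  have hge : ∀ t : ℝ, a ≤ t → u₀ ≤ u t := fun t ht => hge t ht (EReal.coe_lt_top t)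
  have hgneg : ∀ t : ℝ, a ≤ t → g (u t) < 0 := fun t ht =>
    hg.neg_of_mem_neg (by linarith [hge t ht]) (hneg t ht)
  have hv : ∀ t : ℝ, a < t → 0 < -(t * g (u t)) := fun t ht =>
    neg_pos.2 (mul_neg_of_pos_of_neg (ha.trans_lt ht) (hgneg t ht.le))
  have hsol := h.sol hg fun r hr _ => by
    refine mul_nonpos_of_nonpos_of_nonneg (hgneg r hr).le (hg.deriv_nonneg_of_abs_le ?_)
    exact abs_le.2 ⟨by linarith [hge r hr], by linarith [hneg r hr]⟩
  have hmono : ∀ s t : ℝ, a ≤ s → s ≤ t → u s ≤ u t := fun s t hs hst =>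
    (strictMonoOn_of_hasDerivAt_pos (h.continuousOn hs (EReal.coe_lt_top t))
      (fun r hr => h.hasDerivAt (hs.trans_lt hr.1) (EReal.coe_lt_top r))
      fun r hr => hv r (hs.trans_lt hr.1)).monotoneOn
      (left_mem_Icc.2 hst) (right_mem_Icc.2 hst) hst
  refine ⟨u, _, hsol, hu0, by simp only [hu0], hv, ?_⟩
  rw [tendsto_order]
  refine ⟨fun e he => ?_, fun e he => ?_⟩
  · suffices hex : ∃ t, a ≤ t ∧ e < u t by
      obtain ⟨t, hat, ht⟩ := hex
      filter_upwards [eventually_ge_atTop t] with s hs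
      exact ht.trans_le (hmono t s hat hs)
    by_contra! hcon
    have he' := (hge a le_rfl).trans (hcon a le_rfl)
    obtain ⟨t, ht1, ht2⟩ := exists_ge_of_le_deriv (s := a + 1)
      (neg_pos.2 (hg.neg_of_mem_neg (by linarith : -α < e) he))
      (fun t => h.continuousOn (by linarith) (EReal.coe_lt_top t))
      (fun t ht => h.hasDerivAt (by linarith) (EReal.coe_lt_top t))
      (fun t ht => by
        have hat : a ≤ t := by linarith
        have h1 : g (u t) ≤ g e := hg.monotoneOn_Icc
          ⟨by linarith [hge t hat], by linarith [hneg t hat]⟩ ⟨by linarith, by linarith⟩ (hcon t hat)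
        have h2 := hgneg t hat
        nlinarith) 0
    exact absurd (hneg t (by linarith)) (not_lt.2 ht2)
  · filter_upwards [eventually_ge_atTop a] with s hs
    exact (hneg s hs).trans he

/-- Solutions starting from rest in `(-α, 0)` increase to `0`. -/
theorem exists_sol_rest (hg : IsBistable g α β) {b ζ : ℝ} (hb : 0 ≤ b) (hζ : 0 < ζ)
    (hζα : ζ < α) :
    ∃ u v : ℝ → ℝ, Sol g b ⊤ u v ∧ u b = -ζ ∧ v b = 0 ∧
      (∀ r : ℝ, b < r → 0 < v r) ∧ Tendsto u atTop (𝓝 0) := by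
  have hβα := hg.beta_lt_alpha
  have hβ := hg.beta_pos
  -- In this case the excess starts at zero and would grow in the free regime, since `g' > 0` and `v
  -- > 0`; the drift must start at once. Otherwise a free piece comes first.
  by_cases hcase : b = 0 ∧ ζ ≤ β
  · obtain ⟨rfl, hζβ⟩ := hcase
    obtain ⟨u, v, h1, h2, h3, h4, h5⟩ := exists_sol_to_zero hg hb (neg_le_neg hζβ) (neg_neg_of_pos hζ)
    exact ⟨u, v, h1, h2, by simpa using h3, h4, h5⟩
  obtain ⟨R, u, v, h, hu0, hv0⟩ := exists_free hg.contDiff b (-ζ) 0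
  have hR : ∀ t : ℝ, b ≤ t → (t : EReal) < R → |u t| ≤ ζ := fun t ht htR =>
    h.abs_le hg hζα (by rw [hu0, abs_neg, abs_of_pos hζ])
      (by rw [hu0, hv0, hg.potential_neg]; simp) ht htR
  obtain rfl : R = ⊤ := h.eq_top_of_bounded hg.continuous hR
  have hR : ∀ t : ℝ, b ≤ t → |u t| ≤ ζ := fun t ht => hR t ht (EReal.coe_lt_top t)
  have hcu : ∀ s t : ℝ, b ≤ s → ContinuousOn u (Icc s t) := fun s t hs =>
    h.continuousOn_u hs (EReal.coe_lt_top t)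
  have hcv : ∀ s t : ℝ, b ≤ s → ContinuousOn v (Icc s t) := fun s t hs =>
    h.continuousOn_v hs (EReal.coe_lt_top t)
  have hdu : ∀ t : ℝ, b < t → HasDerivAt u (v t) t := fun t ht =>
    h.hasDerivAt_u ht (EReal.coe_lt_top t)
  have hvmono : ∀ T : ℝ, (∀ t ∈ Ico b T, u t < 0) → StrictMonoOn v (Icc b T) := fun T hT =>
    strictMonoOn_of_hasDerivAt_pos (hcv b T le_rfl)
      (fun s hs => h.hasDerivAt_v hs.1 (EReal.coe_lt_top s)) fun s hs =>
      neg_pos.2 (hg.neg_of_mem_neg (by linarith [(abs_le.1 (hR s hs.1.le)).1])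
        (hT s ⟨hs.1.le, hs.2⟩))
  -- `u` reaches `0`
  obtain ⟨s₀, hs₀b, hus₀, hs₀⟩ : ∃ s₀, b < s₀ ∧ u s₀ = 0 ∧ ∀ t ∈ Ico b s₀, u t < 0 := by
    suffices hex : ∃ t, b ≤ t ∧ 0 ≤ u t by
      obtain ⟨t, ht, hut⟩ := hex
      obtain ⟨c, hc, h1, h2⟩ := exists_first_zero (hcu b t le_rfl) ht (by rw [hu0]; linarith) hut
      exact ⟨c, hc.1, h1, h2⟩
    by_contra! hcon
    have hm : ∀ T, StrictMonoOn v (Icc b T) := fun T => hvmono T fun t ht => hcon t ht.1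
    have hv1 : 0 < v (b + 1) := by
      rw [← hv0]
      exact hm (b + 1) ⟨le_rfl, by linarith⟩ ⟨by linarith, le_rfl⟩ (by linarith)
    obtain ⟨t, ht1, ht2⟩ := exists_ge_of_le_deriv (s := b + 1) hv1
      (fun t => hcu _ t (by linarith)) (fun t ht => hdu t (by linarith))
      (fun t ht => (hm t).monotoneOn ⟨by linarith, ht.le⟩ ⟨by linarith, le_rfl⟩ ht.le) 0
    exact absurd (hcon t (by linarith)) (not_lt.2 ht2)
  have hvm := hvmono s₀ hs₀
  have hvpos : ∀ t ∈ Ioc b s₀, 0 < v t := fun t ht => by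
    have := hvm (left_mem_Icc.2 hs₀b.le) (Ioc_subset_Icc_self ht) ht.1
    rwa [hv0] at this
  have hum : StrictMonoOn u (Icc b s₀) := strictMonoOn_of_hasDerivAt_pos (hcu b s₀ le_rfl)
    (fun s hs => hdu s hs.1) fun s hs => hvpos s (Ioo_subset_Ioc_self hs)
  have hcq : ∀ s t, b ≤ s → ContinuousOn (fun t => v t + t * g (u t)) (Icc s t) := fun s t hs =>
    h.continuousOn_excess hg.continuous hs (EReal.coe_lt_top t)
  have hqb : v b + b * g (u b) ≤ 0 := by
    rw [hv0, hu0, hg.odd, zero_add]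
    have := mul_nonneg hb (hg.pos ζ ⟨hζ, hζα⟩).le
    linarith
  -- the excess is negative when `u` enters `[-β, 0)`
  obtain ⟨s₁, hs₁, hus₁, hqs₁, hq₁⟩ : ∃ s₁ ∈ Ico b s₀, -β ≤ u s₁ ∧ v s₁ + s₁ * g (u s₁) < 0 ∧
      ∀ t ∈ Icc b s₁, v t + t * g (u t) ≤ 0 := by
    rcases le_or_gt ζ β with hζβ | hζβ
    · refine ⟨b, ⟨le_rfl, hs₀b⟩, by rw [hu0]; linarith, ?_, fun t ht => ?_⟩
      · have hb0 : 0 < b := lt_of_le_of_ne hb fun h0 => hcase ⟨h0.symm, hζβ⟩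
        rw [hv0, hu0, hg.odd, zero_add]
        have := mul_pos hb0 (hg.pos ζ ⟨hζ, hζα⟩)
        linarith
      · rw [le_antisymm ht.2 ht.1]; exact hqb
    · obtain ⟨s, hs, hus⟩ := intermediate_value_Icc hs₀b.le (hcu b s₀ le_rfl)
        (show -β ∈ Icc (u b) (u s₀) from ⟨by rw [hu0]; linarith, by rw [hus₀]; linarith⟩)
      have hbs : b < s := lt_of_le_of_ne hs.1 (by rintro rfl; rw [hu0] at hus; linarith)
      have hss₀ : s < s₀ := lt_of_le_of_ne hs.2 (by rintro rfl; rw [hus₀] at hus; linarith)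
      have hqanti : StrictAntiOn (fun t => v t + t * g (u t)) (Icc b s) :=
        strictAntiOn_of_hasDerivAt_neg (hcq b s le_rfl)
          (fun t ht => h.hasDerivAt_excess hg ht.1 (EReal.coe_lt_top t)) fun t ht => by
            have h1 : u t < u s := hum ⟨ht.1.le, (ht.2.trans hss₀).le⟩ hs ht.2
            have h2 : deriv g (u t) < 0 := hg.deriv_neg_of_lt_abs (by
              rw [hus] at h1
              rw [abs_of_neg (by linarith)]; linarith)
            exact mul_neg_of_pos_of_neg (hb.trans_lt ht.1)
              (mul_neg_of_neg_of_pos h2 (hvpos t ⟨ht.1, (ht.2.trans hss₀).le⟩))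
      refine ⟨s, ⟨hs.1, hss₀⟩, hus.ge, ?_, fun t ht => ?_⟩
      · exact (hqanti (left_mem_Icc.2 hs.1) (right_mem_Icc.2 hs.1) hbs).trans_le hqb
      · exact (hqanti.antitoneOn (left_mem_Icc.2 hs.1) ht ht.1).trans hqb
  -- At the zero of `u` the excess is `v > 0`, so it vanishes earlier, at some `c` with `u c ∈ [-β,
  -- 0)`. There `v c = -(c * g (u c))`, and the drift takes over with matching slope.
  have hqs₀ : 0 < v s₀ + s₀ * g (u s₀) := by
    rw [hus₀, hg.zero, mul_zero, add_zero]
    exact hvpos s₀ ⟨hs₀b, le_rfl⟩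
  obtain ⟨c, hc, hqc, hq₂⟩ := exists_first_zero (hcq s₁ s₀ hs₁.1) hs₁.2.le hqs₁ hqs₀.le
  have hcs₀ : c < s₀ := lt_of_le_of_ne hc.2 (by rintro rfl; exact hqs₀.ne' hqc)
  have hbc : b < c := hs₁.1.trans_lt hc.1
  have huc : -β ≤ u c := hus₁.trans (hum ⟨hs₁.1, hs₁.2.le⟩ ⟨hbc.le, hc.2⟩ hc.1).le
  have hreach : Reach g u v b c := h.reach hg.continuous hbc.le (EReal.coe_lt_top c) fun t ht => by
    rcases le_or_gt t s₁ with hts | hts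
    · exact hq₁ t ⟨ht.1, hts⟩
    · rcases ht.2.eq_or_lt with rfl | htc
      · exact hqc.le
      · exact (hq₂ t ⟨hts.le, htc⟩).le
  obtain ⟨u₂, v₂, hsol₂, hu₂, hv₂, hv₂pos, hlim⟩ :=
    exists_sol_to_zero hg (hb.trans hbc.le) huc (hs₀ c ⟨hbc.le, hcs₀⟩)
  obtain ⟨U, V, hSol, hU1, hV1, hU2, hV2⟩ := hreach.glue hsol₂ hu₂.symm
    (by rw [hv₂]; linarith [show v c + c * g (u c) = 0 from hqc])
  refine ⟨U, V, hSol, ?_, ?_, fun r hr => ?_, ?_⟩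
  · rw [hU1 hbc.le, hu0]
  · rw [hV1 hbc.le, hv0]
  · rcases le_or_gt r c with hrc | hrc
    · rw [hV1 hrc]; exact hvpos r ⟨hr, hrc.trans hc.2⟩
    · rw [hV2 hrc.le]; exact hv₂pos r hrc
  · refine hlim.congr' ?_
    filter_upwards [eventually_ge_atTop c] with r hr
    exact (hU2 hr).symm

theorem IsBistable.nonpos_of_mem (hg : IsBistable g α β) {s : ℝ} (h1 : -α ≤ s) (h2 : s ≤ 0) :
    g s ≤ 0 := by
  rcases h1.eq_or_lt with h1 | h1
  · rw [← h1, hg.odd, hg.alpha_zero, neg_zero]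
  rcases h2.eq_or_lt with h2 | h2
  · rw [h2, hg.zero]
  · exact (hg.neg_of_mem_neg h1 h2).le

/-! ### The descent from `(0, β]`, by energy level -/

section Descent

variable {a : ℝ} {R : EReal} {u v : ℝ → ℝ}

/-- A bootstrap: as long as `v < 0`, `u` stays in `(0, β]`, so `v' = -g u < 0`, and `v` has no first
return to zero. If `v a = 0`, the negative derivative at `a` starts the argument. -/
theorem Free.strictAntiOn_of_pos (hg : IsBistable g α β) (h : Free g a R u v)
    (hu : u a ∈ Ioc 0 β) (hv : v a ≤ 0) {T : ℝ} (hTR : (T : EReal) < R)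
    (hpos : ∀ t ∈ Ico a T, 0 < u t) : StrictAntiOn v (Icc a T) := by
  have hβα := hg.beta_lt_alpha
  have key : ∀ c : ℝ, c ≤ T → (∀ t ∈ Ioo a c, v t < 0) → StrictAntiOn v (Icc a c) := by
    intro c hcT hneg
    have hcR := coe_lt_of_le hcT hTR
    have hanti : StrictAntiOn u (Icc a c) :=
      strictAntiOn_of_hasDerivAt_neg (h.continuousOn_u le_rfl hcR)
        (fun s hs => h.hasDerivAt_u hs.1 (coe_lt_of_le hs.2.le hcR)) hneg
    refine strictAntiOn_of_hasDerivAt_neg (h.continuousOn_v le_rfl hcR)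
      (fun s hs => h.hasDerivAt_v hs.1 (coe_lt_of_le hs.2.le hcR)) fun s hs => ?_
    have h1 := hanti.antitoneOn ⟨le_rfl, hs.1.le.trans hs.2.le⟩ ⟨hs.1.le, hs.2.le⟩ hs.1.le
    exact neg_neg_of_pos (hg.pos _ ⟨hpos s ⟨hs.1.le, hs.2.trans_le hcT⟩, by linarith [hu.2]⟩)
  refine key T le_rfl fun t ht => ?_
  by_contra! hcon
  have htR := coe_lt_of_le ht.2.le hTR
  have hga : 0 < g (u a) := hg.pos _ ⟨hu.1, hu.2.trans_lt hβα⟩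
  obtain ⟨c, hc, hc0, hcneg⟩ := exists_first_zero_of_deriv_neg (h.continuousOn_v le_rfl htR) ht.1 hv
    (h.der_v a le_rfl h.lt) (neg_neg_of_pos hga) hcon
  have := key c (hc.2.trans ht.2.le) hcneg (left_mem_Icc.2 hc.1.le) (right_mem_Icc.2 hc.1.le) hc.1
  linarith

/-- The first descent: from `(0, β]` with nonpositive velocity, `u` decreases to `0`. -/
theorem Free.exists_zero (hg : IsBistable g α β) (ha : 0 ≤ a) (h : Free g a R u v)
    (hu : u a ∈ Ioc 0 β) (hv : v a ≤ 0) (hq : v a + a * g (u a) ≤ 0) :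
    ∃ s : ℝ, a < s ∧ (s : EReal) < R ∧ u s = 0 ∧ (∀ t ∈ Ioc a s, v t < 0) ∧
      ∀ t ∈ Icc a s, v t + t * g (u t) ≤ 0 := by
  have hβα := hg.beta_lt_alpha
  have hex : ∃ t : ℝ, a ≤ t ∧ (t : EReal) < R ∧ u t ≤ 0 := by
    by_contra! hcon
    have hanti : ∀ T : ℝ, (T : EReal) < R → StrictAntiOn v (Icc a T) := fun T hT =>
      h.strictAntiOn_of_pos hg hu hv hT fun t ht => hcon t ht.1 (coe_lt_of_le ht.2.le hT)
    have hneg : ∀ t : ℝ, a < t → (t : EReal) < R → v t < 0 := fun t ht htR =>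
      (hanti t htR (left_mem_Icc.2 ht.le) (right_mem_Icc.2 ht.le) ht).trans_le hv
    obtain rfl : R = ⊤ := h.eq_top_of_bounded hg.continuous (C := u a) fun t ht htR => by
      rw [abs_of_pos (hcon t ht htR)]
      exact (strictAntiOn_of_hasDerivAt_neg (h.continuousOn_u le_rfl htR)
        (fun s hs => h.hasDerivAt_u hs.1 (coe_lt_of_le hs.2.le htR))
        fun s hs => hneg s hs.1 (coe_lt_of_le hs.2.le htR)).antitoneOn
        (left_mem_Icc.2 ht) (right_mem_Icc.2 ht) ht
    have hv1 := hneg (a + 1) (by linarith) (EReal.coe_lt_top _)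
    obtain ⟨t, ht1, ht2⟩ := exists_le_of_deriv_le (s := a + 1) (neg_pos.2 hv1)
      (fun t => h.continuousOn_u (by linarith) (EReal.coe_lt_top t))
      (fun t ht => h.hasDerivAt_u (by linarith) (EReal.coe_lt_top t))
      (fun t ht => by
        rw [neg_neg]
        exact (hanti t (EReal.coe_lt_top t)).antitoneOn ⟨by linarith, ht.le⟩
          ⟨by linarith, le_rfl⟩ ht.le) 0
    exact absurd (hcon t (by linarith) (EReal.coe_lt_top t)) (not_lt.2 ht2)
  obtain ⟨t, hat, htR, hut⟩ := hex
  obtain ⟨s, hs, hus, hpos⟩ := exists_first_zero (f := fun t => -u t)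
    (h.continuousOn_u le_rfl htR).neg hat (neg_neg_of_pos hu.1) (neg_nonneg.2 hut)
  have hsR := coe_lt_of_le hs.2 htR
  have hpos : ∀ t ∈ Ico a s, 0 < u t := fun t ht => neg_neg_iff_pos.1 (hpos t ht)
  have hva := h.strictAntiOn_of_pos hg hu hv hsR hpos
  have hneg : ∀ t ∈ Ioc a s, v t < 0 := fun t ht =>
    (hva (left_mem_Icc.2 hs.1.le) (Ioc_subset_Icc_self ht) ht.1).trans_le hv
  have hua : StrictAntiOn u (Icc a s) :=
    strictAntiOn_of_hasDerivAt_neg (h.continuousOn_u le_rfl hsR)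
      (fun r hr => h.hasDerivAt_u hr.1 (coe_lt_of_le hr.2.le hsR))
      fun r hr => hneg r (Ioo_subset_Ioc_self hr)
  -- On the way `u ∈ (0, β)`, so `g' > 0` and `v < 0` make the excess decrease.
  have hqa : StrictAntiOn (fun t => v t + t * g (u t)) (Icc a s) :=
    strictAntiOn_of_hasDerivAt_neg (h.continuousOn_excess hg.continuous le_rfl hsR)
      (fun r hr => h.hasDerivAt_excess hg hr.1 (coe_lt_of_le hr.2.le hsR)) fun r hr => by
        have h1 := hua (left_mem_Icc.2 hs.1.le) (Ioo_subset_Icc_self hr) hr.1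
        have h2 := hpos r ⟨hr.1.le, hr.2⟩
        have h3 : 0 < deriv g (u r) := hg.deriv_pos_of_abs_lt (by
          rw [abs_of_pos h2]; linarith [hu.2])
        exact mul_neg_of_pos_of_neg (ha.trans_lt hr.1)
          (mul_neg_of_pos_of_neg h3 (hneg r (Ioo_subset_Ioc_self hr)))
  refine ⟨s, hs.1, hsR, neg_eq_zero.1 hus, hneg, fun t ht => ?_⟩
  exact (hqa.antitoneOn (left_mem_Icc.2 hs.1.le) ht ht.1).trans hq

theorem Free.strictAntiOn_u (h : Free g a R u v) {T : ℝ} (hTR : (T : EReal) < R)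
    (hneg : ∀ t ∈ Ioo a T, v t < 0) : StrictAntiOn u (Icc a T) :=
  strictAntiOn_of_hasDerivAt_neg (h.continuousOn_u le_rfl hTR)
    (fun s hs => h.hasDerivAt_u hs.1 (coe_lt_of_le hs.2.le hTR)) hneg

/-- The energy confines `u` to `[-ζ, ζ]` with `ζ < α`. Below zero, `v' = -g u > 0` brings `u` to
rest at some `b` with `u b ∈ (-α, 0)`, where `exists_sol_rest` continues. Up to `b` the excess is
nonpositive: by `Free.exists_zero` while `u ≥ 0`, and then because `v ≤ 0` and `g u ≤ 0`. -/
theorem exists_sol_subcritical (hg : IsBistable g α β) {y₀ v₀ : ℝ} (ha : 0 ≤ a)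
    (hy : y₀ ∈ Ioc 0 β) (hv : v₀ ≤ 0) (hq : v₀ + a * g y₀ ≤ 0)
    (hE : v₀ ^ 2 / 2 + potential g y₀ < potential g α) :
    ∃ u v : ℝ → ℝ, Sol g a ⊤ u v ∧ u a = y₀ ∧ v a = v₀ ∧ ∃ b, a < b ∧
      (∀ r ∈ Ioo a b, v r < 0) ∧ u b < 0 ∧ (∀ r, b < r → 0 < v r) ∧ Tendsto u atTop (𝓝 0) := by
  obtain ⟨R, u, v, h, rfl, rfl⟩ := exists_free hg.contDiff a y₀ v₀
  have hβα := hg.beta_lt_alpha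
  obtain ⟨ζ, hζ, hGζ⟩ := intermediate_value_Icc (hy.2.trans hβα.le)
    hg.continuous_potential.continuousOn
    (show v a ^ 2 / 2 + potential g (u a) ∈ Icc (potential g (u a)) (potential g α) from
      ⟨by linarith [sq_nonneg (v a)], hE.le⟩)
  have hζα : ζ < α := lt_of_le_of_ne hζ.2 (by rintro rfl; linarith)
  have hbd : ∀ t : ℝ, a ≤ t → (t : EReal) < R → |u t| ≤ ζ := fun t ht htR =>
    h.abs_le hg hζα (by rw [abs_of_pos hy.1]; exact hζ.1) hGζ.ge ht htR
  obtain rfl : R = ⊤ := h.eq_top_of_bounded hg.continuous hbd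
  have hbd : ∀ t : ℝ, a ≤ t → -ζ ≤ u t := fun t ht => (abs_le.1 (hbd t ht (EReal.coe_lt_top t))).1
  obtain ⟨s, has, -, hus, hvs, hqs⟩ := h.exists_zero hg ha hy hv hq
  have hex : ∃ t, a < t ∧ 0 ≤ v t := by
    by_contra! hcon
    have hanti : ∀ T : ℝ, StrictAntiOn u (Icc a T) := fun T =>
      h.strictAntiOn_u (EReal.coe_lt_top T) fun t ht => hcon t ht.1
    have hs1 : u (s + 1) < 0 := by
      rw [← hus]
      exact hanti (s + 1) ⟨has.le, by linarith⟩ ⟨by linarith, le_rfl⟩ (by linarith)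
    -- If `u` decreased forever, it would stay in this compact subset of `(-α, 0)`, where `v' ≥ -g x
    -- > 0`.
    obtain ⟨x, hx, hmax⟩ := (isCompact_Icc (a := -ζ) (b := u (s + 1))).exists_isMaxOn
      (nonempty_Icc.2 (hbd _ (by linarith))) hg.continuous.continuousOn
    have hgx : g x < 0 := hg.neg_of_mem_neg (by linarith [hx.1]) (by linarith [hx.2])
    obtain ⟨t, ht1, ht2⟩ := exists_ge_of_le_deriv (s := s + 1) (neg_pos.2 hgx)
      (fun t => h.continuousOn_v (by linarith) (EReal.coe_lt_top t))
      (fun t ht => h.hasDerivAt_v (by linarith) (EReal.coe_lt_top t))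
      (fun t ht => neg_le_neg (hmax (show u t ∈ Icc (-ζ) (u (s + 1)) from
        ⟨hbd t (by linarith), (hanti t).antitoneOn ⟨by linarith, ht.le⟩ ⟨by linarith, le_rfl⟩ ht.le⟩)))
      0
    exact absurd (hcon t (by linarith)) (not_lt.2 ht2)
  obtain ⟨t, hat, hvt⟩ := hex
  have hga : 0 < g (u a) := hg.pos _ ⟨hy.1, hy.2.trans_lt hβα⟩
  obtain ⟨b, hb, hvb, hneg⟩ := exists_first_zero_of_deriv_neg
    (h.continuousOn_v le_rfl (EReal.coe_lt_top t)) hat hv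
    (h.der_v a le_rfl h.lt) (neg_neg_of_pos hga) hvt
  have hsb : s < b := by
    by_contra! hbs
    exact absurd hvb (hvs b ⟨hb.1, hbs⟩).ne
  have hua := h.strictAntiOn_u (EReal.coe_lt_top b) hneg
  have hub : u b < 0 := by
    rw [← hus]
    exact hua ⟨has.le, hsb.le⟩ ⟨hb.1.le, le_rfl⟩ hsb
  have hreach : Reach g u v a b := h.reach hg.continuous hb.1.le (EReal.coe_lt_top b) fun r hr => by
    rcases le_or_gt r s with hrs | hrs
    · exact hqs r ⟨hr.1, hrs⟩
    · have h1 : u r ≤ 0 := by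
        rw [← hus]
        exact hua.antitoneOn ⟨has.le, hsb.le⟩ hr hrs.le
      have h2 : v r ≤ 0 := by
        rcases hr.2.eq_or_lt with rfl | hrb
        · exact hvb.le
        · exact (hneg r ⟨has.trans hrs, hrb⟩).le
      have h3 := mul_nonpos_of_nonneg_of_nonpos (ha.trans hr.1)
        (hg.nonpos_of_mem (by linarith [hbd r hr.1]) h1)
      linarith
  obtain ⟨u₂, v₂, hsol₂, hu₂, hv₂, hv₂pos, hlim⟩ :=
    exists_sol_rest hg (ha.trans hb.1.le) (neg_pos.2 hub) (by linarith [hbd b hb.1.le])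
  obtain ⟨U, V, hSol, hU1, hV1, hU2, hV2⟩ := hreach.glue hsol₂ (by rw [hu₂, neg_neg])
    (by rw [hv₂, hvb])
  refine ⟨U, V, hSol, hU1 hb.1.le, hV1 hb.1.le, b, hb.1, fun r hr => ?_, ?_, fun r hr => ?_, ?_⟩
  · rw [hV1 hr.2.le]; exact hneg r hr
  · rwa [hU1 (mem_Iic.2 le_rfl)]
  · rw [hV2 hr.le]; exact hv₂pos r hr
  · refine hlim.congr' ?_
    filter_upwards [eventually_ge_atTop b] with r hr
    exact (hU2 hr).symm

/-- If `v` vanished, the energy would force `u = -α`, an equilibrium, which is not reached in finite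
time. So `u` decreases forever, and it stays above `-α`, where the energy would give `v = 0`. If it
stayed above some `e > -α`, its speed would be bounded below, which is absurd. -/
theorem exists_sol_critical (hg : IsBistable g α β) {y₀ v₀ : ℝ} (ha : 0 ≤ a)
    (hy : y₀ ∈ Ioc 0 β) (hv : v₀ ≤ 0) (hq : v₀ + a * g y₀ ≤ 0)
    (hE : v₀ ^ 2 / 2 + potential g y₀ = potential g α) :
    ∃ u v : ℝ → ℝ, Sol g a ⊤ u v ∧ u a = y₀ ∧ v a = v₀ ∧
      (∀ r, a < r → v r < 0) ∧ Tendsto u atTop (𝓝 (-α)) := by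
  obtain ⟨R, u, v, h, rfl, rfl⟩ := exists_free hg.contDiff a y₀ v₀
  have hβα := hg.beta_lt_alpha
  have hα := hg.alpha_pos
  have hga : 0 < g (u a) := hg.pos _ ⟨hy.1, hy.2.trans_lt hβα⟩
  have henergy : ∀ t : ℝ, a ≤ t → (t : EReal) < R →
      v t ^ 2 / 2 + potential g (u t) = potential g α := fun t ht htR =>
    (h.energy hg ht htR).trans hE
  have hneg : ∀ t : ℝ, a < t → (t : EReal) < R → v t < 0 := by
    intro t ht htR
    by_contra! hcon
    obtain ⟨b, hb, hvb, hn⟩ := exists_first_zero_of_deriv_neg (h.continuousOn_v le_rfl htR) ht hv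
      (h.der_v a le_rfl h.lt) (neg_neg_of_pos hga) hcon
    have hbR := coe_lt_of_le hb.2 htR
    have h1 := henergy b hb.1.le hbR
    rw [hvb] at h1
    have h2 : |u b| = α := hg.abs_eq_of_potential_eq (by linarith)
    have h3 := (h.strictAntiOn_u hbR hn).antitoneOn (left_mem_Icc.2 hb.1.le)
      (right_mem_Icc.2 hb.1.le) hb.1.le
    have h4 : u b = -α := by
      rcases abs_choice (u b) with h5 | h5
      · linarith [hy.2]
      · linarith
    have h6 := h.eq_of_equilibrium hg.contDiff hb.1.le hbR
      (by rw [hg.odd, hg.alpha_zero, neg_zero]) h4 hvb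
    linarith [hy.1]
  have hanti : ∀ T : ℝ, (T : EReal) < R → StrictAntiOn u (Icc a T) := fun T hTR =>
    h.strictAntiOn_u hTR fun t ht => hneg t ht.1 (coe_lt_of_le ht.2.le hTR)
  have hle : ∀ t : ℝ, a ≤ t → (t : EReal) < R → u t ≤ u a := fun t ht htR =>
    (hanti t htR).antitoneOn (left_mem_Icc.2 ht) (right_mem_Icc.2 ht) ht
  have hgt : ∀ t : ℝ, a ≤ t → (t : EReal) < R → -α < u t := by
    intro t ht htR
    by_contra! hcon
    obtain ⟨s, hs, hus⟩ := intermediate_value_Icc' ht (h.continuousOn_u le_rfl htR)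
      (show -α ∈ Icc (u t) (u a) from ⟨hcon, by linarith [hy.1]⟩)
    have hsR := coe_lt_of_le hs.2 htR
    have has : a < s := lt_of_le_of_ne hs.1 (by rintro rfl; linarith [hy.1])
    have h1 := henergy s hs.1 hsR
    rw [hus, hg.potential_neg] at h1
    have h2 := hneg s has hsR
    nlinarith [mul_pos_of_neg_of_neg h2 h2]
  obtain rfl : R = ⊤ := h.eq_top_of_bounded hg.continuous (C := α) fun t ht htR =>
    abs_le.2 ⟨(hgt t ht htR).le, by linarith [hle t ht htR, hy.2]⟩
  obtain ⟨s, has, -, hus, -, hqs⟩ := h.exists_zero hg ha hy hv hq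
  have hsol := h.sol hg.continuous fun r hr hrR => by
    rcases le_or_gt r s with hrs | hrs
    · exact hqs r ⟨hr, hrs⟩
    · have h1 : u r ≤ 0 := by
        rw [← hus]
        exact (hanti r hrR).antitoneOn ⟨has.le, hrs.le⟩ ⟨hr, le_rfl⟩ hrs.le
      have h3 := mul_nonpos_of_nonneg_of_nonpos (ha.trans hr) (hg.nonpos_of_mem (hgt r hr hrR).le h1)
      linarith [hneg r (has.trans hrs) hrR]
  refine ⟨u, v, hsol, rfl, rfl, fun r hr => hneg r hr (EReal.coe_lt_top r), ?_⟩
  rw [tendsto_order]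
  refine ⟨fun e he => ?_, fun e he => ?_⟩
  · filter_upwards [eventually_ge_atTop a] with t ht
    exact he.trans (hgt t ht (EReal.coe_lt_top t))
  · suffices hex : ∃ t, a ≤ t ∧ u t < e by
      obtain ⟨t, hat, ht⟩ := hex
      filter_upwards [eventually_ge_atTop t] with r hr
      exact ((hanti r (EReal.coe_lt_top r)).antitoneOn ⟨hat, hr⟩ ⟨hat.trans hr, le_rfl⟩ hr).trans_lt ht
    by_contra! hcon
    -- This bounds `|u|` strictly below `α`, so the kinetic energy is at least `m > 0`.
    set c := max |e| (u a) with hc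
    have hea : e ≤ u a := hcon a le_rfl
    have hcα : c < α := max_lt (abs_lt.2 ⟨he, by linarith [hy.2]⟩) (hy.2.trans_lt hβα)
    have hc0 : 0 ≤ c := (abs_nonneg e).trans (le_max_left _ _)
    set m := potential g α - potential g c with hm
    have hm0 : 0 < m := sub_pos.2 (hg.potential_lt (by rwa [abs_of_nonneg hc0]))
    have hvm : ∀ t : ℝ, a < t → v t ≤ -Real.sqrt m := by
      intro t ht
      have h1 : |u t| ≤ c := abs_le.2
        ⟨by linarith [neg_abs_le e, le_max_left |e| (u a), hcon t ht.le],
          (hle t ht.le (EReal.coe_lt_top t)).trans (le_max_right _ _)⟩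
      have h2 : potential g (u t) ≤ potential g c := by
        rw [← hg.potential_abs]
        exact hg.strictMonoOn_potential.monotoneOn ⟨abs_nonneg _, by linarith⟩ ⟨hc0, hcα.le⟩ h1
      have h3 := henergy t ht.le (EReal.coe_lt_top t)
      have h4 : Real.sqrt m ≤ -v t := by
        refine Real.sqrt_le_iff.2 ⟨by linarith [hneg t ht (EReal.coe_lt_top t)], ?_⟩
        nlinarith
      linarith
    obtain ⟨t, ht1, ht2⟩ := exists_le_of_deriv_le (s := a) (Real.sqrt_pos.2 hm0)
      (fun t => h.continuousOn_u le_rfl (EReal.coe_lt_top t))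
      (fun t ht => h.hasDerivAt_u ht (EReal.coe_lt_top t)) hvm (-α)
    exact absurd (hgt t ht1.le (EReal.coe_lt_top t)) (not_lt.2 ht2)

/-- The energy exceeds the maximum of the potential, so the speed is bounded below and the free
solution falls to `-∞`. Past the zero of `u` its excess can become positive only below `-α`, since
`v < 0` and `g u ≤ 0` on `[-α, 0]`; there the drift is admissible. -/
theorem exists_sol_supercritical (hg : IsBistable g α β) {y₀ v₀ : ℝ} (ha : 0 ≤ a)
    (hy : y₀ ∈ Ioc 0 β) (hv : v₀ ≤ 0) (hq : v₀ + a * g y₀ ≤ 0)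
    (hE : potential g α < v₀ ^ 2 / 2 + potential g y₀) :
    ∃ (R : EReal) (u v : ℝ → ℝ), a < R ∧ Sol g a R u v ∧ u a = y₀ ∧ v a = v₀ ∧
      (∀ r : ℝ, a < r → (r : EReal) < R → v r < 0) ∧ Tendsto u (toLeft R) atBot := by
  obtain ⟨R, u, v, h, rfl, rfl⟩ := exists_free hg.contDiff a y₀ v₀
  have hβα := hg.beta_lt_alpha
  have hα := hg.alpha_pos
  set m := v a ^ 2 / 2 + potential g (u a) - potential g α with hm
  have hm0 : 0 < m := sub_pos.2 hE
  have hva : v a < 0 := lt_of_le_of_ne hv fun h0 => by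
    have := hg.potential_le (u a)
    rw [h0] at hE
    linarith
  have hvsq : ∀ t : ℝ, a ≤ t → (t : EReal) < R → m ≤ v t ^ 2 := fun t ht htR => by
    have h1 := h.energy hg ht htR
    have h2 := hg.potential_le (u t)
    linarith [sq_nonneg (v t)]
  have hneg : ∀ t : ℝ, a ≤ t → (t : EReal) < R → v t < 0 := by
    intro t ht htR
    by_contra! hcon
    obtain ⟨c, hc, hvc, -⟩ := exists_first_zero (h.continuousOn_v le_rfl htR) ht hva hcon
    have := hvsq c hc.1.le (coe_lt_of_le hc.2 htR)
    rw [hvc] at this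
    linarith
  have hvm : ∀ t : ℝ, a ≤ t → (t : EReal) < R → v t ≤ -Real.sqrt m := by
    intro t ht htR
    have h4 : Real.sqrt m ≤ -v t := Real.sqrt_le_iff.2
      ⟨by linarith [hneg t ht htR], by rw [neg_sq]; exact hvsq t ht htR⟩
    linarith
  have hanti : ∀ T : ℝ, (T : EReal) < R → StrictAntiOn u (Icc a T) := fun T hTR =>
    h.strictAntiOn_u hTR fun t ht => hneg t ht.1.le (coe_lt_of_le ht.2.le hTR)
  have hle : ∀ t : ℝ, a ≤ t → (t : EReal) < R → u t ≤ u a := fun t ht htR =>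
    (hanti t htR).antitoneOn (left_mem_Icc.2 ht) (right_mem_Icc.2 ht) ht
  have hunb : ∀ C : ℝ, ∃ t : ℝ, a ≤ t ∧ (t : EReal) < R ∧ u t ≤ C := by
    intro C
    by_contra! hcon
    obtain rfl : R = ⊤ := h.eq_top_of_bounded hg.continuous (C := |C| + |u a|) fun t ht htR =>
      abs_le.2 ⟨by linarith [hcon t ht htR, neg_abs_le C, abs_nonneg (u a)],
        by linarith [hle t ht htR, le_abs_self (u a), abs_nonneg C]⟩
    obtain ⟨t, ht1, ht2⟩ := exists_le_of_deriv_le (s := a) (Real.sqrt_pos.2 hm0)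
      (fun t => h.continuousOn_u le_rfl (EReal.coe_lt_top t))
      (fun t ht => h.hasDerivAt_u ht (EReal.coe_lt_top t))
      (fun t ht => hvm t ht.le (EReal.coe_lt_top t)) C
    exact absurd (hcon t ht1.le (EReal.coe_lt_top t)) (not_lt.2 ht2)
  by_cases hcase : ∀ t : ℝ, a ≤ t → (t : EReal) < R → v t + t * g (u t) ≤ 0
  · exact ⟨R, u, v, h.lt, h.sol hg.continuous hcase, rfl, rfl, fun r hr hrR => hneg r hr.le hrR,
      tendsto_atBot_toLeft (fun s t hs hst htR =>
        (hanti t htR).antitoneOn ⟨hs, hst⟩ ⟨hs.trans hst, le_rfl⟩ hst) hunb⟩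
  -- otherwise the first order regime takes over below `-α`
  push Not at hcase
  obtain ⟨t, hat, htR, hqt⟩ := hcase
  obtain ⟨s, has, hsR, hus, -, hqs⟩ := h.exists_zero hg ha hy hv hq
  have hnonpos : ∀ r : ℝ, s < r → (r : EReal) < R → -α ≤ u r → v r + r * g (u r) < 0 := by
    intro r hsr hrR hur
    have h1 : u r ≤ 0 := by
      rw [← hus]
      exact (hanti r hrR).antitoneOn ⟨has.le, hsr.le⟩ ⟨has.le.trans hsr.le, le_rfl⟩ hsr.le
    have h3 := mul_nonpos_of_nonneg_of_nonpos (ha.trans (has.le.trans hsr.le))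
      (hg.nonpos_of_mem hur h1)
    linarith [hneg r (has.le.trans hsr.le) hrR]
  have hst : s < t := by
    by_contra! hts
    exact absurd (hqs t ⟨hat, hts⟩) (not_le.2 hqt)
  have hqs0 : v s + s * g (u s) < 0 := by
    rw [hus, hg.zero, mul_zero, add_zero]
    exact hneg s has.le hsR
  obtain ⟨c, hc, hqc, hcneg⟩ := exists_first_zero
    (h.continuousOn_excess hg.continuous has.le htR) hst.le hqs0 hqt.le
  have hcR := coe_lt_of_le hc.2 htR
  have hac : a < c := has.trans hc.1
  have huc : u c < -α := by
    by_contra! hcon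
    exact absurd hqc (hnonpos c hc.1 hcR hcon).ne
  have hreach : Reach g u v a c := h.reach hg.continuous hac.le hcR fun r hr => by
    rcases le_or_gt r s with hrs | hrs
    · exact hqs r ⟨hr.1, hrs⟩
    · rcases hr.2.eq_or_lt with rfl | hrc
      · exact hqc.le
      · exact (hcneg r ⟨hrs.le, hrc⟩).le
  obtain ⟨R₂, u₂, v₂, hR₂, hsol₂, hu₂, hv₂, hv₂neg, hlim⟩ :=
    exists_sol_below hg (ha.trans hac.le) huc
  obtain ⟨U, V, hSol, hU1, hV1, hU2, hV2⟩ := hreach.glue hsol₂ hu₂.symm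
    (by rw [hv₂]; linarith [show v c + c * g (u c) = 0 from hqc])
  refine ⟨R₂, U, V, (EReal.coe_lt_coe_iff.2 hac).trans hR₂, hSol, hU1 hac.le, hV1 hac.le,
    fun r hr hrR => ?_, ?_⟩
  · rcases le_or_gt r c with hrc | hrc
    · rw [hV1 hrc]; exact hneg r hr.le (coe_lt_of_le hrc hcR)
    · rw [hV2 hrc.le]; exact hv₂neg r hrc hrR
  · refine hlim.congr' ?_
    filter_upwards [eventually_toLeft_of_lt hR₂] with r hr
    exact (hU2 hr.1.le).symm

end Descent

/-! ### Travel time of the drift and the critical value -/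

section TravelTime

theorem IsBistable.hasDerivAt_integral_inv (hg : IsBistable g α β) {y : ℝ} (hy : y ∈ Ico β α) :
    HasDerivAt (fun y => ∫ s in β..y, 1 / g s) (1 / g y) y := by
  have hpos : ∀ s ∈ Icc β y, g s ≠ 0 := fun s hs =>
    (hg.pos s ⟨hg.beta_pos.trans_le hs.1, hs.2.trans_lt hy.2⟩).ne'
  refine intervalIntegral.integral_hasDerivAt_right ?_ ?_ ?_
  · refine ContinuousOn.intervalIntegrable ?_
    rw [uIcc_of_le hy.1]
    exact continuousOn_const.div hg.continuous.continuousOn hpos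
  · exact (measurable_const.div hg.continuous.measurable).stronglyMeasurable.stronglyMeasurableAtFilter
  · exact continuousAt_const.div hg.continuous.continuousAt (hpos y ⟨hy.1, le_rfl⟩)

theorem IsBistable.strictMonoOn_integral_inv (hg : IsBistable g α β) :
    StrictMonoOn (fun y => ∫ s in β..y, 1 / g s) (Ico β α) := by
  refine strictMonoOn_of_deriv_pos (convex_Ico β α)
    (fun y hy => (hg.hasDerivAt_integral_inv hy).continuousAt.continuousWithinAt) fun y hy => ?_
  rw [interior_Ico] at hy
  rw [(hg.hasDerivAt_integral_inv (Ioo_subset_Ico_self hy)).deriv]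
  exact one_div_pos.2 (hg.pos y ⟨hg.beta_pos.trans hy.1, hy.2⟩)

/-- Being Lipschitz with `g α = 0`, `g` satisfies `g s ≤ k (α - s)`, so the integral diverges at
least logarithmically at `α`. -/
theorem IsBistable.exists_le_integral_inv (hg : IsBistable g α β) {C : ℝ} (hC : 0 < C) :
    ∃ y ∈ Ioo β α, C ≤ ∫ s in β..y, 1 / g s := by
  have hβα := hg.beta_lt_alpha
  have hβ := hg.beta_pos
  obtain ⟨K, hK⟩ := hg.contDiff.locallyLipschitz.locallyLipschitzOn.exists_lipschitzOnWith_of_compact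
    (isCompact_Icc (a := β) (b := α))
  set k : ℝ := K + 1 with hk
  have hk0 : 0 < k := by positivity
  have hgk : ∀ s ∈ Ico β α, g s ≤ k * (α - s) := by
    intro s hs
    have h1 := hK.dist_le_mul s ⟨hs.1, hs.2.le⟩ α (right_mem_Icc.2 hβα.le)
    rw [Real.dist_eq, Real.dist_eq, hg.alpha_zero, sub_zero, abs_sub_comm,
      abs_of_pos (sub_pos.2 hs.2)] at h1
    have h2 := le_abs_self (g s)
    have h3 : 0 < α - s := sub_pos.2 hs.2
    rw [hk]; linarith
  have hexp0 := Real.exp_pos (-(k * C))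
  have hexp1 : Real.exp (-(k * C)) < 1 := Real.exp_lt_one_iff.2 (neg_neg_of_pos (mul_pos hk0 hC))
  have hd : 0 < α - β := sub_pos.2 hβα
  -- For this `y` the lower bound `(1 / k) log ((α - β) / (α - y))` equals `C`.
  set y := α - (α - β) * Real.exp (-(k * C)) with hy
  have hyα : y < α := by
    have := mul_pos hd hexp0
    rw [hy]; linarith
  have hβy : β < y := by
    rw [hy]; nlinarith
  refine ⟨y, ⟨hβy, hyα⟩, ?_⟩
  have hderiv : ∀ t ∈ Icc β y, HasDerivAt
      (fun t => (∫ s in β..t, 1 / g s) + Real.log (α - t) / k)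
      (1 / g t + (-1) / (α - t) / k) t := by
    intro t ht
    have htα : t < α := ht.2.trans_lt hyα
    have h2 : HasDerivAt (fun t => Real.log (α - t)) ((-1) / (α - t)) t :=
      ((hasDerivAt_id t).const_sub α).log (sub_pos.2 htα).ne'
    exact (hg.hasDerivAt_integral_inv ⟨ht.1, htα⟩).add (h2.div_const k)
  have hmono := add_mul_le_of_le_hasDerivAt (C := 0) hβy.le
    (fun t ht => (hderiv t ht).continuousAt.continuousWithinAt)
    (fun t ht => hderiv t (Ioo_subset_Icc_self ht)) fun t ht => by
      have htα : t < α := ht.2.trans hyα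
      have hgt : 0 < g t := hg.pos t ⟨hβ.trans ht.1, htα⟩
      have h1 : 1 / (k * (α - t)) ≤ 1 / g t := one_div_le_one_div_of_le hgt (hgk t ⟨ht.1.le, htα⟩)
      have h2 : (-1) / (α - t) / k = -(1 / (k * (α - t))) := by
        have : 0 < α - t := sub_pos.2 htα
        field_simp
      rw [h2]; linarith
  have hlog : Real.log (α - y) = Real.log (α - β) + -(k * C) := by
    rw [hy, sub_sub_cancel, Real.log_mul hd.ne' hexp0.ne', Real.log_exp]
  rw [hlog, intervalIntegral.integral_same] at hmono
  have h3 : (Real.log (α - β) + -(k * C)) / k = Real.log (α - β) / k - C := by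
    field_simp
    ring
  rw [h3] at hmono
  linarith

theorem IsBistable.integral_eq_potential_sub (hg : IsBistable g α β) :
    ∫ s in β..α, g s = potential g α - potential g β :=
  (intervalIntegral.integral_interval_sub_left (hg.continuous.intervalIntegrable _ _)
    (hg.continuous.intervalIntegrable _ _)).symm

theorem IsBistable.g_beta_pos (hg : IsBistable g α β) : 0 < g β :=
  hg.pos β ⟨hg.beta_pos, hg.beta_lt_alpha⟩

theorem isCriticalValue_one_iff (hg : IsBistable g α β) {ξ : ℝ} : IsCriticalValue 1 g α β ξ ↔
    ξ ∈ Ioo β α ∧ g β ^ 2 * (∫ s in β..ξ, 1 / g s) = potential g α - potential g β := by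
  rw [IsCriticalValue, hg.integral_eq_potential_sub, Nat.cast_one, one_mul]

theorem exists_isCriticalValue (hg : IsBistable g α β) : ∃ ξ, IsCriticalValue 1 g α β ξ := by
  have hβ := hg.beta_pos
  have hgβ : 0 < g β ^ 2 := pow_pos hg.g_beta_pos 2
  have hD : 0 < potential g α - potential g β :=
    sub_pos.2 (hg.potential_lt (by rw [abs_of_pos hβ]; exact hg.beta_lt_alpha))
  obtain ⟨y, hy, hCy⟩ := hg.exists_le_integral_inv (div_pos hD hgβ)
  have hcont : ContinuousOn (fun y => ∫ s in β..y, 1 / g s) (Icc β y) := fun t ht =>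
    (hg.hasDerivAt_integral_inv ⟨ht.1, ht.2.trans_lt hy.2⟩).continuousAt.continuousWithinAt
  obtain ⟨ξ, hξ, hFξ⟩ := intermediate_value_Icc hy.1.le hcont
    (show (potential g α - potential g β) / g β ^ 2 ∈ Icc _ _ from
      ⟨by simpa using (div_pos hD hgβ).le, hCy⟩)
  have hFξ : ∫ s in β..ξ, 1 / g s = (potential g α - potential g β) / g β ^ 2 := hFξ
  refine ⟨ξ, (isCriticalValue_one_iff hg).2 ⟨⟨lt_of_le_of_ne hξ.1 ?_, hξ.2.trans_lt hy.2⟩, ?_⟩⟩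
  · rintro rfl
    rw [intervalIntegral.integral_same] at hFξ
    exact (div_pos hD hgβ).ne hFξ
  · rw [hFξ, mul_div_cancel₀ _ hgβ.ne']

theorem IsCriticalValue.unique (hg : IsBistable g α β) {ξ η : ℝ} (hξ : IsCriticalValue 1 g α β ξ)
    (hη : IsCriticalValue 1 g α β η) : η = ξ := by
  obtain ⟨h1, h2⟩ := (isCriticalValue_one_iff hg).1 hξ
  obtain ⟨h3, h4⟩ := (isCriticalValue_one_iff hg).1 hη
  have hgβ : g β ^ 2 ≠ 0 := (pow_pos hg.g_beta_pos 2).ne'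
  exact hg.strictMonoOn_integral_inv.injOn (Ioo_subset_Ico_self h3) (Ioo_subset_Ico_self h1)
    (mul_left_cancel₀ hgβ (h4.trans h2.symm))

/-- The first order regime from `ξ ∈ (β, α)` down to `β`. -/
theorem exists_reach_beta (hg : IsBistable g α β) {ξ : ℝ} (hβξ : β < ξ) (hξα : ξ < α) :
    ∃ (r₀ : ℝ) (u v : ℝ → ℝ), 0 < r₀ ∧ Reach g u v 0 r₀ ∧ u 0 = ξ ∧ v 0 = 0 ∧ u r₀ = β ∧
      v r₀ = -(r₀ * g β) ∧ (∀ r ∈ Ioc 0 r₀, v r < 0) ∧ r₀ ^ 2 / 2 = ∫ s in β..ξ, 1 / g s := by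
  obtain ⟨R, u, h, hu0⟩ := exists_drift hg.contDiff 0 ξ
  have hβ := hg.beta_pos
  have hle : ∀ t : ℝ, 0 ≤ t → (t : EReal) < R → u t ≤ ξ := by
    intro t ht htR
    refine le_of_forall_gt_imp_ge_of_dense fun c hc => ?_
    have hc' : ξ < min c ((ξ + α) / 2) := lt_min hc (by linarith)
    refine (le_of_deriv_neg_at_level (h.continuousOn le_rfl htR)
        (fun s hs => (h.der s hs.1 (coe_lt_of_le hs.2.le htR)).mono (Ici_subset_Ici.2 hs.1))
        (by rw [hu0]; exact hc'.le) (fun s hs hsc => ?_) t ⟨ht, le_rfl⟩).trans (min_le_left _ _)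
    have has : 0 < s := lt_of_le_of_ne hs.1 (by rintro rfl; rw [hu0] at hsc; linarith)
    refine neg_neg_of_pos (mul_pos has (hg.pos _ ?_))
    rw [hsc]
    exact ⟨by linarith, (min_le_right _ _).trans_lt (by linarith)⟩
  have hex : ∃ t : ℝ, 0 ≤ t ∧ (t : EReal) < R ∧ u t ≤ β := by
    by_contra! hcon
    obtain rfl : R = ⊤ := h.eq_top_of_bounded (C := ξ) fun t ht htR =>
      abs_le.2 ⟨by linarith [hcon t ht htR], hle t ht htR⟩
    have hgξ : 0 < g ξ := hg.pos ξ ⟨hβ.trans hβξ, hξα⟩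
    obtain ⟨t, ht1, ht2⟩ := exists_le_of_deriv_le (s := 1) hgξ
      (fun t => h.continuousOn zero_le_one (EReal.coe_lt_top t))
      (fun t ht => h.hasDerivAt (by linarith) (EReal.coe_lt_top t))
      (fun t ht => by
        have h1 : g ξ ≤ g (u t) := hg.antitoneOn_Ici
          (hcon t (by linarith) (EReal.coe_lt_top t)).le hβξ.le
          (hle t (by linarith) (EReal.coe_lt_top t))
        nlinarith) β
    exact absurd (hcon t (by linarith) (EReal.coe_lt_top t)) (not_lt.2 ht2)
  obtain ⟨t, ht, htR, hut⟩ := hex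
  obtain ⟨r₀, hr₀, hur₀, hpos⟩ := exists_first_zero (f := fun t => β - u t)
    (continuousOn_const.sub (h.continuousOn le_rfl htR)) ht (by rw [hu0]; linarith) (by linarith)
  have hur₀ : u r₀ = β := by linarith [show β - u r₀ = 0 from hur₀]
  have hr₀R := coe_lt_of_le hr₀.2 htR
  have hmem : ∀ r ∈ Icc 0 r₀, u r ∈ Icc β ξ := by
    intro r hr
    refine ⟨?_, hle r hr.1 (coe_lt_of_le hr.2 hr₀R)⟩
    rcases hr.2.eq_or_lt with rfl | h1
    · exact hur₀.ge
    · linarith [show β - u r < 0 from hpos r ⟨hr.1, h1⟩]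
  have hgpos : ∀ r ∈ Icc 0 r₀, 0 < g (u r) := fun r hr =>
    hg.pos _ ⟨hβ.trans_le (hmem r hr).1, (hmem r hr).2.trans_lt hξα⟩
  refine ⟨r₀, u, _, hr₀.1, h.reach hg hr₀.1.le hr₀R fun r hr => ?_, hu0, by simp, hur₀,
    by simp only [hur₀], fun r hr => ?_, ?_⟩
  · refine mul_nonpos_of_nonneg_of_nonpos (hgpos r hr).le (hg.deriv_nonpos_of_le_abs ?_)
    exact (hmem r hr).1.trans (le_abs_self _)
  · exact neg_neg_of_pos (mul_pos hr.1 (hgpos r (Ioc_subset_Icc_self hr)))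
  -- Separation of variables: `u' / g u = -r`.
  · have hconst := constant_of_has_deriv_right_zero
      (f := fun r => r ^ 2 / 2 + ∫ s in β..u r, 1 / g s) (a := 0) (b := r₀) ?_ ?_ r₀
      (right_mem_Icc.2 hr₀.1.le)
    · simpa [hur₀, hu0] using hconst
    · refine ((continuousOn_id.pow 2).div_const 2).add ?_
      exact fun r hr => ContinuousAt.comp_continuousWithinAt (f := u)
        (hg.hasDerivAt_integral_inv ⟨(hmem r hr).1, (hmem r hr).2.trans_lt hξα⟩).continuousAt
        (h.continuousOn le_rfl hr₀R r hr)
    · intro r hr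
      have hr' := Ico_subset_Icc_self hr
      have h1 := (hg.hasDerivAt_integral_inv
        ⟨(hmem r hr').1, (hmem r hr').2.trans_lt hξα⟩).comp_hasDerivWithinAt r
        ((h.der r hr.1 (coe_lt_of_le hr.2.le hr₀R)).mono (Ici_subset_Ici.2 hr.1))
      have h2 := ((hasDerivAt_id r).pow 2).div_const 2 |>.hasDerivWithinAt (s := Ici r)
      refine (h2.add h1).congr_deriv ?_
      have := (hgpos r hr').ne'
      simp only [id]
      field_simp
      norm_num

/-- The energy on entering the second order regime at `β`, compared with the critical one. -/
theorem energy_sub_eq (hg : IsBistable g α β) {ξ ξs r₀ : ℝ} (hs : IsCriticalValue 1 g α β ξs)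
    (hr₀ : r₀ ^ 2 / 2 = ∫ s in β..ξ, 1 / g s) :
    (-(r₀ * g β)) ^ 2 / 2 + potential g β - potential g α =
      g β ^ 2 * ((∫ s in β..ξ, 1 / g s) - ∫ s in β..ξs, 1 / g s) := by
  have := ((isCriticalValue_one_iff hg).1 hs).2
  rw [mul_sub, this, ← hr₀]
  ring

end TravelTime

/-! ### Complete profiles, including those starting in `(0, α)` -/

section GlobalProfiles

theorem sol_const {z : ℝ} (hz : g z = 0) : Sol g 0 ⊤ (fun _ => z) (fun _ => 0) := by
  intro T hT _
  rcases hT.eq_or_lt with rfl | hT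
  · exact Relation.ReflTransGen.refl
  · refine Relation.ReflTransGen.single ⟨hT, fun _ => 0, continuousOn_const, fun r _ =>
      ⟨hasDerivWithinAt_const _ _ _, hasDerivWithinAt_const _ _ _, ?_⟩⟩
    simp [Balance, hz]

/-- Above `β` the drift leads to `β` first; since the travel time increases with `ξ`, the energy on
arrival is below the critical one. -/
theorem exists_sol_between_zero_critical (hg : IsBistable g α β) {ξ ξs : ℝ}
    (hs : IsCriticalValue 1 g α β ξs) (hξ0 : 0 < ξ) (hξ : ξ < ξs) :
    ∃ u v : ℝ → ℝ, Sol g 0 ⊤ u v ∧ u 0 = ξ ∧ v 0 = 0 ∧ ∃ b, 0 < b ∧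
      (∀ r ∈ Ioo 0 b, v r < 0) ∧ u b < 0 ∧ (∀ r, b < r → 0 < v r) ∧ Tendsto u atTop (𝓝 0) := by
  have hβα := hg.beta_lt_alpha
  rcases le_or_gt ξ β with hξβ | hξβ
  · refine exists_sol_subcritical hg le_rfl ⟨hξ0, hξβ⟩ le_rfl (by simp) ?_
    simpa using hg.potential_lt (by rw [abs_of_pos hξ0]; linarith)
  obtain ⟨r₀, u₁, v₁, hr₀, hreach, hu0, hv0, hur₀, hvr₀, hneg, hF⟩ :=
    exists_reach_beta hg hξβ (hξ.trans hs.1.2)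
  have hgr : 0 ≤ r₀ * g β := (mul_pos hr₀ hg.g_beta_pos).le
  have hE := energy_sub_eq hg hs hF
  have hlt := hg.strictMonoOn_integral_inv ⟨hξβ.le, hξ.trans hs.1.2⟩ (Ioo_subset_Ico_self hs.1) hξ
  have hneg2 := mul_neg_of_pos_of_neg (pow_pos hg.g_beta_pos 2) (sub_neg.2 hlt)
  obtain ⟨u₂, v₂, hsol₂, hu₂, hv₂, b, hb, hv₂neg, hub, hv₂pos, hlim⟩ :=
    exists_sol_subcritical hg hr₀.le ⟨hg.beta_pos, le_rfl⟩ (neg_nonpos.2 hgr) (by simp)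
      (by simp only at hneg2; linarith)
  obtain ⟨U, V, hSol, hU1, hV1, hU2, hV2⟩ := hreach.glue hsol₂ (hur₀.trans hu₂.symm)
    (hvr₀.trans hv₂.symm)
  refine ⟨U, V, hSol, (hU1 hr₀.le).trans hu0, (hV1 hr₀.le).trans hv0, b, hr₀.trans hb,
    fun r hr => ?_, ?_, fun r hr => ?_, ?_⟩
  · rcases le_or_gt r r₀ with h | h
    · rw [hV1 h]; exact hneg r ⟨hr.1, h⟩
    · rw [hV2 h.le]; exact hv₂neg r ⟨h, hr.2⟩
  · rwa [hU2 hb.le]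
  · rw [hV2 (hb.trans hr).le]; exact hv₂pos r hr
  · refine hlim.congr' ?_
    filter_upwards [eventually_ge_atTop r₀] with r hr
    exact (hU2 hr).symm

theorem exists_sol_at_critical (hg : IsBistable g α β) {ξs : ℝ} (hs : IsCriticalValue 1 g α β ξs) :
    ∃ u v : ℝ → ℝ, Sol g 0 ⊤ u v ∧ u 0 = ξs ∧ v 0 = 0 ∧
      (∀ r, 0 < r → v r < 0) ∧ Tendsto u atTop (𝓝 (-α)) := by
  obtain ⟨r₀, u₁, v₁, hr₀, hreach, hu0, hv0, hur₀, hvr₀, hneg, hF⟩ :=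
    exists_reach_beta hg hs.1.1 hs.1.2
  have hgr : 0 ≤ r₀ * g β := (mul_pos hr₀ hg.g_beta_pos).le
  have hE := energy_sub_eq hg hs hF
  rw [sub_self, mul_zero] at hE
  obtain ⟨u₂, v₂, hsol₂, hu₂, hv₂, hv₂neg, hlim⟩ :=
    exists_sol_critical hg hr₀.le ⟨hg.beta_pos, le_rfl⟩ (neg_nonpos.2 hgr) (by simp)
      (sub_eq_zero.1 hE)
  obtain ⟨U, V, hSol, hU1, hV1, hU2, hV2⟩ := hreach.glue hsol₂ (hur₀.trans hu₂.symm)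
    (hvr₀.trans hv₂.symm)
  refine ⟨U, V, hSol, (hU1 hr₀.le).trans hu0, (hV1 hr₀.le).trans hv0, fun r hr => ?_, ?_⟩
  · rcases le_or_gt r r₀ with h | h
    · rw [hV1 h]; exact hneg r ⟨hr, h⟩
    · rw [hV2 h.le]; exact hv₂neg r h
  · refine hlim.congr' ?_
    filter_upwards [eventually_ge_atTop r₀] with r hr
    exact (hU2 hr).symm

theorem exists_sol_between_critical_alpha (hg : IsBistable g α β) {ξ ξs : ℝ}
    (hs : IsCriticalValue 1 g α β ξs) (hξ : ξs < ξ) (hξα : ξ < α) :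
    ∃ (R : EReal) (u v : ℝ → ℝ), 0 < R ∧ Sol g 0 R u v ∧ u 0 = ξ ∧ v 0 = 0 ∧
      (∀ r : ℝ, 0 < r → (r : EReal) < R → v r < 0) ∧ Tendsto u (toLeft R) atBot := by
  have hβξ : β < ξ := hs.1.1.trans hξ
  obtain ⟨r₀, u₁, v₁, hr₀, hreach, hu0, hv0, hur₀, hvr₀, hneg, hF⟩ := exists_reach_beta hg hβξ hξα
  have hgr : 0 ≤ r₀ * g β := (mul_pos hr₀ hg.g_beta_pos).le
  have hE := energy_sub_eq hg hs hF
  have hlt := hg.strictMonoOn_integral_inv (Ioo_subset_Ico_self hs.1) ⟨hβξ.le, hξα⟩ hξ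
  have hpos := mul_pos (pow_pos hg.g_beta_pos 2) (sub_pos.2 hlt)
  obtain ⟨R, u₂, v₂, hR, hsol₂, hu₂, hv₂, hv₂neg, hlim⟩ :=
    exists_sol_supercritical hg hr₀.le ⟨hg.beta_pos, le_rfl⟩ (neg_nonpos.2 hgr) (by simp)
      (by simp only at hpos; linarith)
  obtain ⟨U, V, hSol, hU1, hV1, hU2, hV2⟩ := hreach.glue hsol₂ (hur₀.trans hu₂.symm)
    (hvr₀.trans hv₂.symm)
  refine ⟨R, U, V, (EReal.coe_lt_coe_iff.2 hr₀).trans hR, hSol, (hU1 hr₀.le).trans hu0,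
    (hV1 hr₀.le).trans hv0, fun r hr hrR => ?_, ?_⟩
  · rcases le_or_gt r r₀ with h | h
    · rw [hV1 h]; exact hneg r ⟨hr, h⟩
    · rw [hV2 h.le]; exact hv₂neg r h hrR
  · refine hlim.congr' ?_
    filter_upwards [eventually_toLeft_of_lt hR] with r hr
    exact (hU2 hr.1.le).symm

/-- Solutions starting below `-α` decrease to `-∞`. -/
theorem exists_sol_from_below (hg : IsBistable g α β) {ξ : ℝ} (hξ : ξ < -α) :
    ∃ (R : EReal) (u v : ℝ → ℝ), 0 < R ∧ Sol g 0 R u v ∧ u 0 = ξ ∧ v 0 = 0 ∧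
      (∀ r : ℝ, 0 < r → (r : EReal) < R → v r < 0) ∧ Tendsto u (toLeft R) atBot := by
  obtain ⟨R, u, v, h1, h2, h3, h4, h5⟩ := exists_sol_below hg le_rfl hξ
  exact ⟨R, u, v, h1, h2, h3, by simpa using h4, h5⟩

end GlobalProfiles

/-! ### Maximal solutions for all initial values, and transfer to radial solutions -/

section Maximality

variable {R : EReal} {u v : ℝ → ℝ}

theorem maximal_of_tendsto_atBot (h : Tendsto u (toLeft R) atBot) :
    R ≠ ⊤ → Tendsto (fun r => |u r| + |v r|) (toLeft R) atTop := fun _ =>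
  tendsto_atTop_mono (fun _ => le_add_of_nonneg_right (abs_nonneg _))
    (tendsto_abs_atBot_atTop.comp h)

theorem maximal_of_tendsto_atTop (h : Tendsto u (toLeft R) atTop) :
    R ≠ ⊤ → Tendsto (fun r => |u r| + |v r|) (toLeft R) atTop := fun _ =>
  tendsto_atTop_mono (fun _ => le_add_of_nonneg_right (abs_nonneg _))
    (tendsto_abs_atTop_atTop.comp h)

/-- Every initial value is attained by a maximal solution. -/
theorem exists_maximal_sol (hg : IsBistable g α β) (ξ : ℝ) :
    ∃ (R : EReal) (u v : ℝ → ℝ), 0 < R ∧ Sol g 0 R u v ∧ u 0 = ξ ∧ v 0 = 0 ∧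
      (R ≠ ⊤ → Tendsto (fun r => |u r| + |v r|) (toLeft R) atTop) := by
  have hα := hg.alpha_pos
  obtain ⟨ξs, hs⟩ := exists_isCriticalValue hg
  have hconst : ∀ z, g z = 0 → ∃ (R : EReal) (u v : ℝ → ℝ), 0 < R ∧ Sol g 0 R u v ∧ u 0 = z ∧
      v 0 = 0 ∧ (R ≠ ⊤ → Tendsto (fun r => |u r| + |v r|) (toLeft R) atTop) := fun z hz =>
    ⟨⊤, _, _, EReal.zero_lt_top, sol_const hz, rfl, rfl, fun h => absurd rfl h⟩
  rcases lt_trichotomy ξ (-α) with h | rfl | h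
  · obtain ⟨R, u, v, h1, h2, h3, h4, -, h5⟩ := exists_sol_from_below hg h
    exact ⟨R, u, v, h1, h2, h3, h4, maximal_of_tendsto_atBot h5⟩
  · exact hconst _ (by rw [hg.odd, hg.alpha_zero, neg_zero])
  rcases lt_trichotomy ξ 0 with h0 | rfl | h0
  · obtain ⟨u, v, h2, h3, h4, -⟩ := exists_sol_rest hg le_rfl (neg_pos.2 h0) (neg_lt.1 h)
    exact ⟨⊤, u, v, EReal.zero_lt_top, h2, by rw [h3, neg_neg], h4, fun h => absurd rfl h⟩
  · exact hconst _ hg.zero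
  rcases lt_trichotomy ξ α with h1 | rfl | h1
  · rcases lt_trichotomy ξ ξs with h2 | rfl | h2
    · obtain ⟨u, v, h2, h3, h4, -⟩ := exists_sol_between_zero_critical hg hs h0 h2
      exact ⟨⊤, u, v, EReal.zero_lt_top, h2, h3, h4, fun h => absurd rfl h⟩
    · obtain ⟨u, v, h2, h3, h4, -⟩ := exists_sol_at_critical hg hs
      exact ⟨⊤, u, v, EReal.zero_lt_top, h2, h3, h4, fun h => absurd rfl h⟩
    · obtain ⟨R, u, v, h1, h2, h3, h4, -, h5⟩ := exists_sol_between_critical_alpha hg hs h2 h1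
      exact ⟨R, u, v, h1, h2, h3, h4, maximal_of_tendsto_atBot h5⟩
  · exact hconst _ hg.alpha_zero
  · obtain ⟨R, u, v, h1, h2, h3, h4, -, h5⟩ := exists_sol_above hg h1
    exact ⟨R, u, v, h1, h2, h3, h4, maximal_of_tendsto_atTop h5⟩

/-- A radial solution is the maximal solution with the same initial value. -/
theorem IsRadialSolution.eq_sol {N : ℕ} (hN : 2 ≤ N) (hg : ContDiff ℝ 1 g)
    (hu : IsRadialSolution N 1 g R u) {R' : EReal} {u' v' : ℝ → ℝ} (hR' : 0 < R')
    (h : Sol g 0 R' u' v') (h0 : u' 0 = u 0) (hv' : v' 0 = 0)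
    (hmax : R' ≠ ⊤ → Tendsto (fun r => |u' r| + |v' r|) (toLeft R') atTop) :
    R' = R ∧ EqOn u u' (halfOpen R) ∧
      (∀ r : ℝ, 0 < r → (r : EReal) < R → deriv u r = v' r) ∧ u' =ᶠ[toLeft R] u := by
  obtain ⟨v, hs, hv0, hm⟩ := hu.exists_sol hN hg.continuous
  obtain ⟨rfl, h1, h2⟩ := hs.unique hg h hu.radius_pos hR' hv0 hv' h0.symm hm hmax
  refine ⟨rfl, h1, fun r hr hrR => ?_, ?_⟩
  · rw [(hs.hasDerivAt hr hrR).deriv]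
    exact h2 ⟨hr.le, hrR⟩
  · filter_upwards [eventually_toLeft_of_lt (a := 0) hu.radius_pos] with r hr
    exact (h1 ⟨hr.1.le, hr.2⟩).symm

end Maximality

/-! ### Absence of oscillation and periodicity -/

section NoOscillation

variable {R : EReal} {u : ℝ → ℝ}

theorem not_isOscillating_of_eventually (h : R = ⊤ → ∀ᶠ r in atTop, u r ≠ 0) :
    ¬ IsOscillating R u := by
  rintro ⟨hR, -, hz⟩
  obtain ⟨A, hA⟩ := eventually_atTop.1 (h hR)
  obtain ⟨r, hr, -, hur⟩ := hz A
  exact hA r hr.le hur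

/-- Along `r + n * T` the values are all `u r`, so each value inherits the behaviour of `u` at
infinity. -/
theorem tendsto_of_periodic {T : ℝ} (hT : 0 < T) (h : ∀ r, 0 ≤ r → u (r + T) = u r)
    {l : Filter ℝ} (hl : Tendsto u atTop l) {r : ℝ} (hr : 0 ≤ r) :
    Tendsto (fun _ : ℕ => u r) atTop l := by
  have h1 : ∀ n : ℕ, u (r + n * T) = u r := by
    intro n
    induction n with
    | zero => simp
    | succ n ih =>
      rw [← ih, ← h (r + n * T) (by positivity)]
      congr 1
      push_cast
      ring
  have h2 : Tendsto (fun n : ℕ => r + n * T) atTop atTop :=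
    tendsto_atTop_add_const_left _ _ (tendsto_natCast_atTop_atTop.atTop_mul_const hT)
  exact (hl.comp h2).congr h1

theorem not_isNonconstantPeriodic_of_tendsto_nhds {l : ℝ} (h : R = ⊤ → Tendsto u atTop (𝓝 l)) :
    ¬ IsNonconstantPeriodic R u := by
  rintro ⟨hR, ⟨r, hr, hne⟩, T, hT, hp⟩
  have h1 : ∀ s, 0 ≤ s → u s = l := fun s hs =>
    tendsto_nhds_unique tendsto_const_nhds (tendsto_of_periodic hT hp (h hR) hs)
  exact hne ((h1 r hr).trans (h1 0 le_rfl).symm)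

theorem not_isNonconstantPeriodic_of_tendsto_abs
    (h : R = ⊤ → Tendsto (fun r => |u r|) atTop atTop) : ¬ IsNonconstantPeriodic R u := by
  rintro ⟨hR, -, T, hT, hp⟩
  have := tendsto_of_periodic hT (u := fun r => |u r|) (fun r hr => by rw [hp r hr]) (h hR) le_rfl
  exact not_tendsto_const_atTop _ _ this

/-- A strictly increasing function with limit `0` is negative. -/
theorem eventually_ne_zero_of_increasing {b : ℝ} (hpos : ∀ r, b < r → 0 < deriv u r)
    (hlim : Tendsto u atTop (𝓝 0)) : ∀ᶠ r in atTop, u r ≠ 0 := by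
  have hmono : StrictMonoOn u (Ioi b) := by
    refine strictMonoOn_of_deriv_pos (convex_Ioi b) (fun r hr => ?_) fun r hr => ?_
    · exact (differentiableAt_of_deriv_ne_zero (hpos r hr).ne').continuousAt.continuousWithinAt
    · rw [interior_Ioi] at hr; exact hpos r hr
  filter_upwards [eventually_gt_atTop b] with r hr
  have h1 : u r < u (r + 1) := hmono hr (show b < r + 1 by linarith) (by linarith)
  have h2 : u (r + 1) ≤ 0 := by
    refine ge_of_tendsto hlim ?_
    filter_upwards [eventually_ge_atTop (r + 1)] with s hs
    exact hmono.monotoneOn (show b < r + 1 by linarith) (show b < s by linarith) hs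
  linarith

end NoOscillation

end TruncLaplace

/-! ### The main theorem -/

open TruncLaplace in
theorem mainTheorem1 (N : ℕ) (hN : 2 ≤ N) (g : ℝ → ℝ) (α β : ℝ) (hg : IsBistable g α β) :
    -- existence and uniqueness of the radial solution starting from any `ξ`
    (∀ ξ : ℝ, ∃ (R : EReal) (u : ℝ → ℝ), IsRadialSolution N 1 g R u ∧ u 0 = ξ ∧
      ∀ (R' : EReal) (v : ℝ → ℝ), IsRadialSolution N 1 g R' v → v 0 = ξ →
        R' = R ∧ EqOn v u (halfOpen R)) ∧
    -- the critical value and the classification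
    (∃ ξs : ℝ, IsCriticalValue 1 g α β ξs ∧
      (∀ η : ℝ, IsCriticalValue 1 g α β η → η = ξs) ∧
      ∀ (ξ : ℝ) (R : EReal) (u : ℝ → ℝ), IsRadialSolution N 1 g R u → u 0 = ξ →
        (ξ = -α ∨ ξ = 0 ∨ ξ = α → R = ⊤ ∧ ∀ r, 0 ≤ r → u r = ξ) ∧
        (ξ < -α → (∀ r : ℝ, 0 < r → (r : EReal) < R → deriv u r < 0) ∧
          Tendsto u (toLeft R) atBot) ∧
        (α < ξ → (∀ r : ℝ, 0 < r → (r : EReal) < R → 0 < deriv u r) ∧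
          Tendsto u (toLeft R) atTop) ∧
        (-α < ξ → ξ < 0 → R = ⊤ ∧ (∀ r : ℝ, 0 < r → 0 < deriv u r) ∧
          Tendsto u atTop (𝓝 0)) ∧
        (ξs < ξ → ξ < α → (∀ r : ℝ, 0 < r → (r : EReal) < R → deriv u r < 0) ∧
          Tendsto u (toLeft R) atBot) ∧
        (ξ = ξs → R = ⊤ ∧ (∀ r : ℝ, 0 < r → deriv u r < 0) ∧
          Tendsto u atTop (𝓝 (-α))) ∧
        (0 < ξ → ξ < ξs → R = ⊤ ∧ ∃ b : ℝ, 0 < b ∧ (∀ r ∈ Ioo 0 b, deriv u r < 0) ∧ u b < 0 ∧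
          (∀ r ∈ Ioi b, 0 < deriv u r) ∧ Tendsto u atTop (𝓝 0))) ∧
    -- no oscillating and no nonconstant periodic radial solution
    (∀ (R : EReal) (u : ℝ → ℝ), IsRadialSolution N 1 g R u →
      ¬ IsOscillating R u ∧ ¬ IsNonconstantPeriodic R u) := by
  obtain ⟨ξs, hs⟩ := exists_isCriticalValue hg
  have hα := hg.alpha_pos
  have hclass : ∀ (ξ : ℝ) (R : EReal) (u : ℝ → ℝ), IsRadialSolution N 1 g R u → u 0 = ξ →
        (ξ = -α ∨ ξ = 0 ∨ ξ = α → R = ⊤ ∧ ∀ r, 0 ≤ r → u r = ξ) ∧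
        (ξ < -α → (∀ r : ℝ, 0 < r → (r : EReal) < R → deriv u r < 0) ∧
          Tendsto u (toLeft R) atBot) ∧
        (α < ξ → (∀ r : ℝ, 0 < r → (r : EReal) < R → 0 < deriv u r) ∧
          Tendsto u (toLeft R) atTop) ∧
        (-α < ξ → ξ < 0 → R = ⊤ ∧ (∀ r : ℝ, 0 < r → 0 < deriv u r) ∧
          Tendsto u atTop (𝓝 0)) ∧
        (ξs < ξ → ξ < α → (∀ r : ℝ, 0 < r → (r : EReal) < R → deriv u r < 0) ∧
          Tendsto u (toLeft R) atBot) ∧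
        (ξ = ξs → R = ⊤ ∧ (∀ r : ℝ, 0 < r → deriv u r < 0) ∧
          Tendsto u atTop (𝓝 (-α))) ∧
        (0 < ξ → ξ < ξs → R = ⊤ ∧ ∃ b : ℝ, 0 < b ∧ (∀ r ∈ Ioo 0 b, deriv u r < 0) ∧ u b < 0 ∧
          (∀ r ∈ Ioi b, 0 < deriv u r) ∧ Tendsto u atTop (𝓝 0)) := by
    -- In each case `IsRadialSolution.eq_sol` identifies `u` with the profile constructed for the
    -- same initial value, and the properties are read off from it.
    rintro ξ R u hu rfl
    refine ⟨fun h => ?_, fun h => ?_, fun h => ?_, fun h h' => ?_, fun h h' => ?_, fun h => ?_,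
      fun h h' => ?_⟩
    · have hz : g (u 0) = 0 := by
        rcases h with h | h | h <;> rw [h]
        · rw [hg.odd, hg.alpha_zero, neg_zero]
        · exact hg.zero
        · exact hg.alpha_zero
      obtain ⟨rfl, h1, -, -⟩ := hu.eq_sol hN hg.contDiff EReal.zero_lt_top (sol_const hz) rfl rfl
        (fun h => absurd rfl h)
      exact ⟨rfl, fun r hr => h1 ⟨hr, EReal.coe_lt_top r⟩⟩
    · obtain ⟨R', u', v', hR', hS, hu', hv', hneg, hlim⟩ := exists_sol_from_below hg h
      obtain ⟨rfl, -, h2, h3⟩ := hu.eq_sol hN hg.contDiff hR' hS hu' hv'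
        (maximal_of_tendsto_atBot hlim)
      exact ⟨fun r hr hrR => by rw [h2 r hr hrR]; exact hneg r hr hrR, hlim.congr' h3⟩
    · obtain ⟨R', u', v', hR', hS, hu', hv', hpos, hlim⟩ := exists_sol_above hg h
      obtain ⟨rfl, -, h2, h3⟩ := hu.eq_sol hN hg.contDiff hR' hS hu' hv'
        (maximal_of_tendsto_atTop hlim)
      exact ⟨fun r hr hrR => by rw [h2 r hr hrR]; exact hpos r hr hrR, hlim.congr' h3⟩
    · obtain ⟨u', v', hS, hu', hv', hpos, hlim⟩ :=
        exists_sol_rest hg le_rfl (neg_pos.2 h') (neg_lt.1 h)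
      obtain ⟨rfl, -, h2, h3⟩ := hu.eq_sol hN hg.contDiff EReal.zero_lt_top hS
        (by rw [hu', neg_neg]) hv' (fun h => absurd rfl h)
      rw [toLeft_top] at h3
      exact ⟨rfl, fun r hr => by rw [h2 r hr (EReal.coe_lt_top r)]; exact hpos r hr,
        hlim.congr' h3⟩
    · obtain ⟨R', u', v', hR', hS, hu', hv', hneg, hlim⟩ :=
        exists_sol_between_critical_alpha hg hs h h'
      obtain ⟨rfl, -, h2, h3⟩ := hu.eq_sol hN hg.contDiff hR' hS hu' hv'
        (maximal_of_tendsto_atBot hlim)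
      exact ⟨fun r hr hrR => by rw [h2 r hr hrR]; exact hneg r hr hrR, hlim.congr' h3⟩
    · obtain ⟨u', v', hS, hu', hv', hneg, hlim⟩ := exists_sol_at_critical hg hs
      obtain ⟨rfl, -, h2, h3⟩ := hu.eq_sol hN hg.contDiff EReal.zero_lt_top hS
        (hu'.trans h.symm) hv' (fun h => absurd rfl h)
      rw [toLeft_top] at h3
      exact ⟨rfl, fun r hr => by rw [h2 r hr (EReal.coe_lt_top r)]; exact hneg r hr,
        hlim.congr' h3⟩
    · obtain ⟨u', v', hS, hu', hv', b, hb, hneg, hub, hpos, hlim⟩ :=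
        exists_sol_between_zero_critical hg hs h h'
      obtain ⟨rfl, h1, h2, h3⟩ := hu.eq_sol hN hg.contDiff EReal.zero_lt_top hS hu' hv'
        (fun h => absurd rfl h)
      rw [toLeft_top] at h3
      refine ⟨rfl, b, hb, fun r hr => ?_, ?_, fun r hr => ?_, hlim.congr' h3⟩
      · rw [h2 r hr.1 (EReal.coe_lt_top r)]; exact hneg r hr
      · rwa [h1 ⟨hb.le, EReal.coe_lt_top b⟩]
      · rw [h2 r (hb.trans hr) (EReal.coe_lt_top r)]; exact hpos r hr
  refine ⟨fun ξ => ?_, ⟨ξs, hs, fun η hη => hs.unique hg hη, hclass⟩, fun R u hu => ?_⟩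
  · obtain ⟨R, u, v, hR, hS, hu0, hv0, hmax⟩ := exists_maximal_sol hg ξ
    refine ⟨R, u, hS.isRadialSolution hN hg.continuous hR hv0 hmax, hu0, fun R' w hw hw0 => ?_⟩
    obtain ⟨rfl, h1, -, -⟩ := hw.eq_sol hN hg.contDiff hR hS (hu0.trans hw0.symm) hv0 hmax
    exact ⟨rfl, h1⟩
  · obtain ⟨c1, c2, c3, c4, c5, c6, c7⟩ := hclass (u 0) R u hu rfl
    have hconst : (u 0 = -α ∨ u 0 = 0 ∨ u 0 = α) →
        ¬ IsOscillating R u ∧ ¬ IsNonconstantPeriodic R u := by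
      intro h
      obtain ⟨-, h1⟩ := c1 h
      refine ⟨?_, ?_⟩
      · rintro ⟨-, ⟨r, hr, hne⟩, hz⟩
        obtain ⟨s, -, hs0, hs⟩ := hz 0
        exact hne ((h1 r hr).trans ((h1 s hs0).symm.trans hs))
      · rintro ⟨-, ⟨r, hr, hne⟩, -⟩
        exact hne (h1 r hr)
    have hbot : Tendsto u (toLeft R) atBot →
        ¬ IsOscillating R u ∧ ¬ IsNonconstantPeriodic R u := by
      refine fun h => ⟨not_isOscillating_of_eventually ?_,
        not_isNonconstantPeriodic_of_tendsto_abs ?_⟩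
      · rintro rfl
        rw [toLeft_top] at h
        exact (h.eventually_lt_atBot 0).mono fun _ => ne_of_lt
      · rintro rfl
        rw [toLeft_top] at h
        exact tendsto_abs_atBot_atTop.comp h
    rcases lt_trichotomy (u 0) (-α) with h | h | h
    · exact hbot (c2 h).2
    · exact hconst (Or.inl h)
    rcases lt_trichotomy (u 0) 0 with h0 | h0 | h0
    · obtain ⟨-, h1, h2⟩ := c4 h h0
      exact ⟨not_isOscillating_of_eventually fun _ => eventually_ne_zero_of_increasing h1 h2,
        not_isNonconstantPeriodic_of_tendsto_nhds fun _ => h2⟩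
    · exact hconst (Or.inr (Or.inl h0))
    rcases lt_trichotomy (u 0) α with h1 | h1 | h1
    · rcases lt_trichotomy (u 0) ξs with h2 | h2 | h2
      · obtain ⟨-, b, -, -, -, h3, h4⟩ := c7 h0 h2
        exact ⟨not_isOscillating_of_eventually fun _ => eventually_ne_zero_of_increasing h3 h4,
          not_isNonconstantPeriodic_of_tendsto_nhds fun _ => h4⟩
      · obtain ⟨-, -, h3⟩ := c6 h2
        exact ⟨not_isOscillating_of_eventually fun _ => h3.eventually_ne (neg_ne_zero.2 hα.ne'),
          not_isNonconstantPeriodic_of_tendsto_nhds fun _ => h3⟩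
      · exact hbot (c5 h2 h1).2
    · exact hconst (Or.inr (Or.inr h1))
    · obtain ⟨-, h2⟩ := c3 h1
      refine ⟨not_isOscillating_of_eventually ?_, not_isNonconstantPeriodic_of_tendsto_abs ?_⟩
      · rintro rfl
        rw [toLeft_top] at h2
        exact (h2.eventually_gt_atTop 0).mono fun _ => ne_of_gt
      · rintro rfl
        rw [toLeft_top] at h2
        exact tendsto_abs_atTop_atTop.comp h2
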